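/- Oriented site percolation on the triangular lattice. Let $\mathcal L=\{(n,m)\in\mathbb Z^2: n+m \text{ even},\ n\ge 0\}$ and let $p\in[0,1]$. Under $P=P_p$ the sites of $\mathcal L$ are independently occupied, each with probability $p$. An occupied site $(n,m)$ has directed edges to $(n+1,m+1)$, $(n+2,m)$ and $(n+1,m-1)$; a site that is not occupied has none. For $z\in\mathcal L$ write $z\to w$ if there is a directed path of length $\ge 0$ from $z$ to $w$ (so $z\to z$ always). Let $o=(0,0)$, $\mathbf C_o=\{w: o\to w\}$, and $p_c=\inf\{p\in[0,1]: P_p(|\mathbf C_o|=\infty)>0\}$. Put $\overline u_0=0$ and, for $n\ge1$, $$\overline u_n=\sup\{x:\ \exists\, y\le 0 \text{ such that } (0,y)\to(n,x) \text{ or } (1,y)\to(n,x)\}\in[-\infty,\infty),$$ where all points are understood to be in $\mathcal L$. Let $\alpha[p]=\inf_{n\ge1}\frac1n\mathbb E_p[\overline u_n]\in[-\infty,1]$, let $\xi_n=\{x: o\to(n,x)\}$, and let $\tau=\inf\{n\ge 0:\xi_n=\varnothing\}$, with $\inf\varnothing=\infty$. **Lemma.** Let $p_c<p\le 1$. (1)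 Let $a\in\mathbb R$ with $a<\alpha[p]$. Then there are constants $C,\gamma>0$ (depending on $a$ and $p$) such that $P(\overline u_n\le an)\le Ce^{-\gamma n}$ for all $n\ge0$. In fact, with $\log 0=-\infty$, there is $\gamma\in(0,\infty]$ with $$\lim_{n\to\infty}\frac1n\log P(\overline u_n\le an)=\sup_{n\ge1}\frac1n\log P(\overline u_n\le an)=-\gamma<0,$$ and $P(\overline u_n\le an)\le e^{-\gamma n}$ for all $n\ge 0$ (where $e^{-\infty\cdot 0}=1$); moreover $\gamma<\infty$ if $p<1$. (2) There are constants $C,\gamma>0$ such that $P(n\le\tau<\infty)\le Ce^{-\gamma n}$ for all $n\ge0$. -/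

import Mathlib

open Filter Topology MeasureTheory ProbabilityTheory
open scoped ENNReal unitInterval

noncomputable section

namespace OTSP

/-- The lattice `{(n, m) ∈ ℤ² : n + m even, n ≥ 0}`; the first coordinate is the level. -/
def lattice : Set (ℤ × ℤ) := {z | Even (z.1 + z.2) ∧ 0 ≤ z.1}

/-- A percolation configuration: `ω z = true` means that the site `z` is occupied (open). Labels of
points outside `lattice` are never used. -/
abbrev Config : Type := ℤ × ℤ → Bool

/-- The i.i.d. law: every site is occupied with probability `p`, independently of the others. -/
def law (p : I) : Measure Config :=
  Measure.infinitePi fun _ : ℤ × ℤ => bernoulliMeasure true false p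

/-- An occupied site `(n, m)` of the lattice connects to `(n+1, m+1)`, `(n+2, m)`, `(n+1, m-1)`. -/
def Step (ω : Config) (z w : ℤ × ℤ) : Prop :=
  z ∈ lattice ∧ ω z = true ∧
    (w = (z.1 + 1, z.2 + 1) ∨ w = (z.1 + 2, z.2) ∨ w = (z.1 + 1, z.2 - 1))

/-- `z → w`: there is a path of zero or more steps from the lattice point `z` to `w`. Every lattice
point, occupied or not, is connected to itself. -/
def Connects (ω : Config) (z w : ℤ × ℤ) : Prop :=
  z ∈ lattice ∧ Relation.ReflTransGen (Step ω) z w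

/-- The forward cluster of the origin. -/
def cluster (ω : Config) : Set (ℤ × ℤ) := {w | Connects ω (0, 0) w}

/-- The probability that the forward cluster of the origin is infinite. -/
def percProb (p : I) : ℝ≥0∞ := law p {ω | (cluster ω).Infinite}

/-- The critical value `inf {p ∈ [0, 1] : P_p(|C_o| = ∞) > 0}`. -/
def criticalValue : ℝ := sInf {x : ℝ | ∃ p : I, (p : ℝ) = x ∧ 0 < percProb p}

/-- The heights `x` such that `(n, x)` is reached from the origin. -/
def reached (ω : Config) (n : ℕ) : Set ℤ := {x | Connects ω (0, 0) (n, x)}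

/-- The heights `x` such that `(n, x)` is reached from `(0, y)` or `(1, y)` for some `y ≤ 0`. -/
def reachedFromBelow (ω : Config) (n : ℕ) : Set ℤ :=
  {x | ∃ y : ℤ, y ≤ 0 ∧ (Connects ω (0, y) (n, x) ∨ Connects ω (1, y) (n, x))}

/-- `ū_n`, the highest point at level `n ≥ 1` reached from below the origin, with `ū_0 = 0`. The
supremum is taken in the extended reals, so it is `-∞` if no point is reached. -/
def upperEdge (ω : Config) (n : ℕ) : EReal :=
  if n = 0 then 0 else ⨆ x ∈ reachedFromBelow ω n, ((x : ℝ) : EReal)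

/-- The expectation of `ū_n`, as expectation of the positive part (which is at most `n`) minus
expectation of the negative part (which may be infinite). -/
def meanUpperEdge (p : I) (n : ℕ) : EReal :=
  ((∫⁻ ω, (upperEdge ω n).toENNReal ∂law p : ℝ≥0∞) : EReal) -
    ((∫⁻ ω, (-upperEdge ω n).toENNReal ∂law p : ℝ≥0∞) : EReal)

/-- The asymptotic slope `α[p] = inf_{n ≥ 1} E_p[ū_n] / n`. -/
def slope (p : I) : EReal := ⨅ (n : ℕ) (_ : 1 ≤ n), meanUpperEdge p n / (n : EReal)

/-- The first level at which nothing is reached from the origin; `∞` if there is no such level. -/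
def deathTime (ω : Config) : ℕ∞ := ⨅ (n : ℕ) (_ : reached ω n = ∅), (n : ℕ∞)

/-- `P_p(ū_n ≤ a n)`. -/
def lowProb (p : I) (a : ℝ) (n : ℕ) : ℝ≥0∞ :=
  law p {ω | upperEdge ω n ≤ ((a * n : ℝ) : EReal)}

/-- `(1/n) log P_p(ū_n ≤ a n)`, with `log 0 = -∞`. -/
def lowRate (p : I) (a : ℝ) (n : ℕ) : EReal := ENNReal.log (lowProb p a n) / (n : EReal)

end OTSP

end

noncomputable section

namespace OTSP

/-! ### Independent identically distributed fields -/

section Field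

variable {X : Type*} [MeasurableSpace X]

/-- The law of an i.i.d. field on `ℤ × ℤ` with marginal `ν`. -/
abbrev field (ν : Measure X) : Measure (ℤ × ℤ → X) := Measure.infinitePi fun _ => ν

/-- The σ-algebra generated by the values of the field on `S`. -/
@[reducible] def sig (X : Type*) [MeasurableSpace X] (S : Set (ℤ × ℤ)) : MeasurableSpace (ℤ × ℤ → X) :=
  ⨆ z ∈ S, MeasurableSpace.comap (fun ω => ω z) inferInstance

lemma sig_le (S : Set (ℤ × ℤ)) : sig X S ≤ MeasurableSpace.pi :=
  iSup₂_le fun z _ => (measurable_pi_apply z).comap_le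

lemma sig_mono {S T : Set (ℤ × ℤ)} (h : S ⊆ T) : sig X S ≤ sig X T :=
  biSup_mono h

lemma measurable_eval_sig {S : Set (ℤ × ℤ)} {z : ℤ × ℤ} (hz : z ∈ S) :
    Measurable[sig X S] (fun ω : ℤ × ℤ → X => ω z) :=
  Measurable.of_comap_le (le_biSup (f := fun z => MeasurableSpace.comap
    (fun ω : ℤ × ℤ → X => ω z) inferInstance) hz)

lemma measurable_sig_of_eval {Ω : Type*} {m : MeasurableSpace Ω} {S : Set (ℤ × ℤ)}
    {φ : Ω → ℤ × ℤ → X} (h : ∀ z ∈ S, Measurable (fun a => φ a z)) :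
    @Measurable _ _ m (sig X S) φ := by
  refine Measurable.of_le_map ?_
  refine iSup₂_le fun z hz => ?_
  rintro _ ⟨t, ht, rfl⟩
  exact h z hz ht

lemma indep_sig (ν : Measure X) [IsProbabilityMeasure ν] {S T : Set (ℤ × ℤ)}
    (h : Disjoint S T) : Indep (sig X S) (sig X T) (field ν) :=
  indep_iSup_of_disjoint (fun z => (measurable_pi_apply z).comap_le)
    (iIndepFun_infinitePi (X := fun _ (x : X) => x) fun _ => measurable_id) h

lemma measure_inter_eq_mul (ν : Measure X) [IsProbabilityMeasure ν] {S T : Set (ℤ × ℤ)}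
    (h : Disjoint S T) {A B : Set (ℤ × ℤ → X)} (hA : MeasurableSet[sig X S] A)
    (hB : MeasurableSet[sig X T] B) :
    field ν (A ∩ B) = field ν A * field ν B :=
  (Indep_iff _ _ _).1 (indep_sig ν h) A B hA hB

lemma lintegral_mul_eq_mul (ν : Measure X) [IsProbabilityMeasure ν] {S T : Set (ℤ × ℤ)}
    (h : Disjoint S T) {f g : (ℤ × ℤ → X) → ℝ≥0∞} (hf : Measurable[sig X S] f)
    (hg : Measurable[sig X T] g) :
    ∫⁻ ω, f ω * g ω ∂field ν = (∫⁻ ω, f ω ∂field ν) * ∫⁻ ω, g ω ∂field ν :=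
  lintegral_mul_eq_lintegral_mul_lintegral_of_independent_measurableSpace (sig_le S) (sig_le T)
    (indep_sig ν h) hf hg

/-- Events on pairwise disjoint regions are independent. -/
lemma measure_biInter_eq_prod (ν : Measure X) [IsProbabilityMeasure ν] {ι : Type*} (s : Finset ι)
    (R : ι → Set (ℤ × ℤ)) (hR : (s : Set ι).PairwiseDisjoint R) (A : ι → Set (ℤ × ℤ → X))
    (hA : ∀ i ∈ s, MeasurableSet[sig X (R i)] (A i)) :
    field ν (⋂ i ∈ s, A i) = ∏ i ∈ s, field ν (A i) := by
  classical
  induction s using Finset.induction_on with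
  | empty => simp
  | insert i s hi ih =>
    rw [Finset.set_biInter_insert, Finset.prod_insert hi,
      measure_inter_eq_mul ν (S := R i) (T := ⋃ j ∈ s, R j) ?_ (hA i (by simp)) ?_, ih]
    · exact hR.subset (by simp)
    · exact fun j hj => hA j (by simp [hj])
    · simp only [Set.disjoint_iUnion_right]
      intro j hj
      exact hR (by simp) (by simp [hj]) (by rintro rfl; exact hi hj)
    · refine Finset.measurableSet_biInter _ fun j hj => ?_
      exact sig_mono (Set.subset_biUnion_of_mem (u := R) (by simpa using hj)) _
        (hA j (by simp [hj]))

/-- Reindexing a field. -/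
def reindex {X : Type*} (f : ℤ × ℤ → ℤ × ℤ) (ω : ℤ × ℤ → X) : ℤ × ℤ → X := fun z => ω (f z)

lemma measurable_reindex (f : ℤ × ℤ → ℤ × ℤ) : Measurable (reindex (X := X) f) :=
  measurable_pi_lambda _ fun z => measurable_pi_apply (f z)

lemma measurable_reindex_sig (f : ℤ × ℤ → ℤ × ℤ) {S T : Set (ℤ × ℤ)} (h : ∀ z ∈ S, f z ∈ T) :
    @Measurable _ _ (sig X T) (sig X S) (reindex f) :=
  @measurable_sig_of_eval _ _ _ (sig X T) _ _ fun z hz => measurable_eval_sig (h z hz)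

lemma measurePreserving_reindex (ν : Measure X) [IsProbabilityMeasure ν] {f : ℤ × ℤ → ℤ × ℤ}
    (hf : Function.Injective f) : MeasurePreserving (reindex f) (field ν) (field ν) :=
  ⟨measurable_reindex f, Measure.map_infinitePi_infinitePi_of_inj (P := fun _ => ν) hf⟩

/-- The field seen from `v`. -/
def shift {X : Type*} (v : ℤ × ℤ) (ω : ℤ × ℤ → X) : ℤ × ℤ → X := reindex (fun z => z + v) ω

@[simp] lemma shift_apply {X : Type*} (v : ℤ × ℤ) (ω : ℤ × ℤ → X) (z : ℤ × ℤ) : shift v ω z = ω (z + v) := rfl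

lemma measurePreserving_shift (ν : Measure X) [IsProbabilityMeasure ν] (v : ℤ × ℤ) :
    MeasurePreserving (shift v) (field ν) (field ν) :=
  measurePreserving_reindex ν (add_left_injective v)

/-- The field reflected in the horizontal axis. -/
def refl {X : Type*} (ω : ℤ × ℤ → X) : ℤ × ℤ → X := reindex (fun z => (z.1, -z.2)) ω

@[simp] lemma refl_apply {X : Type*} (ω : ℤ × ℤ → X) (z : ℤ × ℤ) : refl ω z = ω (z.1, -z.2) := rfl

lemma measurePreserving_refl (ν : Measure X) [IsProbabilityMeasure ν] :
    MeasurePreserving refl (field ν) (field ν) :=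
  measurePreserving_reindex ν fun z w h => by
    simp only [Prod.mk.injEq, neg_inj] at h
    exact Prod.ext h.1 h.2

end Field

instance (p : I) : IsProbabilityMeasure (law p) := by unfold law; infer_instance

/-! ### Steps and connections -/

lemma Step.level_lt {ω : Config} {z w : ℤ × ℤ} (h : Step ω z w) : z.1 < w.1 := by
  rcases h with ⟨_, _, rfl | rfl | rfl⟩ <;> simp

lemma Step.mem_lattice {ω : Config} {z w : ℤ × ℤ} (h : Step ω z w) : w ∈ lattice := by
  rcases h with ⟨⟨h1, h2⟩, _, rfl | rfl | rfl⟩ <;> constructor <;> grind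

lemma Step.height_le {ω : Config} {z w : ℤ × ℤ} (h : Step ω z w) : w.2 ≤ z.2 + (w.1 - z.1) := by
  rcases h with ⟨_, _, rfl | rfl | rfl⟩ <;> simp; omega

/-- A step from a site of the region `R`. -/
def StepIn (R : Set (ℤ × ℤ)) (ω : Config) (z w : ℤ × ℤ) : Prop := z ∈ R ∧ Step ω z w

/-- A path all of whose sites, except possibly the last one, lie in `R`. -/
def PathIn (R : Set (ℤ × ℤ)) (ω : Config) : ℤ × ℤ → ℤ × ℤ → Prop :=
  Relation.ReflTransGen (StepIn R ω)

lemma PathIn.mono {R S : Set (ℤ × ℤ)} (h : R ⊆ S) {ω : Config} {z w : ℤ × ℤ}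
    (hp : PathIn R ω z w) : PathIn S ω z w :=
  Relation.ReflTransGen.mono (fun _ _ hs => ⟨h hs.1, hs.2⟩) _ _ hp

lemma PathIn.path {R : Set (ℤ × ℤ)} {ω : Config} {z w : ℤ × ℤ}
    (hp : PathIn R ω z w) : Relation.ReflTransGen (Step ω) z w :=
  Relation.ReflTransGen.mono (fun _ _ hs => hs.2) _ _ hp

lemma path_level_le {ω : Config} {z w : ℤ × ℤ} (h : Relation.ReflTransGen (Step ω) z w) :
    z.1 ≤ w.1 := by
  induction h with
  | refl => rfl
  | tail _ h ih => exact ih.trans h.level_lt.le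

lemma path_height_le {ω : Config} {z w : ℤ × ℤ} (h : Relation.ReflTransGen (Step ω) z w) :
    w.2 ≤ z.2 + (w.1 - z.1) := by
  induction h with
  | refl => simp
  | tail _ h ih => linarith [h.height_le]

lemma path_mem_lattice {ω : Config} {z w : ℤ × ℤ} (h : Relation.ReflTransGen (Step ω) z w)
    (hz : z ∈ lattice) : w ∈ lattice := by
  induction h with
  | refl => exact hz
  | tail _ h ih => exact h.mem_lattice

lemma measurableSet_pathIn (R : Set (ℤ × ℤ)) (z w : ℤ × ℤ) :
    MeasurableSet[sig Bool R] {ω : Config | PathIn R ω z w} := by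
  let A : ℕ → ℤ × ℤ → Set Config := fun n => Nat.rec (fun z => {_ω | z = w})
    (fun _ B z => ⋃ v, {ω | StepIn R ω z v} ∩ B v) n
  have hA : ∀ n z, MeasurableSet[sig Bool R] (A n z) := by
    intro n
    induction n with
    | zero => exact fun z => MeasurableSet.const _
    | succ n ih =>
      intro z
      refine MeasurableSet.iUnion fun v => MeasurableSet.inter ?_ (ih v)
      by_cases hz : z ∈ R
      · have : {ω : Config | StepIn R ω z v} = (fun ω : Config => ω z) ⁻¹' {true} ∩
            {_ω | z ∈ lattice ∧
              (v = (z.1 + 1, z.2 + 1) ∨ v = (z.1 + 2, z.2) ∨ v = (z.1 + 1, z.2 - 1))} := by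
          ext ω; simp only [StepIn, Step, hz, Set.mem_ofPred_eq, Set.mem_inter_iff,
            Set.mem_preimage, Set.mem_singleton_iff]; tauto
        rw [this]
        refine @MeasurableSet.inter _ (sig Bool R) _ _ ?_ (@MeasurableSet.const _ (sig Bool R) _)
        exact measurable_eval_sig hz (measurableSet_singleton true)
      · have : {ω : Config | StepIn R ω z v} = ∅ := by
          ext ω; simp [StepIn, hz]
        rw [this]; exact @MeasurableSet.empty _ (sig Bool R)
  have : {ω : Config | PathIn R ω z w} = ⋃ n, A n z := by
    ext ω
    simp only [Set.mem_ofPred_eq, Set.mem_iUnion]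
    constructor
    · intro h
      induction h using Relation.ReflTransGen.head_induction_on with
      | refl => exact ⟨0, rfl⟩
      | head h _ ih =>
        obtain ⟨n, hn⟩ := ih
        exact ⟨n + 1, Set.mem_iUnion.2 ⟨_, h, hn⟩⟩
    · rintro ⟨n, hn⟩
      induction n generalizing z with
      | zero => exact (show z = w from hn) ▸ Relation.ReflTransGen.refl
      | succ n ih =>
        obtain ⟨v, hv, hn⟩ := Set.mem_iUnion.1 hn
        exact Relation.ReflTransGen.head hv (ih v hn)
  rw [this]
  exact MeasurableSet.iUnion fun n => hA n z

/-- The sites with level in `[a, b)`. -/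
def slab (a b : ℤ) : Set (ℤ × ℤ) := {z | a ≤ z.1 ∧ z.1 < b}

/-- The sites with level at least `a`. -/
def levelGe (a : ℤ) : Set (ℤ × ℤ) := {z | a ≤ z.1}

lemma pathIn_slab_iff {ω : Config} {z w : ℤ × ℤ} {a b : ℤ} (ha : a ≤ z.1) (hb : w.1 ≤ b) :
    PathIn (slab a b) ω z w ↔ Relation.ReflTransGen (Step ω) z w := by
  refine ⟨PathIn.path, fun h => ?_⟩
  induction h using Relation.ReflTransGen.head_induction_on with
  | refl => exact Relation.ReflTransGen.refl
  | head h h' ih =>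
    exact Relation.ReflTransGen.head ⟨⟨ha, h.level_lt.trans_le ((path_level_le h').trans hb)⟩, h⟩
      (ih (ha.trans h.level_lt.le))

lemma measurableSet_connects {z w : ℤ × ℤ} {a b : ℤ} (ha : a ≤ z.1) (hb : w.1 ≤ b) :
    MeasurableSet[sig Bool (slab a b)] {ω : Config | Connects ω z w} := by
  have : {ω : Config | Connects ω z w} =
      {_ω | z ∈ lattice} ∩ {ω | PathIn (slab a b) ω z w} := by
    ext ω; simp [Connects, pathIn_slab_iff ha hb]
  rw [this]
  exact (MeasurableSet.const _).inter (measurableSet_pathIn _ _ _)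

lemma step_shift_iff {ω : Config} {v z w : ℤ × ℤ} (hv : v ∈ lattice) (hz : 0 ≤ z.1) :
    Step (shift v ω) z w ↔ Step ω (z + v) (w + v) := by
  obtain ⟨hv1, hv2⟩ := hv
  have h1 : z ∈ lattice ↔ z + v ∈ lattice := by
    simp only [lattice, Set.mem_ofPred_eq, Prod.fst_add, Prod.snd_add]; grind
  simp only [Step, shift_apply, ← h1, Prod.ext_iff, Prod.fst_add, Prod.snd_add]
  refine and_congr_right fun _ => and_congr_right fun _ => ?_
  refine or_congr ?_ (or_congr ?_ ?_) <;> refine and_congr ?_ ?_ <;> constructor <;> intro <;> omega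

lemma pathIn_shift_iff {R : Set (ℤ × ℤ)} {ω : Config} {v z w : ℤ × ℤ} (hv : v ∈ lattice)
    (hz : 0 ≤ z.1) :
    PathIn R (shift v ω) z w ↔ PathIn ((fun z => z - v) ⁻¹' R) ω (z + v) (w + v) := by
  constructor
  · intro h
    induction h with
    | refl => exact Relation.ReflTransGen.refl
    | tail h h' ih =>
      refine ih.tail ⟨by simpa using h'.1, (step_shift_iff hv ?_).1 h'.2⟩
      exact hz.trans (path_level_le (PathIn.path h))
  · intro h
    generalize hz' : z + v = z' at h
    generalize hw' : w + v = w' at h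
    induction h using Relation.ReflTransGen.head_induction_on generalizing z with
    | refl =>
      have : z = w := add_right_cancel (hz'.trans hw'.symm)
      subst this; exact Relation.ReflTransGen.refl
    | @head a c h h' ih =>
      subst hz'
      have hc : z.1 ≤ (c - v).1 := by
        have := h.2.level_lt; simp at this ⊢; omega
      refine Relation.ReflTransGen.head (b := c - v) ⟨by simpa using h.1, ?_⟩
        (ih (hz.trans hc) (by simp))
      exact (step_shift_iff hv hz).2 (by simpa using h.2)

lemma path_iff_pathIn {ω : Config} {z w : ℤ × ℤ} :
    PathIn Set.univ ω z w ↔ Relation.ReflTransGen (Step ω) z w :=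
  ⟨PathIn.path, fun h => Relation.ReflTransGen.mono (fun _ _ hs => ⟨trivial, hs⟩) _ _ h⟩

lemma connects_shift_iff {ω : Config} {v z w : ℤ × ℤ} (hv : v ∈ lattice) (hz : 0 ≤ z.1) :
    Connects (shift v ω) z w ↔ Connects ω (z + v) (w + v) := by
  have h1 : z ∈ lattice ↔ z + v ∈ lattice := by
    obtain ⟨hv1, hv2⟩ := hv
    simp only [lattice, Set.mem_ofPred_eq, Prod.fst_add, Prod.snd_add]; grind
  have h2 := pathIn_shift_iff (R := Set.univ) (ω := ω) (w := w) hv hz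
  rw [Set.preimage_univ, path_iff_pathIn, path_iff_pathIn] at h2
  rw [Connects, Connects, h1, h2]

lemma step_refl_iff {ω : Config} {z w : ℤ × ℤ} :
    Step (refl ω) z w ↔ Step ω (z.1, -z.2) (w.1, -w.2) := by
  have h1 : z ∈ lattice ↔ (z.1, -z.2) ∈ lattice := by
    simp only [lattice, Set.mem_ofPred_eq]; grind
  simp only [Step, refl_apply, ← h1, Prod.ext_iff]
  refine and_congr_right fun _ => and_congr_right fun _ => ?_
  constructor
  · rintro (h | h | h)
    · exact Or.inr (Or.inr ⟨h.1, by omega⟩)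
    · exact Or.inr (Or.inl ⟨h.1, by omega⟩)
    · exact Or.inl ⟨h.1, by omega⟩
  · rintro (h | h | h)
    · exact Or.inr (Or.inr ⟨h.1, by omega⟩)
    · exact Or.inr (Or.inl ⟨h.1, by omega⟩)
    · exact Or.inl ⟨h.1, by omega⟩

lemma refl_refl (ω : Config) : refl (refl ω) = ω := by ext z; simp

lemma path_refl {ω : Config} {z w : ℤ × ℤ} (h : Relation.ReflTransGen (Step (refl ω)) z w) :
    Relation.ReflTransGen (Step ω) (z.1, -z.2) (w.1, -w.2) := by
  induction h with
  | refl => exact Relation.ReflTransGen.refl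
  | tail _ h ih => exact ih.tail (step_refl_iff.1 h)

lemma connects_refl_iff {ω : Config} {z w : ℤ × ℤ} :
    Connects (refl ω) z w ↔ Connects ω (z.1, -z.2) (w.1, -w.2) := by
  have h1 : z ∈ lattice ↔ (z.1, -z.2) ∈ lattice := by
    simp only [lattice, Set.mem_ofPred_eq]; grind
  refine and_congr h1 ⟨path_refl, fun h => ?_⟩
  rw [← refl_refl ω] at h
  simpa using path_refl h

/-! ### The upper edge -/

/-- A path from level at most `n` to level at least `n` visits level `n` or jumps over it. -/
lemma path_split {ω : Config} {z w : ℤ × ℤ} (h : Relation.ReflTransGen (Step ω) z w) {n : ℤ}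
    (h1 : z.1 ≤ n) (h2 : n ≤ w.1) :
    (∃ x, Relation.ReflTransGen (Step ω) z (n, x) ∧ Relation.ReflTransGen (Step ω) (n, x) w) ∨
    (∃ x, Relation.ReflTransGen (Step ω) z (n - 1, x) ∧ Step ω (n - 1, x) (n + 1, x) ∧
      Relation.ReflTransGen (Step ω) (n + 1, x) w) := by
  induction h using Relation.ReflTransGen.head_induction_on with
  | refl => exact Or.inl ⟨w.2, by rw [show (n, w.2) = w from Prod.ext (le_antisymm h2 h1) rfl]; exact ⟨.refl, .refl⟩⟩
  | @head a c h h' ih =>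
    rcases h1.eq_or_lt with h1 | h1
    · refine Or.inl ⟨a.2, ?_⟩
      rw [show (n, a.2) = a from Prod.ext h1.symm rfl]
      exact ⟨.refl, .head h h'⟩
    · rcases le_or_gt c.1 n with hc | hc
      · rcases ih hc with ⟨x, hx, hx'⟩ | ⟨x, hx, hx'⟩
        · exact Or.inl ⟨x, .head h hx, hx'⟩
        · exact Or.inr ⟨x, .head h hx, hx'⟩
      · have : a = (n - 1, a.2) ∧ c = (n + 1, a.2) := by
          rcases h with ⟨_, _, rfl | rfl | rfl⟩ <;> simp only [Prod.ext_iff, and_true] <;> dsimp only at hc ⊢ <;> omega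
        refine Or.inr ⟨a.2, ?_⟩
        rw [← this.1, ← this.2]
        exact ⟨.refl, h, h'⟩

lemma step_up {ω : Config} {z w : ℤ × ℤ} (h : Step ω z w) : Step ω z (z.1 + 1, z.2 + 1) :=
  ⟨h.1, h.2.1, Or.inl rfl⟩

lemma step_mono {ω ω' : Config} {z w : ℤ × ℤ} (h : ω z = true → ω' z = true) (hs : Step ω z w) :
    Step ω' z w := ⟨hs.1, h hs.2.1, hs.2.2⟩

lemma le_of_mem_reachedFromBelow {ω : Config} {n : ℕ} {x : ℤ} (h : x ∈ reachedFromBelow ω n) :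
    x ≤ n := by
  obtain ⟨y, hy, h | h⟩ := h <;> have := path_height_le h.2 <;> simp at this <;> omega

lemma mem_lattice_of_mem_reachedFromBelow {ω : Config} {n : ℕ} {x : ℤ}
    (h : x ∈ reachedFromBelow ω n) : ((n : ℤ), x) ∈ lattice := by
  obtain ⟨y, hy, h | h⟩ := h <;> exact path_mem_lattice h.2 h.1

lemma reachedFromBelow_zero (ω : Config) : reachedFromBelow ω 0 = {x | x ≤ 0 ∧ Even x} := by
  ext x
  constructor
  · intro h
    have h1 := le_of_mem_reachedFromBelow h
    have h2 := (mem_lattice_of_mem_reachedFromBelow h).1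
    exact ⟨by simpa using h1, by simpa using h2⟩
  · rintro ⟨h1, h2⟩
    exact ⟨x, h1, Or.inl ⟨⟨by simpa using h2, le_rfl⟩, by simp [Relation.ReflTransGen.refl]⟩⟩

lemma upperEdge_eq_iSup (ω : Config) (n : ℕ) :
    upperEdge ω n = ⨆ x ∈ reachedFromBelow ω n, ((x : ℝ) : EReal) := by
  rw [upperEdge]
  split_ifs with h
  · subst h
    refine le_antisymm ?_ (iSup₂_le fun x hx => ?_)
    · refine le_iSup₂_of_le (0 : ℤ) ?_ (by simp)
      rw [reachedFromBelow_zero]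
      exact ⟨le_rfl, Even.zero⟩
    · rw [reachedFromBelow_zero] at hx
      exact_mod_cast hx.1
  · rfl

lemma upperEdge_zero (ω : Config) : upperEdge ω 0 = 0 := by simp [upperEdge]

lemma upperEdge_le_iff {ω : Config} {n : ℕ} {c : EReal} :
    upperEdge ω n ≤ c ↔ ∀ x ∈ reachedFromBelow ω n, ((x : ℝ) : EReal) ≤ c := by
  rw [upperEdge_eq_iSup, iSup₂_le_iff]

lemma le_upperEdge {ω : Config} {n : ℕ} {x : ℤ} (h : x ∈ reachedFromBelow ω n) :
    ((x : ℝ) : EReal) ≤ upperEdge ω n := upperEdge_le_iff.1 le_rfl x h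

lemma upperEdge_le (ω : Config) (n : ℕ) : upperEdge ω n ≤ ((n : ℝ) : EReal) :=
  upperEdge_le_iff.2 fun _ hx => by exact_mod_cast le_of_mem_reachedFromBelow hx

/-- The upper edge is attained, unless nothing is reached. -/
lemma upperEdge_cases (ω : Config) (n : ℕ) :
    (upperEdge ω n = ⊥ ∧ reachedFromBelow ω n = ∅) ∨
    ∃ x ∈ reachedFromBelow ω n, upperEdge ω n = ((x : ℝ) : EReal) ∧
      ∀ y ∈ reachedFromBelow ω n, y ≤ x := by
  rcases (reachedFromBelow ω n).eq_empty_or_nonempty with h | h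
  · left; refine ⟨?_, h⟩; rw [upperEdge_eq_iSup, h]; simp
  · right
    obtain ⟨x, hx, hmax⟩ := Int.exists_greatest_of_bdd
      (P := fun x => x ∈ reachedFromBelow ω n) ⟨n, fun z hz => le_of_mem_reachedFromBelow hz⟩ h
    refine ⟨x, hx, le_antisymm (upperEdge_le_iff.2 fun y hy => ?_) (le_upperEdge hx), hmax⟩
    exact_mod_cast hmax y hy

lemma upperEdge_eq_coe_iff {ω : Config} {n : ℕ} {x : ℤ} :
    upperEdge ω n = ((x : ℝ) : EReal) ↔
      x ∈ reachedFromBelow ω n ∧ ∀ y ∈ reachedFromBelow ω n, y ≤ x := by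
  rcases upperEdge_cases ω n with ⟨h, h'⟩ | ⟨x', hx', h, h'⟩
  · simp [h, h']
  · rw [h]
    constructor
    · intro e
      have : x' = x := by exact_mod_cast e
      subst this; exact ⟨hx', h'⟩
    · rintro ⟨h1, h2⟩
      rw [le_antisymm (h2 _ hx') (h' _ h1)]

lemma measurableSet_mem_reachedFromBelow (n : ℕ) (x : ℤ) :
    MeasurableSet[sig Bool (slab 0 n)] {ω : Config | x ∈ reachedFromBelow ω n} := by
  have : {ω : Config | x ∈ reachedFromBelow ω n} =
      ⋃ y : ℤ, {_ω | y ≤ 0} ∩ ({ω | Connects ω (0, y) (n, x)} ∪ {ω | Connects ω (1, y) (n, x)}) := by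
    ext ω; simp [reachedFromBelow]
  rw [this]
  refine MeasurableSet.iUnion fun y => ?_
  exact (@MeasurableSet.const _ (sig Bool (slab 0 n)) _).inter
    ((measurableSet_connects (by simp) (by simp)).union (measurableSet_connects (by simp) (by simp)))

lemma measurable_upperEdge_sig (n : ℕ) :
    Measurable[sig Bool (slab 0 n)] (fun ω : Config => upperEdge ω n) := by
  classical
  have : (fun ω : Config => upperEdge ω n) =
      fun ω => ⨆ x : ℤ, if x ∈ reachedFromBelow ω n then ((x : ℝ) : EReal) else ⊥ := by
    ext ω
    rw [upperEdge_eq_iSup]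
    congr 1; ext x
    split_ifs with h <;> simp [h]
  rw [this]
  refine Measurable.iSup fun x => ?_
  exact Measurable.ite (measurableSet_mem_reachedFromBelow n x) measurable_const measurable_const

lemma measurable_upperEdge (n : ℕ) : Measurable (fun ω : Config => upperEdge ω n) :=
  (measurable_upperEdge_sig n).mono (sig_le _) le_rfl

lemma disjoint_slab_levelGe (a b : ℤ) : Disjoint (slab a b) (levelGe b) :=
  Set.disjoint_left.2 fun _ h h' => absurd h.2 (not_lt.2 h')

/-- If the upper edge at level `n` is `x`, then whatever is reached later is reached from below
`(n, x)`. -/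
lemma sub_mem_reachedFromBelow_shift {ω : Config} {n m : ℕ} {x y : ℤ}
    (hx : ∀ y ∈ reachedFromBelow ω n, y ≤ x) (hl : ((n : ℤ), x) ∈ lattice)
    (hy : y ∈ reachedFromBelow ω (n + m)) :
    y - x ∈ reachedFromBelow (shift (n, x) ω) m := by
  have key : ∀ s : ℤ, (s = 0 ∨ s = 1) → ∀ y0 ≤ 0, Connects ω (s, y0) ((n + m : ℕ), y) →
      y - x ∈ reachedFromBelow (shift (n, x) ω) m := by
    intro s hs y0 hy0 hc
    rcases le_or_gt s n with hsn | hsn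
    · have hmem : ∀ x', Relation.ReflTransGen (Step ω) (s, y0) (n, x') →
          x' ∈ reachedFromBelow ω n := by
        intro x' h
        refine ⟨y0, hy0, ?_⟩
        rcases hs with rfl | rfl
        · exact Or.inl ⟨hc.1, h⟩
        · exact Or.inr ⟨hc.1, h⟩
      rcases path_split hc.2 (n := n) hsn (by simp) with ⟨x', h1, h2⟩ | ⟨x', h1, h2, h3⟩
      · refine ⟨x' - x, by linarith [hx x' (hmem x' h1)], Or.inl ?_⟩
        rw [connects_shift_iff hl (by simp)]
        refine ⟨?_, ?_⟩
        · simpa using path_mem_lattice h1 hc.1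
        · simpa [add_comm] using h2
      · have h4 := hmem (x' + 1) (h1.tail (by simpa using step_up h2))
        refine ⟨x' - x, by linarith [hx _ h4], Or.inr ?_⟩
        rw [connects_shift_iff hl (by simp)]
        refine ⟨?_, ?_⟩
        · simpa [add_comm] using h2.mem_lattice
        · simpa [add_comm] using h3
    · have hn : n = 0 := by omega
      have hs : s = 1 := by omega
      subst hn hs
      have h0 : 0 ≤ x := hx 0 (by rw [reachedFromBelow_zero]; exact ⟨le_rfl, Even.zero⟩)
      refine ⟨y0 - x, by linarith, Or.inr ?_⟩
      rw [connects_shift_iff hl (by simp)]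
      simpa using hc
  obtain ⟨y0, hy0, h | h⟩ := hy
  · exact key 0 (Or.inl rfl) y0 hy0 h
  · exact key 1 (Or.inr rfl) y0 hy0 h

lemma upperEdge_add_le {ω : Config} {n m : ℕ} {x : ℤ} (h : upperEdge ω n = ((x : ℝ) : EReal)) :
    upperEdge ω (n + m) ≤ ((x : ℝ) : EReal) + upperEdge (shift (n, x) ω) m := by
  rw [upperEdge_eq_coe_iff] at h
  refine upperEdge_le_iff.2 fun y hy => ?_
  have := le_upperEdge (sub_mem_reachedFromBelow_shift h.2
    (mem_lattice_of_mem_reachedFromBelow h.1) hy)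
  calc ((y : ℝ) : EReal) = ((x : ℝ) : EReal) + (((y - x : ℤ) : ℝ) : EReal) := by
        rw [← EReal.coe_add]; push_cast; congr 1; ring
    _ ≤ _ := add_le_add_right this _

lemma upperEdge_add_eq_bot {ω : Config} {n m : ℕ} (h : upperEdge ω n = ⊥) :
    upperEdge ω (n + m) = ⊥ := by
  rcases upperEdge_cases ω n with ⟨-, h'⟩ | ⟨x, _, h', _⟩
  · rcases upperEdge_cases ω (n + m) with ⟨h1, -⟩ | ⟨y, hy, -, -⟩
    · exact h1
    · exfalso
      have hbig : ∃ x : ℤ, x ≤ y - m - 2 ∧ ((n : ℤ), x) ∈ lattice := by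
        rcases Int.even_or_odd (n + (y - m - 2)) with he | ho
        · exact ⟨_, le_rfl, he, by simp⟩
        · exact ⟨y - m - 3, by omega, by
            have : (n : ℤ) + (y - m - 3) = n + (y - m - 2) - 1 := by ring
            simpa [this] using ho.sub_odd odd_one, by simp⟩
      obtain ⟨x, hx, hxl⟩ := hbig
      have h2 := sub_mem_reachedFromBelow_shift (x := x) (by simp [h']) hxl hy
      have h3 := le_of_mem_reachedFromBelow h2
      omega
  · simp [h'] at h

lemma path_mono {ω ω' : Config} {z w : ℤ × ℤ} (hω : ∀ v, z.1 ≤ v.1 → v.1 < w.1 →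
    ω v = true → ω' v = true) (h : Relation.ReflTransGen (Step ω) z w) :
    Relation.ReflTransGen (Step ω') z w := by
  induction h using Relation.ReflTransGen.head_induction_on with
  | refl => exact .refl
  | head h h' ih =>
    refine .head (step_mono (hω _ le_rfl (h.level_lt.trans_le (path_level_le h'))) h) (ih ?_)
    exact fun v hv hv' => hω v (h.level_lt.le.trans hv) hv'

lemma reachedFromBelow_mono {ω ω' : Config} {n : ℕ}
    (hω : ∀ v : ℤ × ℤ, 0 ≤ v.1 → v.1 < n → ω v = true → ω' v = true) :
    reachedFromBelow ω n ⊆ reachedFromBelow ω' n := by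
  rintro x ⟨y, hy, h | h⟩
  · exact ⟨y, hy, Or.inl ⟨h.1, path_mono hω h.2⟩⟩
  · exact ⟨y, hy, Or.inr ⟨h.1, path_mono (fun v hv => hω v (by simp at hv; omega)) h.2⟩⟩

lemma upperEdge_mono {ω ω' : Config} {n : ℕ}
    (hω : ∀ v : ℤ × ℤ, 0 ≤ v.1 → v.1 < n → ω v = true → ω' v = true) :
    upperEdge ω n ≤ upperEdge ω' n :=
  upperEdge_le_iff.2 fun _ hx => le_upperEdge (reachedFromBelow_mono hω hx)

/-! ### Restarting at the upper edge; exponential moments -/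

/-- The event that the upper edge at level `n` is at height `x`. -/
def edgeAt (n : ℕ) (x : ℤ) : Set Config := {ω | upperEdge ω n = ((x : ℝ) : EReal)}

lemma measurableSet_edgeAt_sig (n : ℕ) (x : ℤ) : MeasurableSet[sig Bool (slab 0 n)] (edgeAt n x) :=
  measurable_upperEdge_sig n (measurableSet_singleton _)

lemma measurableSet_edgeAt (n : ℕ) (x : ℤ) : MeasurableSet (edgeAt n x) :=
  sig_le _ _ (measurableSet_edgeAt_sig n x)

lemma tsum_indicator_edgeAt {ω : Config} {n : ℕ} {x : ℤ} (h : ω ∈ edgeAt n x)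
    (F : ℤ → ℝ≥0∞) : ∑' y, (edgeAt n y).indicator (fun _ => F y) ω = F x := by
  rw [tsum_eq_single x]
  · simp [h]
  · intro y hy
    refine Set.indicator_of_notMem (fun h' => hy ?_) _
    have : ((y : ℝ) : EReal) = ((x : ℝ) : EReal) := h'.symm.trans h
    exact_mod_cast this

lemma tsum_indicator_edgeAt_of_bot {ω : Config} {n : ℕ} (h : upperEdge ω n = ⊥)
    (F : ℤ → ℝ≥0∞) : ∑' y, (edgeAt n y).indicator (fun _ => F y) ω = 0 := by
  refine ENNReal.tsum_eq_zero.2 fun y => Set.indicator_of_notMem (fun h' => ?_) _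
  simp [edgeAt, h] at h'

lemma exists_edgeAt {ω : Config} {n : ℕ} (h : upperEdge ω n ≠ ⊥) : ∃ x, ω ∈ edgeAt n x := by
  rcases upperEdge_cases ω n with ⟨h', _⟩ | ⟨x, _, h', _⟩
  · exact absurd h' h
  · exact ⟨x, h'⟩

/-- The environment seen from the upper edge is independent of the upper edge. -/
lemma lintegral_restart (p : I) (n : ℕ) (c : ℤ → ℝ≥0∞) {g : Config → ℝ≥0∞}
    (hg : Measurable[sig Bool (levelGe 0)] g) :
    ∫⁻ ω, ∑' x, (edgeAt n x).indicator (fun _ => c x * g (shift (n, x) ω)) ω ∂law p =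
      (∫⁻ ω, ∑' x, (edgeAt n x).indicator (fun _ => c x) ω ∂law p) * ∫⁻ ω, g ω ∂law p := by
  have hgs : ∀ x : ℤ, Measurable[sig Bool (levelGe n)] fun ω : Config => g (shift (n, x) ω) :=
    fun x => hg.comp (measurable_reindex_sig _ fun z hz => by
      simp only [levelGe, Set.mem_ofPred_eq, Prod.fst_add] at hz ⊢; omega)
  have hind : ∀ x, Measurable[sig Bool (slab 0 n)] ((edgeAt n x).indicator fun _ => c x) :=
    fun x => Measurable.indicator measurable_const (measurableSet_edgeAt_sig n x)
  have heq : ∀ (x : ℤ) (ω : Config), (edgeAt n x).indicator (fun _ => c x * g (shift (n, x) ω)) ω =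
      (edgeAt n x).indicator (fun _ => c x) ω * g (shift (n, x) ω) := by
    intro x ω
    by_cases h : ω ∈ edgeAt n x <;> simp [h]
  simp_rw [heq]
  rw [lintegral_tsum, lintegral_tsum, ← ENNReal.tsum_mul_right]
  · congr 1; ext x
    have := lintegral_mul_eq_mul (bernoulliMeasure true false p) (disjoint_slab_levelGe 0 n)
      (hind x) (hgs x)
    refine this.trans ?_
    congr 1
    exact (measurePreserving_shift (bernoulliMeasure true false p) (n, x)).lintegral_comp
      (hg.mono (sig_le _) le_rfl)
  · exact fun x => ((hind x).mono (sig_le _) le_rfl).aemeasurable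
  · exact fun x => (((hind x).mono (sig_le _) le_rfl).mul
      ((hgs x).mono (sig_le _) le_rfl)).aemeasurable

lemma measurable_upperEdge_sig' (n : ℕ) :
    Measurable[sig Bool (levelGe 0)] (fun ω : Config => upperEdge ω n) :=
  (measurable_upperEdge_sig n).mono (sig_mono fun _ h => h.1) le_rfl

lemma measurableSet_upperEdge_le (n : ℕ) (c : EReal) :
    MeasurableSet {ω : Config | upperEdge ω n ≤ c} :=
  measurable_upperEdge n measurableSet_Iic

/-- `P(ū_n ≤ an)` is supermultiplicative. -/
lemma lowProb_mul_le (p : I) (a : ℝ) (n m : ℕ) :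
    lowProb p a n * lowProb p a m ≤ lowProb p a (n + m) := by
  classical
  set B : Set Config := {ω | upperEdge ω n = ⊥} with hB
  have hBm : MeasurableSet B := measurable_upperEdge n (measurableSet_singleton _)
  set g : Config → ℝ≥0∞ := {ω | upperEdge ω m ≤ ((a * m : ℝ) : EReal)}.indicator 1 with hg
  have hgm : Measurable[sig Bool (levelGe 0)] g :=
    Measurable.indicator measurable_const (measurable_upperEdge_sig' m measurableSet_Iic)
  have hgi : ∫⁻ ω, g ω ∂law p = lowProb p a m := by
    rw [hg, lintegral_indicator_one (measurableSet_upperEdge_le m _)]; rfl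
  set c : ℤ → ℝ≥0∞ := fun x => if (x : ℝ) ≤ a * n then 1 else 0 with hc
  have hsum : Measurable fun ω => ∑' x, (edgeAt n x).indicator (fun _ => c x) ω :=
    Measurable.tsum fun x => measurable_const.indicator (measurableSet_edgeAt n x)
  have h1 : lowProb p a n = law p B + ∫⁻ ω, ∑' x, (edgeAt n x).indicator (fun _ => c x) ω ∂law p := by
    rw [← lintegral_indicator_one hBm, ← lintegral_add_right _ hsum, lowProb,
      ← lintegral_indicator_one (measurableSet_upperEdge_le n _)]
    refine lintegral_congr fun ω => ?_
    by_cases h : upperEdge ω n = ⊥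
    · rw [tsum_indicator_edgeAt_of_bot h]
      simp [hB, h]
    · obtain ⟨x, hx⟩ := exists_edgeAt h
      rw [tsum_indicator_edgeAt hx]
      have hx' : upperEdge ω n = ((x : ℝ) : EReal) := hx
      simp only [Set.indicator, Set.mem_ofPred_eq, hx', hB, hc, EReal.coe_le_coe_iff]
      simp
  have hle : law p B + ∫⁻ ω, ∑' x, (edgeAt n x).indicator
      (fun _ => c x * g (shift (n, x) ω)) ω ∂law p ≤ lowProb p a (n + m) := by
    rw [← lintegral_indicator_one hBm, ← lintegral_add_left (measurable_one.indicator hBm), lowProb,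
      ← lintegral_indicator_one (measurableSet_upperEdge_le _ _)]
    refine lintegral_mono fun ω => ?_
    by_cases h : upperEdge ω n = ⊥
    · rw [tsum_indicator_edgeAt_of_bot h (fun x => c x * g (shift (n, x) ω))]
      simp [hB, h, upperEdge_add_eq_bot h]
    · obtain ⟨x, hx⟩ := exists_edgeAt h
      rw [tsum_indicator_edgeAt hx (fun x => c x * g (shift (n, x) ω))]
      have hx' : upperEdge ω n = ((x : ℝ) : EReal) := hx
      simp only [hB, Set.indicator, Set.mem_ofPred_eq, h, if_false, zero_add, hc, hg]
      split_ifs with h1 h2 h3 <;> simp only [mul_one, mul_zero, Pi.one_apply, le_refl, zero_le]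
      exfalso
      apply h3
      refine (upperEdge_add_le hx').trans ((add_le_add (EReal.coe_le_coe_iff.2 h1) h2).trans ?_)
      rw [← EReal.coe_add, EReal.coe_le_coe_iff]
      push_cast
      linarith
  have hrs := lintegral_restart p n c hgm
  rw [hgi] at hrs
  calc lowProb p a n * lowProb p a m
      = law p B * lowProb p a m +
        (∫⁻ ω, ∑' x, (edgeAt n x).indicator (fun _ => c x) ω ∂law p) * lowProb p a m := by
          rw [h1, add_mul]
    _ ≤ law p B + ∫⁻ ω, ∑' x, (edgeAt n x).indicator
          (fun _ => c x * g (shift (n, x) ω)) ω ∂law p := by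
        rw [hrs]
        gcongr
        exact mul_le_of_le_one_right zero_le prob_le_one
    _ ≤ _ := hle

/-- The exponential moment `E[exp(θ ū_n)]`. -/
def expMoment (p : I) (θ : ℝ) (n : ℕ) : ℝ≥0∞ :=
  ∫⁻ ω, EReal.exp ((θ : EReal) * upperEdge ω n) ∂law p

lemma measurable_exp_upperEdge_sig (θ : ℝ) (n : ℕ) : Measurable[sig Bool (levelGe 0)]
    (fun ω : Config => EReal.exp ((θ : EReal) * upperEdge ω n)) := by
  have h : Measurable fun x : EReal => EReal.exp ((θ : EReal) * x) := by fun_prop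
  exact h.comp (measurable_upperEdge_sig' n)

lemma expMoment_add_le (p : I) {θ : ℝ} (hθ : 0 < θ) (n m : ℕ) :
    expMoment p θ (n + m) ≤ expMoment p θ n * expMoment p θ m := by
  set g : Config → ℝ≥0∞ := fun ω => EReal.exp ((θ : EReal) * upperEdge ω m)
  set c : ℤ → ℝ≥0∞ := fun x => EReal.exp ((θ : EReal) * ((x : ℝ) : EReal))
  have hrs := lintegral_restart p n c (measurable_exp_upperEdge_sig θ m)
  have h1 : ∫⁻ ω, ∑' x, (edgeAt n x).indicator (fun _ => c x) ω ∂law p = expMoment p θ n := by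
    refine lintegral_congr fun ω => ?_
    by_cases h : upperEdge ω n = ⊥
    · rw [tsum_indicator_edgeAt_of_bot h, h, EReal.coe_mul_bot_of_pos hθ, EReal.exp_bot]
    · obtain ⟨x, hx⟩ := exists_edgeAt h
      rw [tsum_indicator_edgeAt hx, show upperEdge ω n = _ from hx]
  rw [h1] at hrs
  refine le_trans (lintegral_mono fun ω => ?_) hrs.le
  by_cases h : upperEdge ω n = ⊥
  · simp only [upperEdge_add_eq_bot h, EReal.coe_mul_bot_of_pos hθ, EReal.exp_bot, zero_le]
  · obtain ⟨x, hx⟩ := exists_edgeAt h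
    rw [tsum_indicator_edgeAt hx
      (fun x => c x * EReal.exp ((θ : EReal) * upperEdge (shift (n, x) ω) m)), ← EReal.exp_add,
      ← EReal.left_distrib_of_nonneg_of_ne_top (by exact_mod_cast hθ.le) (by simp)]
    exact EReal.exp_monotone (mul_le_mul_of_nonneg_left (upperEdge_add_le hx)
      (by exact_mod_cast hθ.le))

lemma expMoment_le (p : I) {θ : ℝ} (hθ : 0 < θ) (n : ℕ) :
    expMoment p θ n ≤ ENNReal.ofReal (Real.exp (θ * n)) := by
  calc expMoment p θ n ≤ ∫⁻ _, ENNReal.ofReal (Real.exp (θ * n)) ∂law p := by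
        refine lintegral_mono fun ω => ?_
        rw [← EReal.exp_coe, EReal.coe_mul]
        exact EReal.exp_monotone (mul_le_mul_of_nonneg_left (upperEdge_le ω n)
          (by exact_mod_cast hθ.le))
    _ = _ := by simp

lemma expMoment_mul_le (p : I) {θ : ℝ} (hθ : 0 < θ) (n k : ℕ) :
    expMoment p θ (n * k) ≤ expMoment p θ n ^ k := by
  induction k with
  | zero => simpa using expMoment_le p hθ 0
  | succ k ih =>
    rw [mul_add, mul_one, pow_succ]
    exact (expMoment_add_le p hθ _ _).trans (mul_le_mul_left ih _)

/-- A random variable bounded from above whose mean is below `b` has an exponential moment below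
`exp(θ b)`. -/
lemma exists_expMoment_le_of_mean_lt {p : I} {n : ℕ} {b : ℝ} (h : meanUpperEdge p n < (b : EReal)) :
    ∃ θ : ℝ, 0 < θ ∧ expMoment p θ n ≤ ENNReal.ofReal (Real.exp (θ * b)) := by
  set P : Config → ℝ≥0∞ := fun ω => (upperEdge ω n).toENNReal with hP
  set N : Config → ℝ≥0∞ := fun ω => (-upperEdge ω n).toENNReal with hN
  have hPm : Measurable P := (measurable_upperEdge n).ereal_toENNReal
  have hNm : Measurable N := (measurable_upperEdge n).neg.ereal_toENNReal
  have hPle : ∀ ω, P ω ≤ ENNReal.ofReal n := fun ω => by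
    have := EReal.toENNReal_le_toENNReal (upperEdge_le ω n)
    rwa [EReal.toENNReal_of_ne_top (EReal.coe_ne_top _), EReal.toReal_coe] at this
  have hPfin : ∫⁻ ω, P ω ∂law p ≠ ⊤ := by
    refine ((lintegral_mono hPle).trans_lt ?_).ne
    simp
  set A : ℝ := (∫⁻ ω, P ω ∂law p).toReal with hA
  have hAe : ((∫⁻ ω, P ω ∂law p : ℝ≥0∞) : EReal) = (A : EReal) := by
    rw [hA, EReal.coe_ennreal_toReal hPfin]
  obtain ⟨K, hK⟩ : ∃ K : ℕ, A - b < (∫⁻ ω, min (N ω) K ∂law p).toReal := by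
    have hlt : ENNReal.ofReal (A - b) < ∫⁻ ω, N ω ∂law p ∨ A - b < 0 := by
      by_contra hcon
      push Not at hcon
      obtain ⟨h1, h2⟩ := hcon
      have h3 : ((∫⁻ ω, N ω ∂law p : ℝ≥0∞) : EReal) ≤ ((A - b : ℝ) : EReal) := by
        have := EReal.coe_ennreal_le_coe_ennreal_iff.2 h1
        rwa [EReal.coe_ennreal_ofReal, max_eq_left h2] at this
      have h4 : meanUpperEdge p n ≥ (A : EReal) - ((A - b : ℝ) : EReal) := by
        rw [meanUpperEdge, hAe]
        exact EReal.sub_le_sub le_rfl h3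
      rw [← EReal.coe_sub] at h4
      have := h.trans_le (le_of_eq_of_le (by congr 1; ring) h4)
      exact lt_irrefl _ this
    rcases hlt with hlt | hlt
    · have hmono : ∫⁻ ω, N ω ∂law p = ⨆ K : ℕ, ∫⁻ ω, min (N ω) K ∂law p := by
        rw [← lintegral_iSup (fun K => hNm.min measurable_const)
          (fun K L hKL ω => min_le_min le_rfl (by exact_mod_cast hKL))]
        refine lintegral_congr fun ω => ?_
        rw [← inf_iSup_eq]
        simp [ENNReal.iSup_natCast]
      rw [hmono] at hlt
      obtain ⟨K, hK⟩ := lt_iSup_iff.1 hlt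
      refine ⟨K, ?_⟩
      have hfin : ∫⁻ ω, min (N ω) K ∂law p ≠ ⊤ := by
        refine ((lintegral_mono fun ω => min_le_right _ _).trans_lt ?_).ne
        simp
      by_contra hcon
      exact absurd hK (not_lt.2 ((ENNReal.le_ofReal_iff_toReal_le hfin
        (ENNReal.toReal_nonneg.trans (not_lt.1 hcon))).2 (not_lt.1 hcon)))
    · exact ⟨0, hlt.trans_le ENNReal.toReal_nonneg⟩
  set NK : Config → ℝ≥0∞ := fun ω => min (N ω) K with hNK
  have hNKm : Measurable NK := hNm.min measurable_const
  have hNKfin : ∫⁻ ω, NK ω ∂law p ≠ ⊤ := by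
    refine ((lintegral_mono fun ω => min_le_right _ _).trans_lt ?_).ne
    simp
  set V : Config → ℝ := fun ω => (P ω).toReal - (NK ω).toReal with hV
  have hPi : Integrable (fun ω => (P ω).toReal) (law p) :=
    integrable_toReal_of_lintegral_ne_top hPm.aemeasurable hPfin
  have hNi : Integrable (fun ω => (NK ω).toReal) (law p) :=
    integrable_toReal_of_lintegral_ne_top hNKm.aemeasurable hNKfin
  have hVi : Integrable V (law p) := hPi.sub hNi
  have hVint : ∫ ω, V ω ∂law p < b := by
    rw [hV, integral_sub hPi hNi, integral_toReal hPm.aemeasurable, integral_toReal hNKm.aemeasurable]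
    · linarith
    · exact ae_of_all _ fun ω => (min_le_right _ _).trans_lt (by simp)
    · exact ae_of_all _ fun ω => (hPle ω).trans_lt (by simp)
  have hVb : ∀ ω, |V ω| ≤ n + K := by
    intro ω
    have h1 : (P ω).toReal ≤ n := ENNReal.toReal_le_of_le_ofReal (by simp) (hPle ω)
    have h2 : (NK ω).toReal ≤ K := ENNReal.toReal_le_of_le_ofReal (by simp)
      (by rw [ENNReal.ofReal_natCast]; exact min_le_right _ _)
    have h3 : 0 ≤ (P ω).toReal := ENNReal.toReal_nonneg
    have h4 : 0 ≤ (NK ω).toReal := ENNReal.toReal_nonneg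
    rw [abs_le]; constructor <;> simp only [hV] <;> linarith
  have hUV : ∀ ω, upperEdge ω n ≤ (V ω : EReal) := by
    intro ω
    rcases upperEdge_cases ω n with ⟨h, -⟩ | ⟨x, -, h, -⟩
    · simp [h]
    · have e1 : P ω = ENNReal.ofReal x := by
        simp [hP, h]
      have e2 : N ω = ENNReal.ofReal (-x) := by
        simp only [hN, h]
        rw [← EReal.coe_neg, EReal.toENNReal_of_ne_top (EReal.coe_ne_top _), EReal.toReal_coe]
      rw [h, EReal.coe_le_coe_iff, hV]
      have e3 : (NK ω).toReal ≤ (N ω).toReal :=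
        ENNReal.toReal_mono (by simp [e2]) (min_le_left _ _)
      have e4 : (P ω).toReal = max (x : ℝ) 0 := by rw [e1, ENNReal.toReal_ofReal'] 
      have e5 : (N ω).toReal = max (-x : ℝ) 0 := by rw [e2, ENNReal.toReal_ofReal']
      have : (x : ℝ) = max (x : ℝ) 0 - max (-x : ℝ) 0 := by
        rcases le_total (x : ℝ) 0 with hx | hx
        · rw [max_eq_right hx, max_eq_left (by linarith)]; ring
        · rw [max_eq_left hx, max_eq_right (by linarith)]; ring
      simp only
      linarith
  set B : ℝ := n + K + |b| + 1 with hB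
  have hBpos : 0 < B := by positivity
  set δ : ℝ := b - ∫ ω, V ω ∂law p with hδ
  have hδpos : 0 < δ := by linarith
  set θ : ℝ := min (1 / B) (δ / B ^ 2) with hθ
  have hθpos : 0 < θ := by positivity
  have hθ1 : θ * B ≤ 1 := by
    calc θ * B ≤ 1 / B * B := by gcongr; exact min_le_left _ _
      _ = 1 := by field_simp
  have hθ2 : θ * B ^ 2 ≤ δ := by
    calc θ * B ^ 2 ≤ δ / B ^ 2 * B ^ 2 := by gcongr; exact min_le_right _ _
      _ = δ := by field_simp
  refine ⟨θ, hθpos, ?_⟩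
  have hpt : ∀ ω, Real.exp (θ * V ω) ≤
      Real.exp (θ * b) * (1 + θ * (V ω - b) + θ ^ 2 * B ^ 2) := by
    intro ω
    have hVB : |V ω - b| ≤ B := by
      calc |V ω - b| ≤ |V ω| + |b| := abs_sub _ _
        _ ≤ B := by rw [hB]; linarith [hVb ω]
    have h1 : |θ * (V ω - b)| ≤ 1 := by
      rw [abs_mul, abs_of_pos hθpos]
      exact (mul_le_mul_of_nonneg_left hVB hθpos.le).trans hθ1
    have h2 := (abs_le.1 (Real.abs_exp_sub_one_sub_id_le h1)).2
    have h3 : (θ * (V ω - b)) ^ 2 ≤ θ ^ 2 * B ^ 2 := by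
      rw [mul_pow, ← sq_abs (V ω - b)]
      gcongr
    rw [show θ * V ω = θ * b + θ * (V ω - b) by ring, Real.exp_add]
    gcongr
    linarith
  have hVm : Measurable V := hPm.ennreal_toReal.sub hNKm.ennreal_toReal
  have hRi : Integrable (fun ω => Real.exp (θ * b) * (1 + θ * (V ω - b) + θ ^ 2 * B ^ 2))
      (law p) := by
    refine Integrable.const_mul ?_ _
    exact ((integrable_const _).add ((hVi.sub (integrable_const _)).const_mul _)).add
      (integrable_const _)
  calc expMoment p θ n ≤ ∫⁻ ω, ENNReal.ofReal
        (Real.exp (θ * b) * (1 + θ * (V ω - b) + θ ^ 2 * B ^ 2)) ∂law p := by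
        refine lintegral_mono fun ω => ?_
        refine le_trans ?_ (ENNReal.ofReal_le_ofReal (hpt ω))
        rw [← EReal.exp_coe, EReal.coe_mul]
        exact EReal.exp_monotone (mul_le_mul_of_nonneg_left (hUV ω) (by exact_mod_cast hθpos.le))
    _ = ENNReal.ofReal (∫ ω, Real.exp (θ * b) * (1 + θ * (V ω - b) + θ ^ 2 * B ^ 2) ∂law p) := by
        rw [ofReal_integral_eq_lintegral_ofReal hRi]
        exact ae_of_all _ fun ω => (Real.exp_pos _).le.trans (hpt ω)
    _ ≤ ENNReal.ofReal (Real.exp (θ * b)) := by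
        refine ENNReal.ofReal_le_ofReal ?_
        rw [integral_const_mul]
        have e : ∫ ω, (1 + θ * (V ω - b) + θ ^ 2 * B ^ 2) ∂law p =
            θ * ∫ ω, V ω ∂law p + (1 - θ * b + θ ^ 2 * B ^ 2) := by
          rw [integral_congr_ae (ae_of_all _ fun ω => show _ =
            θ * V ω + (1 - θ * b + θ ^ 2 * B ^ 2) by ring),
            integral_add (hVi.const_mul _) (integrable_const _), integral_const_mul]
          simp
        have : ∫ ω, (1 + θ * (V ω - b) + θ ^ 2 * B ^ 2) ∂law p ≤ 1 := by
          have : θ * (θ * B ^ 2) ≤ θ * δ := by gcongr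
          rw [e]
          rw [hδ] at this
          linarith
        exact mul_le_of_le_one_right (Real.exp_pos _).le this

/-- If the mean of `ū_n` is below `cn` for one `n`, then `ū_k - ck` has uniformly bounded
exponential moments. -/
lemma exists_expMoment_le_forall {p : I} {n : ℕ} (hn : 1 ≤ n) {c : ℝ}
    (h : meanUpperEdge p n < ((c * n : ℝ) : EReal)) :
    ∃ θ C : ℝ, 0 < θ ∧ 0 < C ∧ ∀ k : ℕ,
      expMoment p θ k ≤ ENNReal.ofReal (C * Real.exp (θ * (c * k))) := by
  obtain ⟨θ, hθ, h⟩ := exists_expMoment_le_of_mean_lt h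
  refine ⟨θ, Real.exp (θ * n * (1 + |c|)), hθ, Real.exp_pos _, fun k => ?_⟩
  have hk := Nat.div_add_mod k n
  have hr : k % n < n := Nat.mod_lt _ (by omega)
  calc expMoment p θ k = expMoment p θ (n * (k / n) + k % n) := by rw [hk]
    _ ≤ expMoment p θ n ^ (k / n) * expMoment p θ (k % n) :=
        (expMoment_add_le p hθ _ _).trans (mul_le_mul_left (expMoment_mul_le p hθ _ _) _)
    _ ≤ ENNReal.ofReal (Real.exp (θ * (c * n))) ^ (k / n) *
          ENNReal.ofReal (Real.exp (θ * (k % n : ℕ))) := by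
        gcongr
        exact expMoment_le p hθ _
    _ = ENNReal.ofReal (Real.exp ((k / n : ℕ) * (θ * (c * n)) + θ * (k % n : ℕ))) := by
        rw [← ENNReal.ofReal_pow (Real.exp_pos _).le, ← ENNReal.ofReal_mul (by positivity),
          ← Real.exp_nat_mul, ← Real.exp_add]
    _ ≤ _ := by
        rw [← Real.exp_add]
        refine ENNReal.ofReal_le_ofReal (Real.exp_le_exp.2 ?_)
        have e : (k : ℝ) = n * (k / n : ℕ) + (k % n : ℕ) := by exact_mod_cast hk.symm
        have hr' : ((k % n : ℕ) : ℝ) ≤ n := by exact_mod_cast hr.le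
        have hr0 : (0 : ℝ) ≤ ((k % n : ℕ) : ℝ) := by positivity
        have h1 : -c * ((k % n : ℕ) : ℝ) ≤ |c| * n :=
          (mul_le_mul_of_nonneg_right (neg_le_abs c) hr0).trans
            (mul_le_mul_of_nonneg_left hr' (abs_nonneg c))
        have h2 : ((k % n : ℕ) : ℝ) - c * ((k % n : ℕ) : ℝ) ≤ n * (1 + |c|) := by linarith
        have h3 := mul_le_mul_of_nonneg_left h2 hθ.le
        have h4 : θ * (c * k) = θ * (c * (n * (k / n : ℕ) + (k % n : ℕ))) := by rw [← e]
        rw [h4]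
        linarith

/-- Exponential Markov inequality for the upper edge. -/
lemma law_le_upperEdge_le (p : I) {θ : ℝ} (hθ : 0 < θ) (n : ℕ) (y : ℝ) :
    law p {ω | (y : EReal) ≤ upperEdge ω n} ≤
      ENNReal.ofReal (Real.exp (-(θ * y))) * expMoment p θ n := by
  have h := mul_meas_ge_le_lintegral₀ (μ := law p) (f := fun ω => EReal.exp ((θ : EReal) * upperEdge ω n))
    (((measurable_exp_upperEdge_sig θ n).mono (sig_le _) le_rfl).aemeasurable)
    (ENNReal.ofReal (Real.exp (θ * y)))
  have h2 : law p {ω | (y : EReal) ≤ upperEdge ω n} ≤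
      law p {ω | ENNReal.ofReal (Real.exp (θ * y)) ≤ EReal.exp ((θ : EReal) * upperEdge ω n)} := by
    refine measure_mono fun ω (hω : (y : EReal) ≤ upperEdge ω n) => ?_
    simp only [Set.mem_ofPred_eq]
    rw [← EReal.exp_coe, EReal.coe_mul]
    exact EReal.exp_monotone (mul_le_mul_of_nonneg_left hω (by exact_mod_cast hθ.le))
  calc law p {ω | (y : EReal) ≤ upperEdge ω n}
      = ENNReal.ofReal (Real.exp (-(θ * y))) * (ENNReal.ofReal (Real.exp (θ * y)) *
          law p {ω | (y : EReal) ≤ upperEdge ω n}) := by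
        rw [← mul_assoc, ← ENNReal.ofReal_mul (Real.exp_pos _).le, ← Real.exp_add]
        simp
    _ ≤ _ := by
        gcongr
        exact le_trans (by gcongr) h

/-- If the mean of `ū_n` is below `cn` for one `n`, then upward deviations from slope `c` are
exponentially unlikely. -/
lemma exists_upper_deviation {p : I} {n : ℕ} (hn : 1 ≤ n) {c : ℝ}
    (h : meanUpperEdge p n < ((c * n : ℝ) : EReal)) :
    ∃ θ C : ℝ, 0 < θ ∧ 0 < C ∧ ∀ (k : ℕ) (y : ℝ),
      law p {ω | ((c * k + y : ℝ) : EReal) ≤ upperEdge ω k} ≤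
        ENNReal.ofReal (C * Real.exp (-(θ * y))) := by
  obtain ⟨θ, C, hθ, hC, h⟩ := exists_expMoment_le_forall hn h
  refine ⟨θ, C, hθ, hC, fun k y => (law_le_upperEdge_le p hθ k _).trans ?_⟩
  calc _ ≤ ENNReal.ofReal (Real.exp (-(θ * (c * k + y)))) *
        ENNReal.ofReal (C * Real.exp (θ * (c * k))) := by gcongr; exact h k
    _ = _ := by
        rw [← ENNReal.ofReal_mul (Real.exp_pos _).le]
        congr 1
        rw [show -(θ * y) = -(θ * (c * k + y)) + θ * (c * k) by ring, Real.exp_add]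
        ring

/-! ### Paths as height functions, and their crossings -/

/-- `g` describes an open path over the levels `[s, t]`: at level `l`, either `(l, g l)` is a site of
the lattice, which is then a vertex of the path, or `l + g l` is odd and the path jumps over level
`l` at height `g l`. -/
def IsPath (ω : Config) (g : ℤ → ℤ) (s t : ℤ) : Prop :=
  0 ≤ s ∧ Even (s + g s) ∧ ∀ l, s ≤ l → l < t →
    |g (l + 1) - g l| ≤ 1 ∧ (Even (l + g l) → ω (l, g l) = true) ∧
      (¬Even (l + g l) → g (l + 1) = g l)

lemma IsPath.path {ω : Config} {g : ℤ → ℤ} {s t : ℤ} (h : IsPath ω g s t) {a b : ℤ} (ha : s ≤ a)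
    (hab : a ≤ b) (hb : b ≤ t) (hea : Even (a + g a)) (heb : Even (b + g b)) :
    Relation.ReflTransGen (Step ω) (a, g a) (b, g b) := by
  obtain ⟨k, hk⟩ : ∃ k : ℕ, b - a = k := ⟨(b - a).toNat, by omega⟩
  induction k using Nat.strong_induction_on generalizing a with
  | _ k ih =>
    rcases hab.eq_or_lt with rfl | hlt
    · exact .refl
    have hla : (a, g a) ∈ lattice := ⟨hea, h.1.trans ha⟩
    obtain ⟨h1, h2, -⟩ := h.2.2 a ha (by omega)
    rw [abs_le] at h1
    obtain hd | hd | hd : g (a + 1) = g a + 1 ∨ g (a + 1) = g a ∨ g (a + 1) = g a - 1 := by omega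
    · have he : Even (a + 1 + g (a + 1)) := by rw [hd]; grind
      refine .head ⟨hla, h2 hea, Or.inl rfl⟩ ?_
      have := ih (k - 1) (by omega) (a := a + 1) (by omega) (by omega) he (by omega)
      rwa [hd] at this
    · have hne : ¬Even (a + 1 + g (a + 1)) := by rw [hd]; grind
      have hab' : a + 1 ≠ b := by rintro rfl; exact hne heb
      obtain ⟨-, -, h3⟩ := h.2.2 (a + 1) (by omega) (by omega)
      have h4 : g (a + 2) = g a := by rw [← hd, ← h3 hne]; congr 1; ring
      refine .head ⟨hla, h2 hea, Or.inr (Or.inl rfl)⟩ ?_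
      have := ih (k - 2) (by omega) (a := a + 2) (by omega) (by omega) (by rw [h4]; grind) (by omega)
      rwa [h4] at this
    · have he : Even (a + 1 + g (a + 1)) := by rw [hd]; grind
      refine .head ⟨hla, h2 hea, Or.inr (Or.inr rfl)⟩ ?_
      have := ih (k - 1) (by omega) (a := a + 1) (by omega) (by omega) he (by omega)
      rwa [hd] at this

lemma PathIn.exists_isPath {R : Set (ℤ × ℤ)} {ω : Config} {z w : ℤ × ℤ} (h : PathIn R ω z w)
    (hz : z ∈ lattice) :
    ∃ g, IsPath ω g z.1 w.1 ∧ g z.1 = z.2 ∧ g w.1 = w.2 ∧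
      ∀ l, z.1 ≤ l → l < w.1 → Even (l + g l) → (l, g l) ∈ R := by
  induction h using Relation.ReflTransGen.head_induction_on with
  | refl =>
    exact ⟨fun _ => w.2, ⟨hz.2, hz.1, fun l h1 h2 => by omega⟩, rfl, rfl, fun l h1 h2 => by omega⟩
  | @head a c h h' ih =>
    obtain ⟨g, ⟨h0, he, hg⟩, hc, hw, hR⟩ := ih h.2.mem_lattice
    have hac := h.2.level_lt
    have hcw := path_level_le (PathIn.path h')
    have hstep : (c.1 = a.1 + 1 ∧ (c.2 = a.2 + 1 ∨ c.2 = a.2 - 1)) ∨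
        (c.1 = a.1 + 2 ∧ c.2 = a.2) := by
      rcases h.2.2.2 with rfl | rfl | rfl <;> simp
    have key : ∀ l, a.1 ≤ l → l < c.1 → Even (l + a.2) → (l, a.2) = a := by
      intro l h1 h2 h3
      have := hz.1
      have : l = a.1 := by
        rcases hstep with hs | hs
        · omega
        · by_contra hne
          have : l = a.1 + 1 := by omega
          subst this; grind
      rw [this]
    refine ⟨fun l => if l < c.1 then a.2 else g l, ⟨hz.2, by simpa [hac] using hz.1, ?_⟩, by simp [hac],
      by simp [hcw, hw], ?_⟩
    · intro l h1 h2
      rcases lt_or_ge l c.1 with hl | hl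
      · simp only [hl, if_true]
        refine ⟨?_, fun h3 => by rw [key l h1 hl h3]; exact h.2.2.1, fun h3 => ?_⟩
        · split_ifs with hl'
          · simp
          · have : l + 1 = c.1 := by omega
            rw [this, hc, abs_le]; omega
        · have hl' : ¬ l + 1 < c.1 ∧ c.2 = a.2 := by
            have := hz.1
            have : l ≠ a.1 := by rintro rfl; exact h3 this
            omega
          rw [if_neg hl'.1, show l + 1 = c.1 by omega, hc, hl'.2]
      · simp only [not_lt.2 hl, if_false, show ¬ l + 1 < c.1 by omega]
        exact hg l hl h2
    · intro l h1 h2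
      rcases lt_or_ge l c.1 with hl | hl
      · simp only [hl, if_true]
        exact fun h3 => by rw [key l h1 hl h3]; exact h.1
      · simp only [not_lt.2 hl, if_false]
        exact hR l hl h2

/-- Two paths that cross have a common vertex. -/
lemma IsPath.exists_common {ω : Config} {f g : ℤ → ℤ} {s t s' t' a b : ℤ} (hf : IsPath ω f s t)
    (hg : IsPath ω g s' t') (hsa : s ≤ a) (hsa' : s' ≤ a) (hbt : b ≤ t) (hbt' : b ≤ t')
    (hab : a ≤ b) (ha : g a < f a ∨ (f a = g a ∧ Even (a + f a))) (hb : f b ≤ g b) :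
    ∃ l, a ≤ l ∧ l ≤ b ∧ f l = g l ∧ Even (l + g l) := by
  by_contra! hcon
  have key : ∀ k : ℕ, a + k ≤ b → g (a + k) < f (a + k) := by
    intro k
    induction k with
    | zero =>
      intro _
      rcases ha with ha | ⟨h1, h2⟩
      · simpa using ha
      · exact absurd (h1 ▸ h2) (hcon a le_rfl hab h1)
    | succ k ih =>
      intro hk
      have h1 := ih (by push_cast at hk; omega)
      have h2 := hf.2.2 (a + k) (by omega) (by push_cast at hk; omega)
      have h3 := hg.2.2 (a + k) (by omega) (by push_cast at hk; omega)
      have h4 := hcon (a + k + 1) (by omega) (by push_cast at hk; omega)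
      have e : a + ((k + 1 : ℕ) : ℤ) = a + k + 1 := by push_cast; ring
      rw [e]
      rw [abs_le] at h2 h3
      obtain ⟨h2, -, h2'⟩ := h2
      obtain ⟨h3, -, h3'⟩ := h3
      rw [Int.even_iff] at h2' h3' h4
      generalize f (a + k) = u at *
      generalize g (a + k) = v at *
      generalize f (a + k + 1) = u' at *
      generalize g (a + k + 1) = v' at *
      by_contra! hlt
      rcases Int.emod_two_eq_zero_or_one (a + k + u) with hu | hu <;>
        rcases Int.emod_two_eq_zero_or_one (a + k + v) with hv | hv
      · by_cases huv : u' = v'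
        · have := h4 huv; omega
        · omega
      · have := h3' (by omega)
        by_cases huv : u' = v'
        · have := h4 huv; omega
        · omega
      · have := h2' (by omega)
        by_cases huv : u' = v'
        · have := h4 huv; omega
        · omega
      · have := h2' (by omega); have := h3' (by omega); omega
  have := key (b - a).toNat (by omega)
  rw [show a + ((b - a).toNat : ℤ) = b by omega] at this
  omega

lemma path_height_ge {ω : Config} {z w : ℤ × ℤ} (h : Relation.ReflTransGen (Step ω) z w) :
    z.2 - (w.1 - z.1) ≤ w.2 := by
  rw [← refl_refl ω] at h
  have := path_height_le (path_refl h)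
  simp only at this
  linarith

/-- If the cluster of the origin is infinite, every level is reached. -/
lemma reached_nonempty_of_infinite {ω : Config} (h : (cluster ω).Infinite) (n : ℕ) :
    (reached ω n).Nonempty := by
  by_contra hcon
  rw [Set.not_nonempty_iff_eq_empty] at hcon
  refine h (Set.Finite.subset ((Set.finite_Icc (0 : ℤ) n).prod (Set.finite_Icc (-n : ℤ) n)) ?_)
  rintro w ⟨h0, hw⟩
  have h1 := path_level_le hw
  have h2 := path_height_le hw
  have h3 := path_height_ge hw
  simp only at h1 h2 h3
  rcases le_or_gt w.1 n with hwn | hwn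
  · refine ⟨⟨h1, hwn⟩, ?_, ?_⟩ <;> omega
  · exfalso
    rcases path_split hw (n := n) (by simp) hwn.le with ⟨x, hx, -⟩ | ⟨x, hx, hx', -⟩
    · exact Set.notMem_empty x (hcon ▸ ⟨h0, hx⟩)
    · refine Set.notMem_empty (x + 1) (hcon ▸ ⟨h0, hx.tail ?_⟩)
      simpa using step_up hx'

lemma reached_subset_reachedFromBelow (ω : Config) (n : ℕ) : reached ω n ⊆ reachedFromBelow ω n :=
  fun _ hx => ⟨0, le_rfl, Or.inl hx⟩

lemma neg_mem_reached_refl {ω : Config} {n : ℕ} {x : ℤ} (h : x ∈ reached ω n) :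
    -x ∈ reached (refl ω) n := by
  have h' : Connects ω (0, 0) (n, x) := h
  rw [reached, Set.mem_ofPred_eq, connects_refl_iff]
  simpa using h'

lemma percProb_le (p : I) (n : ℕ) : percProb p ≤ 2 * law p {ω | (0 : EReal) ≤ upperEdge ω n} := by
  have hm : MeasurableSet {ω : Config | (0 : EReal) ≤ upperEdge ω n} :=
    measurable_upperEdge n measurableSet_Ici
  have h2 : law p (refl ⁻¹' {ω | (0 : EReal) ≤ upperEdge ω n}) =
      law p {ω | (0 : EReal) ≤ upperEdge ω n} :=
    (measurePreserving_refl (bernoulliMeasure true false p)).measure_preimage hm.nullMeasurableSet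
  rw [two_mul]
  nth_rewrite 2 [← h2]
  refine le_trans (measure_mono fun ω hω => ?_) (measure_union_le _ _)
  obtain ⟨x, hx⟩ := reached_nonempty_of_infinite hω n
  rcases le_total 0 x with h0 | h0
  · left
    refine le_trans ?_ (le_upperEdge (reached_subset_reachedFromBelow ω n hx))
    exact_mod_cast h0
  · right
    refine le_trans ?_ (le_upperEdge (reached_subset_reachedFromBelow _ n (neg_mem_reached_refl hx)))
    have : (0 : ℝ) ≤ ((-x : ℤ) : ℝ) := by exact_mod_cast neg_nonneg.2 h0
    exact_mod_cast this

/-- If the origin percolates, then the upper edge has non-negative mean. -/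
lemma meanUpperEdge_nonneg {p : I} (hp : 0 < percProb p) {n : ℕ} (hn : 1 ≤ n) :
    0 ≤ meanUpperEdge p n := by
  by_contra! hcon
  obtain ⟨b, hb, hb0⟩ := EReal.lt_iff_exists_real_btwn.1 hcon
  have hb0 : b < 0 := by exact_mod_cast hb0
  have hn' : (0 : ℝ) < n := by exact_mod_cast hn
  obtain ⟨θ, C, hθ, hC, h⟩ := exists_upper_deviation (p := p) (c := b / n) hn
    (by rwa [div_mul_cancel₀ _ hn'.ne'])
  have hc : b / n < 0 := div_neg_of_neg_of_pos hb0 hn'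
  have hlim : Tendsto (fun k : ℕ => 2 * ENNReal.ofReal (C * Real.exp (-(θ * (-(b / n) * k)))))
      atTop (𝓝 (2 * ENNReal.ofReal (C * 0))) := by
    refine ENNReal.Tendsto.const_mul (ENNReal.tendsto_ofReal (Tendsto.const_mul _ ?_))
      (Or.inr (by simp))
    refine Real.tendsto_exp_neg_atTop_nhds_zero.comp ?_
    refine Tendsto.const_mul_atTop hθ (Tendsto.const_mul_atTop (by linarith) ?_)
    exact tendsto_natCast_atTop_atTop
  have hle : percProb p ≤ 2 * ENNReal.ofReal (C * 0) := by
    refine ge_of_tendsto' hlim fun k => (percProb_le p k).trans ?_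
    gcongr
    have := h k (-(b / n) * k)
    rwa [show b / n * k + -(b / n) * k = 0 by ring, EReal.coe_zero] at this
  simp at hle
  exact hp.ne' hle

/-! ### The mean of the upper edge is strictly increasing in `p` -/

/-- The upper edge as a real number (with a junk value if nothing is reached). -/
def edgeR (ω : Config) (n : ℕ) : ℝ := (upperEdge ω n).toReal

lemma measurable_edgeR_sig (n : ℕ) :
    Measurable[sig Bool (levelGe 0)] (fun ω : Config => edgeR ω n) :=
  measurable_ereal_toReal.comp (measurable_upperEdge_sig' n)

lemma measurable_edgeR (n : ℕ) : Measurable (fun ω : Config => edgeR ω n) :=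
  (measurable_edgeR_sig n).mono (sig_le _) le_rfl

lemma upperEdge_ne_top (ω : Config) (n : ℕ) : upperEdge ω n ≠ ⊤ :=
  ((upperEdge_le ω n).trans_lt (EReal.coe_lt_top _)).ne

lemma coe_edgeR {ω : Config} {n : ℕ} (h : upperEdge ω n ≠ ⊥) :
    ((edgeR ω n : ℝ) : EReal) = upperEdge ω n := EReal.coe_toReal (upperEdge_ne_top ω n) h

lemma edgeR_le (ω : Config) (n : ℕ) : edgeR ω n ≤ n := by
  by_cases h : upperEdge ω n = ⊥
  · simp [edgeR, h]
  · rw [← EReal.coe_le_coe_iff, coe_edgeR h]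
    exact upperEdge_le ω n

/-- If the mean is not `-∞`, it is a Bochner integral. -/
lemma integrable_edgeR {p : I} {n : ℕ} (h : meanUpperEdge p n ≠ ⊥) :
    (∀ᵐ ω ∂law p, upperEdge ω n ≠ ⊥) ∧ Integrable (fun ω => edgeR ω n) (law p) ∧
      meanUpperEdge p n = ((∫ ω, edgeR ω n ∂law p : ℝ) : EReal) := by
  set P : Config → ℝ≥0∞ := fun ω => (upperEdge ω n).toENNReal with hP
  set N : Config → ℝ≥0∞ := fun ω => (-upperEdge ω n).toENNReal with hN
  have hPm : Measurable P := (measurable_upperEdge n).ereal_toENNReal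
  have hNm : Measurable N := (measurable_upperEdge n).neg.ereal_toENNReal
  have hPle : ∀ ω, P ω ≤ ENNReal.ofReal n := fun ω => by
    have := EReal.toENNReal_le_toENNReal (upperEdge_le ω n)
    rwa [EReal.toENNReal_of_ne_top (EReal.coe_ne_top _), EReal.toReal_coe] at this
  have hPfin : ∫⁻ ω, P ω ∂law p ≠ ⊤ := by
    refine ((lintegral_mono hPle).trans_lt ?_).ne
    simp
  have hNfin : ∫⁻ ω, N ω ∂law p ≠ ⊤ := by
    intro hcon
    apply h
    rw [meanUpperEdge, hcon]
    simp
  have hNae : ∀ᵐ ω ∂law p, N ω < ⊤ := ae_lt_top hNm hNfin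
  have hne : ∀ᵐ ω ∂law p, upperEdge ω n ≠ ⊥ := by
    filter_upwards [hNae] with ω hω hbot
    simp [hN, hbot] at hω
  have hPi : Integrable (fun ω => (P ω).toReal) (law p) :=
    integrable_toReal_of_lintegral_ne_top hPm.aemeasurable hPfin
  have hNi : Integrable (fun ω => (N ω).toReal) (law p) :=
    integrable_toReal_of_lintegral_ne_top hNm.aemeasurable hNfin
  have heq : (fun ω => (P ω).toReal - (N ω).toReal) =ᵐ[law p] fun ω => edgeR ω n := by
    filter_upwards [hne] with ω hω
    obtain ⟨x, hx⟩ := exists_edgeAt hω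
    have hx' : upperEdge ω n = ((x : ℝ) : EReal) := hx
    have e1 : P ω = ENNReal.ofReal x := by
      simp [hP, hx']
    have e2 : N ω = ENNReal.ofReal (-x) := by
      simp only [hN, hx']
      rw [← EReal.coe_neg, EReal.toENNReal_of_ne_top (EReal.coe_ne_top _), EReal.toReal_coe]
    rw [e1, e2, ENNReal.toReal_ofReal', ENNReal.toReal_ofReal', edgeR, hx', EReal.toReal_coe]
    rcases le_total (x : ℝ) 0 with hx | hx
    · rw [max_eq_right hx, max_eq_left (by linarith)]; ring
    · rw [max_eq_left hx, max_eq_right (by linarith)]; ring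
  refine ⟨hne, (hPi.sub hNi).congr heq, ?_⟩
  rw [← integral_congr_ae heq, integral_sub hPi hNi, integral_toReal hPm.aemeasurable,
    integral_toReal hNm.aemeasurable hNae, EReal.coe_sub, EReal.coe_ennreal_toReal hPfin,
    EReal.coe_ennreal_toReal hNfin]
  · rfl
  · exact ae_of_all _ fun ω => (hPle ω).trans_lt (by simp)

lemma meanUpperEdge_zero (p : I) : meanUpperEdge p 0 = 0 := by
  simp [meanUpperEdge, upperEdge_zero]

/-- If the top site at level `k` is closed, later levels are only reached from below
`(k+1, x-1)`. -/
lemma upperEdge_le_of_closed {ω ζ : Config} {k m : ℕ} {x : ℤ}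
    (hx : upperEdge ω k = ((x : ℝ) : EReal)) (hcl : ω (k, x) = false)
    (hζ : ∀ z : ℤ × ℤ, (k : ℤ) < z.1 → ω z = true → ζ z = true) :
    upperEdge ω (k + 1 + m) ≤
      ((x - 1 : ℝ) : EReal) + upperEdge (shift ((k : ℤ) + 1, x - 1) ζ) m := by
  rw [upperEdge_eq_coe_iff] at hx
  have hl := mem_lattice_of_mem_reachedFromBelow hx.1
  have hl' : (((k + 1 : ℕ) : ℤ), x - 1) ∈ lattice := by
    obtain ⟨h1, h2⟩ := hl
    refine ⟨?_, by simp; omega⟩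
    simp only at h1 ⊢; push_cast; grind
  have h1 : ∀ y ∈ reachedFromBelow ω (k + 1), y ≤ x - 1 := by
    intro y hy
    have h2 := sub_mem_reachedFromBelow_shift hx.2 hl hy
    have h3 := (mem_lattice_of_mem_reachedFromBelow h2).1
    have h4 := le_of_mem_reachedFromBelow h2
    by_contra! hlt
    have hy1 : y - x = 1 := by
      simp only [Nat.cast_one] at h3 h4
      rw [Int.even_iff] at h3
      omega
    rw [hy1] at h2
    obtain ⟨y0, hy0, h | h⟩ := h2
    · have h5 := path_height_le h.2
      simp only [Nat.cast_one] at h5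
      have : y0 = 0 := by omega
      subst this
      rcases Relation.ReflTransGen.cases_head h.2 with he | ⟨c, hc, -⟩
      · simp at he
      · have := hc.2.1
        simp [hcl] at this
    · have h5 := path_height_le h.2
      simp only [Nat.cast_one] at h5
      omega
  refine upperEdge_le_iff.2 fun y hy => ?_
  have h2 := sub_mem_reachedFromBelow_shift h1 hl' hy
  have h3 := reachedFromBelow_mono (ω' := shift ((k : ℤ) + 1, x - 1) ζ) (fun v hv _ => by
    simpa using hζ _ (by simp; omega)) h2
  have := le_upperEdge h3
  calc ((y : ℝ) : EReal) = ((x - 1 : ℝ) : EReal) + (((y - (x - 1) : ℤ) : ℝ) : EReal) := by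
        rw [← EReal.coe_add]; push_cast; congr 1; ring
    _ ≤ _ := add_le_add_right this _

/-- If the top site `(k, x)` at level `k` is open, then everything that is reached from below
`(k+1, x+1)` but not from below `(k+1, x-1)` is reached. -/
lemma le_upperEdge_of_open {ω ζ : Config} {k m : ℕ} {x : ℤ}
    (hx : upperEdge ω k = ((x : ℝ) : EReal)) (hop : ω (k, x) = true)
    (hζ : ∀ z : ℤ × ℤ, (k : ℤ) < z.1 → ζ z = true → ω z = true) :
    ((x + 1 : ℝ) : EReal) + upperEdge (shift ((k : ℤ) + 1, x + 1) ζ) m ≤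
      max (((x - 1 : ℝ) : EReal) + upperEdge (shift ((k : ℤ) + 1, x - 1) ζ) m)
        (upperEdge ω (k + 1 + m)) := by
  rw [upperEdge_eq_coe_iff] at hx
  have hl := mem_lattice_of_mem_reachedFromBelow hx.1
  have hlp : ((k : ℤ) + 1, x + 1) ∈ lattice := by
    obtain ⟨h1, h2⟩ := hl
    refine ⟨?_, by simp; omega⟩
    simp only at h1 ⊢; grind
  have hlm : ((k : ℤ) + 1, x - 1) ∈ lattice := by
    obtain ⟨h1, h2⟩ := hl
    refine ⟨?_, by simp; omega⟩
    simp only at h1 ⊢; grind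
  rcases upperEdge_cases (shift ((k : ℤ) + 1, x + 1) ζ) m with ⟨h, -⟩ | ⟨y, hy, h, -⟩
  · simp [h]
  rw [h]
  have hlow : ∀ s : ℤ, 0 ≤ s → ∀ y0 ≤ 0, Connects (shift ((k : ℤ) + 1, x + 1) ζ) (s, y0) (m, y) →
      Connects (shift ((k : ℤ) + 1, x - 1) ζ) (s, y0 + 2) (m, y + 2) := by
    intro s hs y0 hy0 hc
    rw [connects_shift_iff hlp hs] at hc
    rw [connects_shift_iff hlm hs]
    have e : ∀ t u : ℤ, ((t, u + 2) + ((k : ℤ) + 1, x - 1) : ℤ × ℤ) = (t, u) + ((k : ℤ) + 1, x + 1) :=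
      fun t u => Prod.ext rfl (by simp only [Prod.snd_add]; ring)
    rwa [e, e]
  have hhigh : ∀ w : ℤ × ℤ, Step ω (k, x) w → Connects ζ w ((k : ℤ) + 1 + m, x + 1 + y) →
      x + 1 + y ∈ reachedFromBelow ω (k + 1 + m) := by
    intro w hw hc
    have h1 : Relation.ReflTransGen (Step ω) w (((k + 1 + m : ℕ) : ℤ), x + 1 + y) := by
      have := path_mono (ω' := ω) (fun v hv _ => hζ v (hw.level_lt.trans_le hv)) hc.2
      simpa using this
    obtain ⟨y0, hy0, h2 | h2⟩ := hx.1
    · exact ⟨y0, hy0, Or.inl ⟨h2.1, (h2.2.tail hw).trans h1⟩⟩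
    · exact ⟨y0, hy0, Or.inr ⟨h2.1, (h2.2.tail hw).trans h1⟩⟩
  have hcase1 : y + 2 ∈ reachedFromBelow (shift ((k : ℤ) + 1, x - 1) ζ) m →
      ((x + 1 : ℝ) : EReal) + ((y : ℝ) : EReal) ≤
      max (((x - 1 : ℝ) : EReal) + upperEdge (shift ((k : ℤ) + 1, x - 1) ζ) m)
        (upperEdge ω (k + 1 + m)) := by
    intro h1
    refine le_max_of_le_left ?_
    calc ((x + 1 : ℝ) : EReal) + ((y : ℝ) : EReal) =
          ((x - 1 : ℝ) : EReal) + (((y + 2 : ℤ) : ℝ) : EReal) := by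
          rw [← EReal.coe_add, ← EReal.coe_add, EReal.coe_eq_coe_iff]; push_cast; ring
      _ ≤ _ := add_le_add_right (le_upperEdge h1) _
  have hcase2 : x + 1 + y ∈ reachedFromBelow ω (k + 1 + m) →
      ((x + 1 : ℝ) : EReal) + ((y : ℝ) : EReal) ≤
      max (((x - 1 : ℝ) : EReal) + upperEdge (shift ((k : ℤ) + 1, x - 1) ζ) m)
        (upperEdge ω (k + 1 + m)) := by
    intro h1
    refine le_max_of_le_right ?_
    refine le_trans (le_of_eq ?_) (le_upperEdge h1)
    rw [← EReal.coe_add]; push_cast; rfl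
  obtain ⟨y0, hy0, hc | hc⟩ := hy
  · have hpar := hc.1.1
    simp only [zero_add, Int.even_iff] at hpar
    rcases le_or_gt y0 (-2) with h2 | h2
    · exact hcase1 ⟨y0 + 2, by omega, Or.inl (hlow 0 le_rfl y0 hy0 hc)⟩
    · have : y0 = 0 := by omega
      subst this
      rw [connects_shift_iff hlp le_rfl] at hc
      refine hcase2 (hhigh (k + 1, x + 1) ⟨hl, hop, Or.inl rfl⟩ ?_)
      convert hc using 2 <;> simp only [Prod.mk_add_mk] <;> ring
  · have hpar := hc.1.1
    simp only [Int.even_iff] at hpar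
    rcases le_or_gt y0 (-2) with h2 | h2
    · exact hcase1 ⟨y0 + 2, by omega, Or.inr (hlow 1 zero_le_one y0 hy0 hc)⟩
    · have : y0 = -1 := by omega
      subst this
      rw [connects_shift_iff hlp zero_le_one] at hc
      refine hcase2 (hhigh (k + 2, x) ⟨hl, hop, Or.inr (Or.inl rfl)⟩ ?_)
      convert hc using 2 <;> simp only [Prod.mk_add_mk] <;> ring

/-! ### Coupling of two parameters -/

/-- The law of a pair of independent Bernoulli variables. -/
abbrev pairLaw (p r : I) : Measure (Bool × Bool) :=
  (bernoulliMeasure true false p).prod (bernoulliMeasure true false r)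

/-- The configuration of the first labels. -/
def lower (η : ℤ × ℤ → Bool × Bool) : Config := fun z => (η z).1

/-- The configuration of all sites with at least one label `true`. -/
def upper (η : ℤ × ℤ → Bool × Bool) : Config := fun z => (η z).1 || (η z).2

/-- The configuration that uses the second label only below level `k`. -/
def hybrid (k : ℕ) (η : ℤ × ℤ → Bool × Bool) : Config :=
  fun z => (η z).1 || (decide (z.1 < k) && (η z).2)

lemma measurable_lower : Measurable lower :=
  measurable_pi_lambda _ fun z => measurable_fst.comp (measurable_pi_apply z)

lemma measurable_upper : Measurable upper :=
  measurable_pi_lambda _ fun z => (measurable_of_countable fun b : Bool × Bool => b.1 || b.2).comp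
    (measurable_pi_apply z)

lemma measurable_hybrid_sig (k : ℕ) (S : Set (ℤ × ℤ)) :
    @Measurable _ _ (sig (Bool × Bool) S) (sig Bool S) (hybrid k) :=
  @measurable_sig_of_eval _ _ _ (sig (Bool × Bool) S) _ _ fun z hz =>
    (measurable_of_countable fun b : Bool × Bool => b.1 || (decide (z.1 < k) && b.2)).comp
      (measurable_eval_sig hz)

lemma measurable_lower_sig (S : Set (ℤ × ℤ)) :
    @Measurable _ _ (sig (Bool × Bool) S) (sig Bool S) lower :=
  @measurable_sig_of_eval _ _ _ (sig (Bool × Bool) S) _ _ fun _ hz =>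
    measurable_fst.comp (measurable_eval_sig hz)

lemma measurable_hybrid (k : ℕ) : Measurable (hybrid k) :=
  measurable_pi_lambda _ fun z => (measurable_of_countable
    fun b : Bool × Bool => b.1 || (decide (z.1 < k) && b.2)).comp (measurable_pi_apply z)

lemma measurePreserving_lower (p r : I) :
    MeasurePreserving lower (field (pairLaw p r)) (law p) := by
  refine ⟨measurable_lower, ?_⟩
  have := Measure.infinitePi_map_pi (fun _ : ℤ × ℤ => pairLaw p r)
    (f := fun _ b => b.1) (fun _ => measurable_fst)
  refine this.trans ?_
  rw [law]
  congr 1; ext1 z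
  exact measurePreserving_fst.map_eq

lemma map_or_pairLaw {p q r : I} (h : (1 - p : ℝ) = (1 - q) * (1 - r)) :
    (pairLaw q r).map (fun b => b.1 || b.2) = bernoulliMeasure true false p := by
  have hm : Measurable fun b : Bool × Bool => b.1 || b.2 := measurable_of_countable _
  have : IsProbabilityMeasure ((pairLaw q r).map fun b => b.1 || b.2) :=
    Measure.isProbabilityMeasure_map hm.aemeasurable
  have hf : ((pairLaw q r).map fun b => b.1 || b.2).real {false} =
      (bernoulliMeasure true false p).real {false} := by
    rw [map_measureReal_apply hm (measurableSet_singleton _)]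
    have : (fun b : Bool × Bool => b.1 || b.2) ⁻¹' {false} = {false} ×ˢ {false} := by
      ext ⟨a, b⟩; simp
    rw [this, measureReal_prod_prod]
    simp [h]
  have ht : ((pairLaw q r).map fun b => b.1 || b.2).real {true} =
      (bernoulliMeasure true false p).real {true} := by
    have e : ({true} : Set Bool) = {false}ᶜ := by ext b; simp
    rw [e, probReal_compl_eq_one_sub (measurableSet_singleton _),
      probReal_compl_eq_one_sub (measurableSet_singleton _), hf]
  refine Measure.ext_of_singleton fun b => ?_
  rw [← measureReal_eq_measureReal_iff]
  cases b
  · exact hf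
  · exact ht

lemma measurePreserving_upper {p q r : I} (h : (1 - p : ℝ) = (1 - q) * (1 - r)) :
    MeasurePreserving upper (field (pairLaw q r)) (law p) := by
  refine ⟨measurable_upper, ?_⟩
  have := Measure.infinitePi_map_pi (fun _ : ℤ × ℤ => pairLaw q r)
    (f := fun _ b => b.1 || b.2) (fun _ => measurable_of_countable _)
  refine this.trans ?_
  rw [law]
  congr 1; ext1 z
  exact map_or_pairLaw h

lemma meanUpperEdge_mono {p q r : I} (h : (1 - p : ℝ) = (1 - q) * (1 - r)) (n : ℕ) :
    meanUpperEdge q n ≤ meanUpperEdge p n := by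
  have hle : ∀ η, upperEdge (lower η) n ≤ upperEdge (upper η) n := fun η =>
    upperEdge_mono fun v _ _ hv => by
      simp only [lower] at hv
      simp [upper, hv]
  have hP : Measurable fun ω : Config => (upperEdge ω n).toENNReal :=
    (measurable_upperEdge n).ereal_toENNReal
  have hN : Measurable fun ω : Config => (-upperEdge ω n).toENNReal :=
    (measurable_upperEdge n).neg.ereal_toENNReal
  rw [meanUpperEdge, meanUpperEdge, ← (measurePreserving_lower q r).lintegral_comp hP,
    ← (measurePreserving_lower q r).lintegral_comp hN,
    ← (measurePreserving_upper h).lintegral_comp hP, ← (measurePreserving_upper h).lintegral_comp hN]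
  refine EReal.sub_le_sub ?_ ?_
  · exact_mod_cast lintegral_mono fun η => EReal.toENNReal_le_toENNReal (hle η)
  · exact_mod_cast lintegral_mono fun η => EReal.toENNReal_le_toENNReal (EReal.neg_le_neg_iff.2 (hle η))

lemma ofReal_integral_le_lintegral {Ω : Type*} [MeasurableSpace Ω] {μ : Measure Ω} {f : Ω → ℝ}
    (hf : Integrable f μ) : ENNReal.ofReal (∫ x, f x ∂μ) ≤ ∫⁻ x, ENNReal.ofReal (f x) ∂μ := by
  rw [integral_eq_lintegral_pos_part_sub_lintegral_neg_part hf]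
  refine ENNReal.ofReal_le_of_le_toReal ?_
  linarith [ENNReal.toReal_nonneg (a := ∫⁻ x, ENNReal.ofReal (-f x) ∂μ)]

section Gain

variable {q r : I}

lemma integrable_edgeR_shift_lower (hq : ∀ n, meanUpperEdge q n ≠ ⊥) (v : ℤ × ℤ) (m : ℕ) :
    Integrable (fun η => edgeR (shift v (lower η)) m) (field (pairLaw q r)) ∧
      ∫ η, edgeR (shift v (lower η)) m ∂field (pairLaw q r) = ∫ ω, edgeR ω m ∂law q ∧
      ∀ᵐ η ∂field (pairLaw q r), upperEdge (shift v (lower η)) m ≠ ⊥ := by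
  have hmp : MeasurePreserving (fun η => shift v (lower η)) (field (pairLaw q r)) (law q) :=
    (measurePreserving_shift (bernoulliMeasure true false q) v).comp (measurePreserving_lower q r)
  obtain ⟨h1, h2, -⟩ := integrable_edgeR (hq m)
  refine ⟨hmp.integrable_comp_of_integrable h2, ?_, hmp.quasiMeasurePreserving.ae h1⟩
  rw [← hmp.map_eq, integral_map hmp.aemeasurable (measurable_edgeR m).aestronglyMeasurable]

lemma ae_upperEdge_hybrid_ne_bot (hq : ∀ n, meanUpperEdge q n ≠ ⊥) (k n : ℕ) :
    ∀ᵐ η ∂field (pairLaw q r), upperEdge (hybrid k η) n ≠ ⊥ := by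
  have hmp := measurePreserving_lower q r
  filter_upwards [hmp.quasiMeasurePreserving.ae (integrable_edgeR (hq n)).1] with η hη hbot
  have : upperEdge (lower η) n ≤ upperEdge (hybrid k η) n := upperEdge_mono fun v _ _ hv => by
    simp only [lower] at hv
    simp [hybrid, hv]
  exact hη (le_bot_iff.1 (hbot ▸ this))

lemma integrable_edgeR_hybrid (hq : ∀ n, meanUpperEdge q n ≠ ⊥) (k n : ℕ) :
    Integrable (fun η => edgeR (hybrid k η) n) (field (pairLaw q r)) := by
  have hmp := measurePreserving_lower q r
  have hi : Integrable (fun η => edgeR (lower η) n) (field (pairLaw q r)) :=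
    hmp.integrable_comp_of_integrable (integrable_edgeR (hq n)).2.1
  refine ((integrable_const (n : ℝ)).add hi.abs).mono'
    ((measurable_edgeR n).comp (measurable_hybrid k)).aestronglyMeasurable ?_
  filter_upwards [hmp.quasiMeasurePreserving.ae (integrable_edgeR (hq n)).1,
    ae_upperEdge_hybrid_ne_bot (r := r) hq k n] with η h1 h2
  have h3 : upperEdge (lower η) n ≤ upperEdge (hybrid k η) n := upperEdge_mono fun v _ _ hv => by
    simp only [lower] at hv
    simp [hybrid, hv]
  rw [← coe_edgeR h1, ← coe_edgeR h2, EReal.coe_le_coe_iff] at h3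
  have h4 := edgeR_le (hybrid k η) n
  have h5 := neg_abs_le (edgeR (lower η) n)
  have h6 := abs_nonneg (edgeR (lower η) n)
  simp only [Pi.add_apply, Real.norm_eq_abs, abs_le]
  constructor <;> [linarith [(Nat.cast_nonneg n : (0 : ℝ) ≤ n)]; linarith]

/-- Using the second label at level `k` raises the mean of the upper edge. -/
lemma gain_hybrid (hq : ∀ n, meanUpperEdge q n ≠ ⊥) (k m : ℕ) :
    ∫ η, edgeR (hybrid k η) (k + 1 + m) ∂field (pairLaw q r) + 2 * ((1 - q) * r) ≤
      ∫ η, edgeR (hybrid (k + 1) η) (k + 1 + m) ∂field (pairLaw q r) := by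
  set μ := field (pairLaw q r) with hμ
  set n := k + 1 + m with hn
  have hmono : ∀ η, upperEdge (hybrid k η) n ≤ upperEdge (hybrid (k + 1) η) n := fun η =>
    upperEdge_mono fun v _ _ hv => by
      simp only [hybrid, Bool.or_eq_true, Bool.and_eq_true, decide_eq_true_eq] at hv ⊢
      push_cast
      rcases hv with hv | hv
      · exact Or.inl hv
      · exact Or.inr ⟨by omega, hv.2⟩
  set D : ℤ → (ℤ × ℤ → Bool × Bool) → ℝ := fun x η =>
    2 + edgeR (shift ((k : ℤ) + 1, x + 1) (lower η)) m -
      edgeR (shift ((k : ℤ) + 1, x - 1) (lower η)) m with hD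
  set A : ℤ → Set (ℤ × ℤ → Bool × Bool) := fun x => hybrid k ⁻¹' edgeAt k x with hA
  set E : ℤ → Set (ℤ × ℤ → Bool × Bool) := fun x => (fun η => η (k, x)) ⁻¹' {(false, true)} with hE
  have hAm : ∀ x, MeasurableSet[sig (Bool × Bool) (slab 0 k)] (A x) := fun x =>
    measurable_hybrid_sig k _ (measurableSet_edgeAt_sig k x)
  have hEm : ∀ x : ℤ, MeasurableSet[sig (Bool × Bool) {((k : ℤ), x)}] (E x) := fun x =>
    measurable_eval_sig (Set.mem_singleton _) (measurableSet_singleton _)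
  have hEp : ∀ x, μ (E x) = ENNReal.ofReal ((1 - q) * r) := by
    intro x
    have h1 : μ (E x) = pairLaw q r {(false, true)} :=
      (measurePreserving_eval_infinitePi (fun _ : ℤ × ℤ => pairLaw q r) (k, x)).measure_preimage
        (measurableSet_singleton _).nullMeasurableSet
    have h2 : ({(false, true)} : Set (Bool × Bool)) = {false} ×ˢ {true} := by simp
    rw [h1, h2, ← ofReal_measureReal, measureReal_prod_prod]
    simp
  have hDm : ∀ x, Measurable[sig (Bool × Bool) (levelGe (k + 1))] (D x) := by
    intro x
    have h1 : ∀ y : ℤ, Measurable[sig (Bool × Bool) (levelGe (k + 1))]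
        fun η : ℤ × ℤ → Bool × Bool => edgeR (shift ((k : ℤ) + 1, y) (lower η)) m := fun y =>
      (measurable_edgeR_sig m).comp ((measurable_reindex_sig _ fun z hz => by
        simp only [levelGe, Set.mem_ofPred_eq, Prod.fst_add] at hz ⊢; omega).comp
          (measurable_lower_sig _))
    exact (measurable_const.add (h1 _)).sub (h1 _)
  have hDi : ∀ x, ENNReal.ofReal 2 ≤ ∫⁻ η, ENNReal.ofReal (D x η) ∂μ := by
    intro x
    obtain ⟨h1, h2, -⟩ := integrable_edgeR_shift_lower (r := r) hq ((k : ℤ) + 1, x + 1) m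
    obtain ⟨h3, h4, -⟩ := integrable_edgeR_shift_lower (r := r) hq ((k : ℤ) + 1, x - 1) m
    have hi : Integrable (D x) μ := ((integrable_const (2 : ℝ)).add h1).sub h3
    refine le_trans (ENNReal.ofReal_le_ofReal (le_of_eq ?_)) (ofReal_integral_le_lintegral hi)
    have h5 : ∫ η, D x η ∂μ = ∫ η, ((2 : ℝ) + edgeR (shift ((k : ℤ) + 1, x + 1) (lower η)) m) ∂μ -
        ∫ η, edgeR (shift ((k : ℤ) + 1, x - 1) (lower η)) m ∂μ :=
      integral_sub ((integrable_const (2 : ℝ)).add h1) h3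
    rw [h5, integral_add (integrable_const _) h1, h2, h4]
    simp
  have hpt : ∀ᵐ η ∂μ, ∑' x, (A x ∩ E x).indicator (fun η => ENNReal.ofReal (D x η)) η ≤
      ENNReal.ofReal (edgeR (hybrid (k + 1) η) n - edgeR (hybrid k η) n) := by
    have hfin : ∀ᵐ η ∂μ, ∀ y : ℤ, upperEdge (shift ((k : ℤ) + 1, y) (lower η)) m ≠ ⊥ :=
      ae_all_iff.2 fun y => (integrable_edgeR_shift_lower hq _ m).2.2
    filter_upwards [hfin, ae_upperEdge_hybrid_ne_bot hq k n, ae_upperEdge_hybrid_ne_bot hq k k,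
      ae_upperEdge_hybrid_ne_bot hq (k + 1) n] with η h1 h2 h3 h4
    obtain ⟨x, hx⟩ := exists_edgeAt h3
    rw [tsum_eq_single x]
    swap
    · intro y hy
      refine Set.indicator_of_notMem (fun h' => hy ?_) _
      have : ((y : ℝ) : EReal) = ((x : ℝ) : EReal) :=
        (show upperEdge (hybrid k η) k = _ from h'.1).symm.trans hx
      exact_mod_cast this
    by_cases hE' : η ∈ A x ∩ E x
    swap
    · rw [Set.indicator_of_notMem hE']; exact zero_le
    rw [Set.indicator_of_mem hE']
    have hη : η (k, x) = (false, true) := hE'.2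
    have hx' : upperEdge (hybrid (k + 1) η) k = ((x : ℝ) : EReal) := by
      rw [← show upperEdge (hybrid k η) k = _ from hx]
      refine le_antisymm (upperEdge_mono ?_) (upperEdge_mono ?_) <;> intro v _ hv <;>
        simp [hybrid, hv, show v.1 < k + 1 by omega]
    have hlow := upperEdge_le_of_closed (ω := hybrid k η) (ζ := lower η) (k := k) (m := m) hx
      (by simp [hybrid, hη]) (fun z hz => by
        simp [hybrid, lower, not_lt.2 hz.le])
    have hup := le_upperEdge_of_open (ω := hybrid (k + 1) η) (ζ := lower η) (k := k) (m := m) hx'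
      (by simp [hybrid, hη]) (fun z hz h => by
        simp only [lower] at h
        simp [hybrid, h])
    have hmon := hmono η
    rw [← hn, ← coe_edgeR h2, ← coe_edgeR (h1 (x - 1)), ← EReal.coe_add, EReal.coe_le_coe_iff] at hlow
    rw [← hn, ← coe_edgeR h4, ← coe_edgeR (h1 (x - 1)), ← coe_edgeR (h1 (x + 1)), ← EReal.coe_add,
      ← EReal.coe_add, le_max_iff, EReal.coe_le_coe_iff, EReal.coe_le_coe_iff] at hup
    rw [← coe_edgeR h2, ← coe_edgeR h4, EReal.coe_le_coe_iff] at hmon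
    refine ENNReal.ofReal_le_ofReal ?_
    simp only [hD]
    rcases hup with hup | hup <;> linarith
  have hsum : ENNReal.ofReal (2 * ((1 - q) * r)) ≤
      ∫⁻ η, ∑' x, (A x ∩ E x).indicator (fun η => ENNReal.ofReal (D x η)) η ∂μ := by
    have hterm : ∀ x, ∫⁻ η, (A x ∩ E x).indicator (fun η => ENNReal.ofReal (D x η)) η ∂μ =
        μ (A x) * μ (E x) * ∫⁻ η, ENNReal.ofReal (D x η) ∂μ := by
      intro x
      have hS : MeasurableSet[sig (Bool × Bool) (slab 0 k ∪ {((k : ℤ), x)})] (A x ∩ E x) :=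
        @MeasurableSet.inter _ (sig (Bool × Bool) (slab 0 k ∪ {((k : ℤ), x)})) _ _
          (sig_mono Set.subset_union_left _ (hAm x)) (sig_mono Set.subset_union_right _ (hEm x))
      have hdis : Disjoint (slab 0 k ∪ {((k : ℤ), x)}) (levelGe (k + 1)) := by
        rw [Set.disjoint_left]
        rintro z (hz | hz) hz'
        · have := hz.2; have : (k : ℤ) + 1 ≤ z.1 := hz'; omega
        · rw [Set.mem_singleton_iff] at hz
          have : (k : ℤ) + 1 ≤ z.1 := hz'
          rw [hz] at this; simp at this
      have hdis2 : Disjoint (slab 0 k) {((k : ℤ), x)} := by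
        rw [Set.disjoint_singleton_right]
        intro h; exact absurd h.2 (lt_irrefl _)
      have h1 := lintegral_mul_eq_mul (pairLaw q r) hdis
        (f := (A x ∩ E x).indicator 1) (g := fun η => ENNReal.ofReal (D x η))
        (Measurable.indicator measurable_const hS) (ENNReal.measurable_ofReal.comp (hDm x))
      rw [lintegral_indicator_one (sig_le _ _ hS), measure_inter_eq_mul _ hdis2 (hAm x) (hEm x)] at h1
      rw [← h1]
      refine lintegral_congr fun η => ?_
      by_cases h : η ∈ A x ∩ E x <;> simp only [h, Set.indicator_of_mem, Set.indicator_of_notMem,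
        Pi.one_apply, one_mul, zero_mul, not_false_eq_true]
    have hAE : ∀ x, MeasurableSet (A x ∩ E x) := fun x =>
      (sig_le _ _ (hAm x)).inter (sig_le _ _ (hEm x))
    have hone : ∑' x, μ (A x) = 1 := by
      rw [← measure_iUnion (fun x y hxy => ?_) fun x => sig_le _ _ (hAm x)]
      · have : IsProbabilityMeasure μ := by rw [hμ]; infer_instance
        rw [prob_compl_eq_zero_iff (MeasurableSet.iUnion fun x => sig_le _ _ (hAm x)) |>.symm]
        have := ae_upperEdge_hybrid_ne_bot (r := r) hq k k
        rw [ae_iff] at this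
        refine measure_mono_null (fun η hη => ?_) this
        intro h
        obtain ⟨x, hx⟩ := exists_edgeAt h
        exact hη (Set.mem_iUnion.2 ⟨x, hx⟩)
      · refine Set.disjoint_left.2 fun η h1 h2 => hxy ?_
        have : ((x : ℝ) : EReal) = ((y : ℝ) : EReal) :=
          (show upperEdge (hybrid k η) k = _ from h1).symm.trans h2
        exact_mod_cast this
    have hDm' : ∀ x, Measurable fun η => ENNReal.ofReal (D x η) := fun x =>
      ENNReal.measurable_ofReal.comp ((hDm x).mono (sig_le _) le_rfl)
    rw [lintegral_tsum fun x => ((hDm' x).indicator (hAE x)).aemeasurable]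
    calc ENNReal.ofReal (2 * ((1 - q) * r))
        = ∑' x, μ (A x) * ENNReal.ofReal ((1 - q) * r) * ENNReal.ofReal 2 := by
          rw [ENNReal.tsum_mul_right, ENNReal.tsum_mul_right, hone, one_mul,
            ENNReal.ofReal_mul (by norm_num), mul_comm]
      _ ≤ _ := by
          refine ENNReal.tsum_le_tsum fun x => ?_
          rw [hterm x, hEp x]
          exact mul_le_mul_right (hDi x) _
  have hintg : Integrable (fun η => edgeR (hybrid (k + 1) η) n - edgeR (hybrid k η) n) μ :=
    (integrable_edgeR_hybrid (r := r) hq (k + 1) n).sub (integrable_edgeR_hybrid hq k n)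
  have hnn : 0 ≤ᵐ[μ] fun η => edgeR (hybrid (k + 1) η) n - edgeR (hybrid k η) n := by
    filter_upwards [ae_upperEdge_hybrid_ne_bot hq k n, ae_upperEdge_hybrid_ne_bot hq (k + 1) n]
      with η h1 h2
    have := hmono η
    rw [← coe_edgeR h1, ← coe_edgeR h2, EReal.coe_le_coe_iff] at this
    simpa using this
  have hfinal : ENNReal.ofReal (2 * ((1 - q) * r)) ≤ ENNReal.ofReal
      (∫ η, (edgeR (hybrid (k + 1) η) n - edgeR (hybrid k η) n) ∂μ) := by
    rw [ofReal_integral_eq_lintegral_ofReal hintg hnn]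
    exact hsum.trans (lintegral_mono_ae hpt)
  rw [ENNReal.ofReal_le_ofReal_iff (integral_nonneg_of_ae hnn), integral_sub
    (integrable_edgeR_hybrid hq (k + 1) n) (integrable_edgeR_hybrid hq k n)] at hfinal
  linarith

lemma mean_hybrid_ge (hq : ∀ n, meanUpperEdge q n ≠ ⊥) (n k : ℕ)
    (hk : k ≤ n) :
    ∫ ω, edgeR ω n ∂law q + 2 * ((1 - q) * r) * k ≤
      ∫ η, edgeR (hybrid k η) n ∂field (pairLaw q r) := by
  induction k with
  | zero =>
    have hmp := measurePreserving_lower q r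
    have h0 : ∀ η, edgeR (hybrid 0 η) n = edgeR (lower η) n := by
      intro η
      have : upperEdge (hybrid 0 η) n = upperEdge (lower η) n := by
        refine le_antisymm (upperEdge_mono ?_) (upperEdge_mono ?_) <;> intro v hv _ <;>
          simp [hybrid, lower, not_lt.2 hv]
      rw [edgeR, this, edgeR]
    simp only [h0]
    rw [← hmp.map_eq, integral_map hmp.aemeasurable (measurable_edgeR n).aestronglyMeasurable]
    simp
  | succ k ih =>
    obtain ⟨m, rfl⟩ : ∃ m, n = k + 1 + m := ⟨n - (k + 1), by omega⟩
    have h1 := ih (by omega)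
    have h2 := gain_hybrid (r := r) hq k m
    push_cast
    linarith

end Gain

/-- Above criticality the mean of the upper edge grows at least linearly. -/
lemma exists_meanUpperEdge_ge {p : I} (hp : criticalValue < p) :
    ∃ c : ℝ, 0 < c ∧ ∀ n : ℕ, 1 ≤ n → ((c * n : ℝ) : EReal) ≤ meanUpperEdge p n := by
  obtain ⟨_, ⟨q, rfl, hq⟩, hqp⟩ := (csInf_lt_iff ⟨0, by rintro _ ⟨q, rfl, -⟩; exact q.2.1⟩ (by
    by_contra hne
    rw [Set.not_nonempty_iff_eq_empty] at hne
    have h1 : percProb 1 = 0 := by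
      by_contra h
      exact Set.notMem_empty (1 : ℝ) (hne ▸ ⟨1, rfl, pos_iff_ne_zero.2 h⟩)
    have h2 : percProb 1 = 1 := by
      have hlaw : law 1 = Measure.dirac (fun _ => true) := by simp [law]
      rw [percProb, hlaw, Measure.dirac_apply, Set.indicator_of_mem]
      · rfl
      · refine Set.infinite_of_injective_forall_mem (f := fun n : ℕ => ((n : ℤ), (n : ℤ)))
          (fun a b h => by simpa using h) fun n => ?_
        refine ⟨⟨by simp, le_rfl⟩, ?_⟩
        induction n with
        | zero => exact .refl
        | succ n ih =>
          refine ih.tail ⟨⟨by simp, by simp⟩, rfl, Or.inl (by simp)⟩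
    rw [h1] at h2
    exact zero_ne_one h2)).1 hp
  have hq1 : (q : ℝ) < 1 := hqp.trans_le p.2.2
  set r : I := ⟨(p - q) / (1 - q), div_nonneg (by linarith) (by linarith),
    (div_le_one (by linarith)).2 (by linarith [p.2.2])⟩ with hr
  have hne : (1 - q : ℝ) ≠ 0 := by linarith
  have hr1 : ((1 - q) * r : ℝ) = p - q := by rw [hr]; field_simp
  have hpr : (1 - p : ℝ) = (1 - q) * (1 - r) := by
    rw [mul_sub, hr1]; ring
  have hqn : ∀ n, 0 ≤ meanUpperEdge q n := by
    intro n
    rcases Nat.eq_zero_or_pos n with rfl | hn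
    · rw [meanUpperEdge_zero]
    · exact meanUpperEdge_nonneg hq hn
  have hqb : ∀ n, meanUpperEdge q n ≠ ⊥ := fun n h => by
    have := hqn n; rw [h] at this; simp at this
  refine ⟨2 * (p - q), by linarith, fun n hn => ?_⟩
  have hpb : meanUpperEdge p n ≠ ⊥ := fun h => hqb n (le_bot_iff.1 (h ▸ meanUpperEdge_mono hpr n))
  rw [(integrable_edgeR hpb).2.2, EReal.coe_le_coe_iff]
  have h1 := mean_hybrid_ge (r := r) hqb n n le_rfl
  have h2 : (0 : ℝ) ≤ ∫ ω, edgeR ω n ∂law q := by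
    have := hqn n
    rw [(integrable_edgeR (hqb n)).2.2] at this
    exact_mod_cast this
  have h3 : ∫ η, edgeR (hybrid n η) n ∂field (pairLaw q r) = ∫ ω, edgeR ω n ∂law p := by
    have hmp := measurePreserving_upper hpr
    rw [← hmp.map_eq, integral_map hmp.aemeasurable (measurable_edgeR n).aestronglyMeasurable]
    refine integral_congr_ae (ae_of_all _ fun η => ?_)
    have : upperEdge (hybrid n η) n = upperEdge (upper η) n := by
      refine le_antisymm (upperEdge_mono ?_) (upperEdge_mono ?_) <;> intro v _ hv <;>
        simp [hybrid, upper, hv]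
    simp only [edgeR, this]
  rw [hr1, h3] at h1
  linarith

/-- Above criticality the slope is a positive real number, at most one. -/
lemma exists_slope_eq {p : I} (hp : criticalValue < p) :
    ∃ α : ℝ, 0 < α ∧ α ≤ 1 ∧ slope p = α := by
  obtain ⟨c, hc, h⟩ := exists_meanUpperEdge_ge hp
  have hge : (c : EReal) ≤ slope p := by
    refine le_iInf₂ fun n hn => ?_
    have hn' : (0 : ℝ) < n := by exact_mod_cast hn
    rw [EReal.le_div_iff_mul_le (by exact_mod_cast hn') (EReal.natCast_ne_top n)]
    have := h n hn
    rwa [EReal.coe_mul] at this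
  have hle : slope p ≤ 1 := by
    refine (iInf₂_le 1 le_rfl).trans ?_
    have h1 : meanUpperEdge p 1 ≠ ⊥ := by
      intro hb
      have := h 1 le_rfl
      rw [hb] at this
      simp at this
    rw [(integrable_edgeR h1).2.2]
    have : ∫ ω, edgeR ω 1 ∂law p ≤ 1 := by
      calc ∫ ω, edgeR ω 1 ∂law p ≤ ∫ _, (1 : ℝ) ∂law p :=
            integral_mono (integrable_edgeR h1).2.1 (integrable_const _)
              fun ω => by simpa using edgeR_le ω 1
        _ = 1 := by simp
    simp only [Nat.cast_one, div_one]
    exact_mod_cast this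
  have hbot : slope p ≠ ⊥ := (lt_of_lt_of_le (EReal.bot_lt_coe c) hge).ne'
  have htop : slope p ≠ ⊤ := (lt_of_le_of_lt hle (EReal.coe_lt_top 1)).ne
  have he := EReal.coe_toReal htop hbot
  refine ⟨(slope p).toReal, ?_, ?_, he.symm⟩
  · rw [← he] at hge
    exact hc.trans_le (by exact_mod_cast hge)
  · rw [← he] at hle
    exact_mod_cast hle

/-! ### The upper edge has speed `α`, and is followed by a path in a narrow corridor -/

section Speed

variable {p : I} {α : ℝ}

lemma le_meanUpperEdge (hα : slope p = α) {n : ℕ} (hn : 1 ≤ n) :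
    ((α * n : ℝ) : EReal) ≤ meanUpperEdge p n := by
  have hn' : (0 : ℝ) < n := by exact_mod_cast hn
  have h : (α : EReal) ≤ meanUpperEdge p n / (n : EReal) := hα ▸ iInf₂_le n hn
  rw [EReal.le_div_iff_mul_le (by exact_mod_cast hn') (EReal.natCast_ne_top n)] at h
  rwa [EReal.coe_mul]

lemma exists_deviation_above_slope (hα : slope p = α) {η : ℝ} (hη : 0 < η) :
    ∃ θ C : ℝ, 0 < θ ∧ 0 < C ∧ ∀ (k : ℕ) (y : ℝ),
      law p {ω | (((α + η) * k + y : ℝ) : EReal) ≤ upperEdge ω k} ≤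
        ENNReal.ofReal (C * Real.exp (-(θ * y))) := by
  have h : slope p < ((α + η : ℝ) : EReal) := by rw [hα]; exact_mod_cast lt_add_of_pos_right α hη
  obtain ⟨n, h⟩ := iInf_lt_iff.1 h
  obtain ⟨hn, h⟩ := iInf_lt_iff.1 h
  refine exists_upper_deviation hn ?_
  have hn' : (0 : ℝ) < n := by exact_mod_cast hn
  rw [EReal.div_lt_iff (by exact_mod_cast hn') (EReal.natCast_ne_top n)] at h
  rwa [EReal.coe_mul]

lemma tendsto_exp_neg_mul {c : ℝ} (hc : 0 < c) :
    Tendsto (fun N : ℕ => Real.exp (-(c * N))) atTop (𝓝 0) := by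
  refine Real.tendsto_exp_atBot.comp (tendsto_neg_atTop_atBot.comp ?_)
  exact tendsto_natCast_atTop_atTop.const_mul_atTop hc

/-- The lower half of the law of large numbers for the upper edge. -/
lemma eventually_lowProb_le (hα : slope p = α) (hα0 : 0 ≤ α) {η δ : ℝ} (hη : 0 < η) (hδ : 0 < δ) :
    ∀ᶠ N : ℕ in atTop, lowProb p (α - η) N ≤ ENNReal.ofReal δ := by
  set η' := η * δ / 4 with hη'
  have hη'0 : 0 < η' := by positivity
  obtain ⟨θ, C, hθ, hC, hdev⟩ := exists_deviation_above_slope hα hη'0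
  have hlim : Tendsto (fun N : ℕ => C * Real.exp (-(θ * η' * N))) atTop (𝓝 0) := by
    simpa using (tendsto_exp_neg_mul (mul_pos hθ hη'0)).const_mul C
  filter_upwards [hlim.eventually (ge_mem_nhds (show 0 < η * δ / 2 by positivity)),
    eventually_ge_atTop 1] with N hN hN1
  have hN0 : (0 : ℝ) < N := by exact_mod_cast hN1
  have hmean := le_meanUpperEdge hα hN1
  have hbot : meanUpperEdge p N ≠ ⊥ := (lt_of_lt_of_le (EReal.bot_lt_coe _) hmean).ne'
  obtain ⟨hne, hintg, he⟩ := integrable_edgeR hbot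
  rw [he, EReal.coe_le_coe_iff] at hmean
  set A := {ω : Config | upperEdge ω N ≤ (((α - η) * N : ℝ) : EReal)} with hA
  set B := {ω : Config | (((α + η') * N + η' * N : ℝ) : EReal) ≤ upperEdge ω N} with hB
  have hAm : MeasurableSet A := measurableSet_upperEdge_le N _
  have hBm : MeasurableSet B := measurableSet_le measurable_const (measurable_upperEdge N)
  have hBr : (law p).real B ≤ η * δ / 2 := by
    refine le_trans (ENNReal.toReal_le_of_le_ofReal (by positivity) (hdev N (η' * N))) ?_
    rwa [mul_assoc] at hN
  have hi1 : Integrable (A.indicator fun _ => -((η + 2 * η') * N : ℝ)) (law p) :=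
    (integrable_const _).indicator hAm
  have hi2 : Integrable (B.indicator fun _ => (N : ℝ)) (law p) :=
    (integrable_const _).indicator hBm
  have hi3 : Integrable (fun ω => (α + 2 * η') * N
      + A.indicator (fun _ => -((η + 2 * η') * N : ℝ)) ω) (law p) := (integrable_const _).add hi1
  have hle : ∫ ω, edgeR ω N ∂law p ≤ ∫ ω, ((α + 2 * η') * N
      + A.indicator (fun _ => -((η + 2 * η') * N)) ω + B.indicator (fun _ => (N : ℝ)) ω) ∂law p := by
    refine integral_mono_ae hintg (hi3.add hi2) ?_
    filter_upwards [hne] with ω hω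
    have h1 := edgeR_le ω N
    have h2 := coe_edgeR hω
    have hAB : ω ∈ A ↔ edgeR ω N ≤ (α - η) * N := by
      rw [hA, Set.mem_ofPred_eq, ← h2, EReal.coe_le_coe_iff]
    have hBB : ω ∈ B ↔ (α + η') * N + η' * N ≤ edgeR ω N := by
      rw [hB, Set.mem_ofPred_eq, ← h2, EReal.coe_le_coe_iff]
    have h3 : 0 ≤ α * N := by positivity
    have h4 : 0 < η * N := by positivity
    have h5 : 0 < η' * N := by positivity
    by_cases ha : ω ∈ A <;> by_cases hb : ω ∈ B <;>
      simp only [ha, hb, Set.indicator_of_mem, Set.indicator_of_notMem, not_false_eq_true] <;>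
      simp only [hAB, hBB] at ha hb <;> nlinarith
  rw [integral_add hi3 hi2, integral_add (integrable_const _) hi1,
    integral_indicator_const _ hAm, integral_indicator_const _ hBm] at hle
  simp only [integral_const, probReal_univ, smul_eq_mul, one_mul] at hle
  have hfin : (law p).real A ≤ δ := by
    have h6 : 0 ≤ (law p).real A := measureReal_nonneg
    have h7 : (η + 2 * η') * (law p).real A ≤ 2 * η' + (law p).real B := by
      refine le_of_mul_le_mul_right ?_ hN0
      linarith
    have h8 : 0 ≤ η' * (law p).real A := by positivity
    have h9 : η * (law p).real A ≤ η * δ := by nlinarith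
    exact le_of_mul_le_mul_left h9 hη
  exact ENNReal.le_ofReal_iff_toReal_le (measure_ne_top _ _) hδ.le |>.2 hfin

end Speed

/-- The sites of levels `[0, N)` at vertical distance at most `w` from the line of slope `α`. -/
def corridor (α w : ℝ) (N : ℕ) : Set (ℤ × ℤ) :=
  {z | 0 ≤ z.1 ∧ z.1 < N ∧ |(z.2 : ℝ) - α * z.1| ≤ w}

/-- There is a path in the corridor from its left end, starting at or below height `0`, to level
`N`. -/
def corridorEvent (α w : ℝ) (N : ℕ) : Set Config :=
  {ω | ∃ s y x : ℤ, 0 ≤ s ∧ s ≤ 1 ∧ y ≤ 0 ∧ (s, y) ∈ lattice ∧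
    PathIn (corridor α w N) ω (s, y) (N, x)}

lemma measurableSet_corridorEvent (α w : ℝ) (N : ℕ) :
    MeasurableSet[sig Bool (corridor α w N)] (corridorEvent α w N) := by
  have : corridorEvent α w N = ⋃ (s : ℤ) (y : ℤ) (x : ℤ),
      {_ω : Config | 0 ≤ s ∧ s ≤ 1 ∧ y ≤ 0 ∧ (s, y) ∈ lattice} ∩
        {ω : Config | PathIn (corridor α w N) ω (s, y) (N, x)} := by
    ext ω
    simp only [corridorEvent, Set.mem_ofPred_eq, Set.mem_iUnion, Set.mem_inter_iff, and_assoc]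
  rw [this]
  exact MeasurableSet.iUnion fun s => MeasurableSet.iUnion fun y => MeasurableSet.iUnion fun x =>
    (MeasurableSet.const _).inter (measurableSet_pathIn _ _ _)

lemma exists_isPath_of_mem_corridorEvent {α w : ℝ} (hα0 : 0 ≤ α) (hα1 : α ≤ 1) {N : ℕ}
    (hN : 2 ≤ N) {ω : Config} (h : ω ∈ corridorEvent α w N) :
    ∃ (s : ℤ) (g : ℤ → ℤ), 0 ≤ s ∧ s ≤ 1 ∧ g s ≤ 0 ∧ IsPath ω g s N ∧
      ∀ l, s ≤ l → l ≤ N → |(g l : ℝ) - α * l| ≤ w + 4 := by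
  obtain ⟨s, y, x, hs0, hs1, hy, hl, hp⟩ := h
  obtain ⟨g, hg, hgs, hgN, hR⟩ := hp.exists_isPath hl
  simp only at hgs hgN hg hR
  refine ⟨s, g, hs0, hs1, hgs.trans_le hy, hg, fun l hsl hlN => ?_⟩
  have hvert : ∀ l, s ≤ l → l < N → Even (l + g l) → |(g l : ℝ) - α * l| ≤ w :=
    fun l h1 h2 h3 => (hR l h1 h2 h3).2.2
  have hstep : ∀ l, s ≤ l → l < N → |(g (l + 1) : ℝ) - α * (l + 1 : ℤ)| ≤ |(g l : ℝ) - α * l| + 2 := by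
    intro l h1 h2
    have h3 := (hg.2.2 l h1 h2).1
    have h4 : |(g (l + 1) : ℝ) - g l| ≤ 1 := by exact_mod_cast h3
    rw [show (g (l + 1) : ℝ) - α * (l + 1 : ℤ) = (g l - α * l) + ((g (l + 1) - g l) - α) by
      push_cast; ring]
    refine (abs_add_le _ _).trans ?_
    have : |((g (l + 1) : ℝ) - g l) - α| ≤ 2 := by
      rw [abs_le] at h4 ⊢; constructor <;> linarith [h4.1, h4.2]
    linarith
  have hw : 0 ≤ w := (abs_nonneg _).trans (hvert s le_rfl (by omega) hg.2.1)
  rcases hsl.eq_or_lt with rfl | hlt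
  · linarith [hvert s le_rfl (by omega) hg.2.1]
  have h1 := hstep (l - 1) (by omega) (by omega)
  rw [sub_add_cancel] at h1
  by_cases he : Even (l - 1 + g (l - 1))
  · linarith [hvert (l - 1) (by omega) (by omega) he]
  · have hs' : s < l - 1 := by
      rcases (show s ≤ l - 1 by omega).eq_or_lt with h | h
      · exact absurd (h ▸ hg.2.1) he
      · exact h
    have he' : Even (l - 1 - 1 + g (l - 1 - 1)) := by
      by_contra hc
      have := (hg.2.2 (l - 1 - 1) (by omega) (by omega)).2.2 hc
      rw [sub_add_cancel] at this
      rw [this] at he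
      grind
    have h2 := hstep (l - 1 - 1) (by omega) (by omega)
    rw [sub_add_cancel] at h2
    linarith [hvert (l - 1 - 1) (by omega) (by omega) he']

/-- A path all of whose vertices lie in `R` is a path in `R`. -/
lemma pathIn_of_forall_mem {R : Set (ℤ × ℤ)} {ω : Config} {z w : ℤ × ℤ}
    (h : Relation.ReflTransGen (Step ω) z w)
    (hR : ∀ v, Relation.ReflTransGen (Step ω) z v → Relation.ReflTransGen (Step ω) v w →
      v.1 < w.1 → v ∈ R) : PathIn R ω z w := by
  induction h using Relation.ReflTransGen.head_induction_on with
  | refl => exact .refl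
  | head h h' ih =>
    exact .head ⟨hR _ .refl (.head h h') (h.level_lt.trans_le (path_level_le h')), h⟩
      (ih fun v h1 h2 h3 => hR v (.head h h1) h2 h3)

/-- The event that `(N, x)` with `x > b` is reached from level `k` below `c` costs as much as a
large upper edge. -/
lemma law_reached_from_low_le (p : I) {k N : ℕ} (hk : k ≤ N) (b c : ℝ) :
    law p {ω | ∃ y x : ℤ, (y : ℝ) ≤ c ∧ b ≤ x ∧ ((k : ℤ), y) ∈ lattice ∧
      Relation.ReflTransGen (Step ω) (k, y) (N, x)} ≤
    law p {ω | ((b - c - 1 : ℝ) : EReal) ≤ upperEdge ω (N - k)} := by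
  obtain ⟨y₀, hy1, hy2, hy3⟩ : ∃ y₀ : ℤ, ⌊c⌋ ≤ y₀ ∧ y₀ ≤ ⌊c⌋ + 1 ∧ Even ((k : ℤ) + y₀) := by
    rcases Int.even_or_odd ((k : ℤ) + ⌊c⌋) with h | h
    · exact ⟨⌊c⌋, le_rfl, by omega, h⟩
    · exact ⟨⌊c⌋ + 1, by omega, le_rfl, by grind⟩
  have hv : ((k : ℤ), y₀) ∈ lattice := ⟨hy3, by simp⟩
  have hmp : MeasurePreserving (shift ((k : ℤ), y₀)) (law p) (law p) :=
    measurePreserving_shift _ _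
  rw [← hmp.measure_preimage (measurableSet_le measurable_const (measurable_upperEdge (N - k))).nullMeasurableSet]
  refine measure_mono ?_
  rintro ω ⟨y, x, hy, hx, hl, hp⟩
  have hmem : x - y₀ ∈ reachedFromBelow (shift ((k : ℤ), y₀) ω) (N - k) := by
    refine ⟨y - y₀, ?_, Or.inl ?_⟩
    · have := Int.le_floor.2 hy; omega
    · rw [connects_shift_iff hv (by simp)]
      refine ⟨by simpa using hl, ?_⟩
      have e : (((N - k : ℕ) : ℤ), x - y₀) + ((k : ℤ), y₀) = ((N : ℤ), x) := by
        ext <;> simp [Nat.cast_sub hk]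
      rw [e]
      simpa using hp
  refine le_trans ?_ (le_upperEdge hmem)
  rw [EReal.coe_le_coe_iff]
  have h1 : (y₀ : ℝ) ≤ ⌊c⌋ + 1 := by exact_mod_cast hy2
  have h2 := Int.floor_le c
  push_cast
  linarith

lemma eventually_corridorEvent {p : I} {α : ℝ} (hα : slope p = α) (hα0 : 0 ≤ α) {β δ : ℝ}
    (hβ : 0 < β) (hδ : 0 < δ) :
    ∀ᶠ N : ℕ in atTop, law p (corridorEvent α (β * N) N)ᶜ ≤ ENNReal.ofReal δ := by
  set η := β / 4 with hη
  have hη0 : 0 < η := by positivity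
  obtain ⟨θ, C, hθ, hC, hdev⟩ := exists_deviation_above_slope hα hη0
  have hlim : Tendsto (fun N : ℕ => 2 * ((N + 1 : ℕ) * (C * Real.exp (-(θ * (2 * η * N - 1)))))) atTop
      (𝓝 0) := by
    have hr : Real.exp (-(θ * (2 * η))) < 1 := Real.exp_lt_one_iff.2 (neg_neg_of_pos (by positivity))
    have h1 := (tendsto_self_mul_const_pow_of_lt_one (Real.exp_pos _).le hr).add
      (tendsto_pow_atTop_nhds_zero_of_lt_one (Real.exp_pos _).le hr)
    have h2 := h1.const_mul (2 * (C * Real.exp θ))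
    rw [add_zero, mul_zero] at h2
    refine h2.congr fun N => ?_
    rw [← Real.exp_nat_mul, show -(θ * (2 * η * N - 1)) = N * -(θ * (2 * η)) + θ by ring,
      Real.exp_add]
    push_cast
    ring
  filter_upwards [hlim.eventually (ge_mem_nhds (half_pos hδ)),
    eventually_lowProb_le hα hα0 hη0 (half_pos hδ)] with N h1 h2
  set A := {ω : Config | upperEdge ω N ≤ (((α - η) * N : ℝ) : EReal)} with hA
  set B : ℕ → Set Config := fun k => {ω | ((α * k + β * N : ℝ) : EReal) ≤ upperEdge ω k} with hB
  set D : ℕ → Set Config := fun k => {ω | ∃ y x : ℤ, (y : ℝ) ≤ α * k - β * N ∧ (α - η) * N ≤ x ∧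
    ((k : ℤ), y) ∈ lattice ∧ Relation.ReflTransGen (Step ω) (k, y) (N, x)} with hD
  have hsub : (corridorEvent α (β * N) N)ᶜ ⊆
      A ∪ ((⋃ k ∈ Finset.range (N + 1), B k) ∪ ⋃ k ∈ Finset.range (N + 1), D k) := by
    intro ω hω
    by_contra hcon
    simp only [Set.mem_union, Set.mem_iUnion, not_or, not_exists] at hcon
    obtain ⟨hcA, hcB, hcD⟩ := hcon
    refine hω ?_
    rw [hA, Set.mem_ofPred_eq, upperEdge_le_iff] at hcA
    push Not at hcA
    obtain ⟨x, hx, hxb⟩ := hcA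
    have hxb : (α - η) * N < x := by exact_mod_cast hxb
    have key : ∀ s y : ℤ, 0 ≤ s → s ≤ 1 → y ≤ 0 → Connects ω (s, y) (N, x) →
        ω ∈ corridorEvent α (β * N) N := by
      intro s y hs0 hs1 hy hc
      refine ⟨s, y, x, hs0, hs1, hy, hc.1, pathIn_of_forall_mem hc.2 fun v hv1 hv2 hv3 => ?_⟩
      have hv0 : 0 ≤ v.1 := hs0.trans (path_level_le hv1)
      obtain ⟨k, y'⟩ := v
      lift k to ℕ using hv0
      have hkN : k < N := by simpa using hv3
      have hkr : k ∈ Finset.range (N + 1) := Finset.mem_range.2 (by omega)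
      refine ⟨by simp, by simpa using hv3, ?_⟩
      rw [abs_le]
      constructor
      · by_contra hlt
        push Not at hlt
        refine hcD k hkr ⟨y', x, ?_, hxb.le, path_mem_lattice hv1 hc.1, hv2⟩
        simp at hlt; linarith
      · by_contra hlt
        push Not at hlt
        refine hcB k hkr ?_
        have hm : y' ∈ reachedFromBelow ω k := by
          refine ⟨y, hy, ?_⟩
          obtain rfl | rfl : s = 0 ∨ s = 1 := by omega
          · exact Or.inl ⟨hc.1, hv1⟩
          · exact Or.inr ⟨hc.1, hv1⟩
        refine le_trans ?_ (le_upperEdge hm)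
        rw [EReal.coe_le_coe_iff]
        simp at hlt; linarith
    obtain ⟨y, hy, h | h⟩ := hx
    · exact key 0 y le_rfl zero_le_one hy h
    · exact key 1 y zero_le_one le_rfl hy h
  have hBk : ∀ k ∈ Finset.range (N + 1), law p (B k) ≤
      ENNReal.ofReal (C * Real.exp (-(θ * (2 * η * N - 1)))) := by
    intro k hk
    have hk' : (k : ℝ) ≤ N := by exact_mod_cast Nat.lt_succ_iff.1 (Finset.mem_range.1 hk)
    refine le_trans (measure_mono ?_) (hdev k (2 * η * N - 1))
    intro ω hω
    change _ ≤ upperEdge ω k at hω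
    refine le_trans ?_ hω
    rw [EReal.coe_le_coe_iff]
    nlinarith [mul_le_mul_of_nonneg_left hk' hη0.le, mul_nonneg hη0.le (Nat.cast_nonneg (α := ℝ) N)]
  have hDk : ∀ k ∈ Finset.range (N + 1), law p (D k) ≤
      ENNReal.ofReal (C * Real.exp (-(θ * (2 * η * N - 1)))) := by
    intro k hk
    have hkN : k ≤ N := Nat.lt_succ_iff.1 (Finset.mem_range.1 hk)
    have hk' : (k : ℝ) ≤ N := by exact_mod_cast hkN
    refine le_trans (law_reached_from_low_le p hkN _ _) (le_trans (measure_mono ?_)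
      (hdev (N - k) (2 * η * N - 1)))
    intro ω hω
    change _ ≤ upperEdge ω (N - k) at hω
    refine le_trans ?_ hω
    rw [EReal.coe_le_coe_iff, Nat.cast_sub hkN]
    nlinarith [mul_nonneg hη0.le (Nat.cast_nonneg (α := ℝ) k)]
  calc law p (corridorEvent α (β * N) N)ᶜ
      ≤ law p A + (∑ k ∈ Finset.range (N + 1), law p (B k) +
          ∑ k ∈ Finset.range (N + 1), law p (D k)) := by
        refine (measure_mono hsub).trans ((measure_union_le _ _).trans ?_)
        gcongr
        refine (measure_union_le _ _).trans ?_
        gcongr <;> exact measure_biUnion_finset_le _ _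
    _ ≤ ENNReal.ofReal (δ / 2) + ENNReal.ofReal (δ / 2) := by
        refine add_le_add h2 ?_
        refine (add_le_add (Finset.sum_le_card_nsmul _ _ _ hBk)
          (Finset.sum_le_card_nsmul _ _ _ hDk)).trans (le_trans ?_ (ENNReal.ofReal_le_ofReal h1))
        rw [ENNReal.ofReal_mul zero_le_two, ENNReal.ofReal_mul (Nat.cast_nonneg _),
          ENNReal.ofReal_natCast, Finset.card_range, nsmul_eq_mul, ← two_mul]
        simp
    _ = ENNReal.ofReal δ := by
        rw [← ENNReal.ofReal_add (by positivity) (by positivity), add_halves]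

/-! ### Coarse-grained paths and dual walks -/

/-- A path of good (not bad) sites `(k, e k)`, `0 ≤ k ≤ n`, starting at or below height `0` and
ending at or above height `-1`. -/
def HasGoodPath (bad : ℤ × ℤ → Prop) (n : ℕ) : Prop :=
  ∃ e : ℕ → ℤ, e 0 ≤ 0 ∧ -1 ≤ e n ∧ (∀ k < n, e (k + 1) = e k + 1 ∨ e (k + 1) = e k - 1) ∧
    ∀ k : ℕ, k ≤ n → ¬bad (k, e k)

/-- The steps of the dual walks blocking good paths: free upward steps, and downward steps onto bad
sites. -/
def DualStep (bad : ℤ × ℤ → Prop) (n : ℕ) (a b : ℤ × ℤ) : Prop :=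
  (0 ≤ b.1 ∧ b.1 ≤ n) ∧
    (b = (a.1 + 1, a.2 + 1) ∨ b = (a.1 - 1, a.2 + 1) ∨ (b = (a.1, a.2 - 2) ∧ bad b))

lemma hasGoodPath_of_forall_not {bad : ℤ × ℤ → Prop} {n : ℕ} (hn : 1 ≤ n)
    (h : ∀ x ≤ 0, ¬Relation.ReflTransGen (DualStep bad n) (0, 2) (n, x)) : HasGoodPath bad n := by
  set U : ℕ → ℤ → Prop := fun k x => Relation.ReflTransGen (DualStep bad n) (0, 2) (k, x) with hU
  have hright : ∀ k x, k < n → U k x → U (k + 1) (x + 1) := fun k x hk hx =>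
    hx.tail ⟨⟨by simp; omega, by simpa using hk⟩, Or.inl (by simp)⟩
  have hleft : ∀ k x, k < n → U (k + 1) x → U k (x + 1) := fun k x hk hx =>
    hx.tail ⟨⟨by simp, by simpa using hk.le⟩, Or.inr (Or.inl (by simp))⟩
  have hne : ∀ k ≤ n, U k (2 + k) := by
    intro k
    induction k with
    | zero => intro _; simpa [hU] using Relation.ReflTransGen.refl
    | succ k ih =>
      intro hk
      have := hright k _ (by omega) (ih (by omega))
      rwa [add_assoc, ← Nat.cast_succ] at this
  have hbd : ∀ d k : ℕ, k + d = n → ∀ x, U k x → 1 - (n : ℤ) ≤ x - k := by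
    intro d
    induction d with
    | zero =>
      rintro k rfl x hx
      by_contra hlt
      refine h x (by omega) hx
    | succ d ih =>
      intro k hk x hx
      have := ih (k + 1) (by omega) _ (hright k x (by omega) hx)
      push_cast at this; omega
  have hpar : ∀ z, Relation.ReflTransGen (DualStep bad n) (0, 2) z → Even (z.1 + z.2) := by
    intro z hz
    induction hz with
    | refl => decide
    | tail _ hs ih =>
      rcases hs.2 with rfl | rfl | ⟨rfl, -⟩ <;> simp only <;> grind
  have hmin : ∀ k : ℕ, k ≤ n → ∃ d : ℤ, U k d ∧ ∀ x, U k x → d ≤ x := by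
    intro k hk
    exact Int.exists_least_of_bdd ⟨1 - (n : ℤ) + k, fun x hx => by
      have := hbd (n - k) k (by omega) x hx; omega⟩ ⟨_, hne k hk⟩
  choose! d hd1 hd2 using hmin
  refine ⟨fun k => d k - 2, ?_, ?_, fun k hk => ?_, fun k hk hb => ?_⟩
  · have := hd2 0 (by omega) 2 (by simpa using hne 0 (by omega)); simp only; omega
  · have := hbd 0 n rfl _ (hd1 n le_rfl); simp only; omega
  · have h1 := hd2 (k + 1) (by omega) _ (hright k _ hk (hd1 k hk.le))
    have h2 := hd2 k hk.le _ (hleft k _ hk (hd1 (k + 1) (by omega)))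
    have h3 := hpar _ (hd1 k hk.le)
    have h4 := hpar _ (hd1 (k + 1) (by omega))
    simp only at h3 h4 ⊢
    rw [Int.even_iff] at h3 h4
    push_cast at h4
    omega
  · have h1 : U k (d k - 2) :=
      (hd1 k hk).tail ⟨⟨by simp, by simpa using hk⟩, Or.inr (Or.inr ⟨rfl, hb⟩)⟩
    have := hd2 k hk _ h1
    omega

/-- A path of a relation can be taken without repetitions. -/
lemma exists_nodup_isChain {β : Type*} {r : β → β → Prop} {a b : β}
    (h : Relation.ReflTransGen r a b) :
    ∃ l : List β, (a :: l).IsChain r ∧ (a :: l).Nodup ∧ (a :: l).getLast (by simp) = b := by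
  induction h using Relation.ReflTransGen.head_induction_on with
  | refl => exact ⟨[], by simp⟩
  | @head a c h h' ih =>
    obtain ⟨l, h1, h2, h3⟩ := ih
    by_cases ha : a ∈ c :: l
    · obtain ⟨s, t, hst⟩ := List.append_of_mem ha
      refine ⟨t, ?_, ?_, ?_⟩
      · rw [hst] at h1
        exact h1.suffix (List.suffix_append s _)
      · rw [hst] at h2
        exact h2.sublist (List.sublist_append_right s _)
      · rw [← h3]
        simp only [hst]
        rw [List.getLast_append_of_ne_nil]
    · exact ⟨c :: l, List.isChain_cons_cons.2 ⟨h, h1⟩, List.nodup_cons.2 ⟨ha, h2⟩, by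
        rw [List.getLast_cons (by simp)]; exact h3⟩

/-- The sites entered by downward steps in the walk `a :: l`. -/
def dropsFrom : ℤ × ℤ → List (ℤ × ℤ) → List (ℤ × ℤ)
  | _, [] => []
  | a, b :: l => if b.1 = a.1 then b :: dropsFrom b l else dropsFrom b l

lemma dropsFrom_sublist (a : ℤ × ℤ) (l : List (ℤ × ℤ)) : (dropsFrom a l).Sublist l := by
  induction l generalizing a with
  | nil => simp [dropsFrom]
  | cons b l ih =>
    rw [dropsFrom]
    split_ifs
    · exact (ih b).cons_cons b
    · exact (ih b).cons b

lemma mem_dropsFrom {bad : ℤ × ℤ → Prop} {n : ℕ} {a : ℤ × ℤ} {l : List (ℤ × ℤ)}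
    (h : (a :: l).IsChain (DualStep bad n)) : ∀ z ∈ dropsFrom a l, 0 ≤ z.1 ∧ bad z := by
  induction l generalizing a with
  | nil => simp [dropsFrom]
  | cons b l ih =>
    rw [List.isChain_cons_cons] at h
    intro z hz
    rw [dropsFrom] at hz
    split_ifs at hz with hb
    · rcases List.mem_cons.1 hz with rfl | hz
      · refine ⟨h.1.1.1, ?_⟩
        rcases h.1.2 with he | he | he
        · simp [he] at hb
        · simp [he] at hb
        · exact he.2
      · exact ih h.2 z hz
    · exact ih h.2 z hz

lemma getLast_walk {bad : ℤ × ℤ → Prop} {n : ℕ} {a : ℤ × ℤ} {l : List (ℤ × ℤ)}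
    (h : (a :: l).IsChain (DualStep bad n)) :
    ((a :: l).getLast (by simp)).2 = a.2 + l.length - 3 * (dropsFrom a l).length ∧
      ((a :: l).getLast (by simp)).1 ≤ a.1 + l.length := by
  induction l generalizing a with
  | nil => simp [dropsFrom]
  | cons b l ih =>
    rw [List.isChain_cons_cons] at h
    obtain ⟨h1, h2⟩ := ih h.2
    rw [List.getLast_cons (by simp), h1, dropsFrom, List.length_cons]
    refine ⟨?_, h2.trans ?_⟩
    · rcases h.1.2 with he | he | he
      · rw [if_neg (by simp [he]), he]; push_cast; ring
      · rw [if_neg (by simp [he]), he]; push_cast; ring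
      · rw [if_pos (by simp [he.1]), he.1, List.length_cons]; push_cast; ring
    · rcases h.1.2 with he | he | he
      · rw [he]; push_cast; omega
      · rw [he]; push_cast; omega
      · rw [he.1]; push_cast; omega

/-- The possible walks of `t` steps started from a given site. -/
def walksFrom : ℕ → ℤ × ℤ → Finset (List (ℤ × ℤ))
  | 0, _ => {[]}
  | t + 1, a => ({(a.1 + 1, a.2 + 1), (a.1 - 1, a.2 + 1), (a.1, a.2 - 2)} : Finset (ℤ × ℤ)).biUnion
      fun b => (walksFrom t b).image (List.cons b)

lemma card_walksFrom_le (t : ℕ) (a : ℤ × ℤ) : (walksFrom t a).card ≤ 3 ^ t := by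
  induction t generalizing a with
  | zero => simp [walksFrom]
  | succ t ih =>
    rw [walksFrom]
    refine (Finset.card_biUnion_le_card_mul _ _ (3 ^ t)
      fun b _ => Finset.card_image_le.trans (ih b)).trans ?_
    rw [pow_succ']
    gcongr
    exact Finset.card_le_three

lemma mem_walksFrom {bad : ℤ × ℤ → Prop} {n : ℕ} {a : ℤ × ℤ} {l : List (ℤ × ℤ)}
    (h : (a :: l).IsChain (DualStep bad n)) : l ∈ walksFrom l.length a := by
  induction l generalizing a with
  | nil => simp [walksFrom]
  | cons b l ih =>
    rw [List.isChain_cons_cons] at h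
    rw [List.length_cons, walksFrom, Finset.mem_biUnion]
    refine ⟨b, ?_, Finset.mem_image_of_mem _ (ih h.2)⟩
    simp only [Finset.mem_insert, Finset.mem_singleton]
    rcases h.1.2 with he | he | he
    exacts [Or.inl he, Or.inr (Or.inl he), Or.inr (Or.inr he.1)]

lemma exists_card_le_mul_card_fiber {β : Type*} [DecidableEq β] {R : ℕ} (cls : β → Fin R)
    (hR : 0 < R) (S : Finset β) : ∃ c, S.card ≤ R * (S.filter fun z => cls z = c).card := by
  have : Nonempty (Fin R) := ⟨⟨0, hR⟩⟩
  by_contra! hcon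
  have h1 := Finset.card_eq_sum_card_fiberwise (f := cls) (s := S) (t := Finset.univ) (by simp)
  have h2 : ∑ c : Fin R, R * (S.filter fun z => cls z = c).card < ∑ _c : Fin R, S.card :=
    Finset.sum_lt_sum_of_nonempty Finset.univ_nonempty fun c _ => hcon c
  rw [← Finset.mul_sum, ← h1] at h2
  simp at h2

/-- If bad sites are rare, and approximately independent in the sense that they are independent
within each of finitely many classes, then good paths are likely. -/
theorem measure_not_hasGoodPath_le {Ω : Type*} [MeasurableSpace Ω] (μ : Measure Ω) {R : ℕ}
    (hR : 0 < R) (cls : ℤ × ℤ → Fin R) (bad : Ω → ℤ × ℤ → Prop)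
    (h : ∀ (S : Finset (ℤ × ℤ)) (c : Fin R), (∀ z ∈ S, 0 ≤ z.1 ∧ cls z = c) →
      μ {ω | ∀ z ∈ S, bad ω z} ≤ ((6⁻¹ : ℝ≥0∞) ^ (3 * R)) ^ S.card) {n : ℕ} (hn : 1 ≤ n) :
    μ {ω | ¬HasGoodPath (bad ω) n} ≤ 2 * 2⁻¹ ^ n := by
  set E : List (ℤ × ℤ) → Set Ω := fun l => {ω | (dropsFrom (0, 2) l).Nodup ∧
    l.length ≤ 3 * (dropsFrom (0, 2) l).length ∧ ∀ z ∈ dropsFrom (0, 2) l, 0 ≤ z.1 ∧ bad ω z}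
  have hE : ∀ l, μ (E l) ≤ 6⁻¹ ^ l.length := by
    intro l
    rcases (E l).eq_empty_or_nonempty with he | ⟨ω₀, h1, h2, h3⟩
    · simp [he]
    obtain ⟨c, hc⟩ := exists_card_le_mul_card_fiber cls hR (dropsFrom (0, 2) l).toFinset
    rw [List.toFinset_card_of_nodup h1] at hc
    set S := (dropsFrom (0, 2) l).toFinset.filter fun z => cls z = c
    calc μ (E l) ≤ μ {ω | ∀ z ∈ S, bad ω z} := by
          refine measure_mono fun ω hω z hz => (hω.2.2 z ?_).2
          exact List.mem_toFinset.1 (Finset.mem_filter.1 hz).1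
      _ ≤ ((6⁻¹ : ℝ≥0∞) ^ (3 * R)) ^ S.card := h S c fun z hz =>
          ⟨(h3 z (List.mem_toFinset.1 (Finset.mem_filter.1 hz).1)).1, (Finset.mem_filter.1 hz).2⟩
      _ ≤ 6⁻¹ ^ l.length := by
          rw [← pow_mul]
          refine pow_le_pow_right_of_le_one' (ENNReal.inv_le_one.2 (by norm_num)) ?_
          calc l.length ≤ 3 * (dropsFrom (0, 2) l).length := h2
            _ ≤ 3 * (R * S.card) := by gcongr
            _ = 3 * R * S.card := by ring
  have hsub : {ω | ¬HasGoodPath (bad ω) n} ⊆ ⋃ t : ℕ, ⋃ l ∈ (walksFrom (t + n) (0, 2)).filter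
      (fun l => l.length = t + n), E l := by
    intro ω hω
    have : ∃ x ≤ 0, Relation.ReflTransGen (DualStep (bad ω) n) (0, 2) (n, x) := by
      by_contra! hcon
      exact hω (hasGoodPath_of_forall_not hn hcon)
    obtain ⟨x, hx, hp⟩ := this
    obtain ⟨l, h1, h2, h3⟩ := exists_nodup_isChain hp
    obtain ⟨h4, h5⟩ := getLast_walk h1
    rw [h3] at h4 h5
    simp only [zero_add] at h4 h5
    have h6 : l.length - n + n = l.length := by omega
    refine Set.mem_iUnion.2 ⟨l.length - n, Set.mem_iUnion₂.2 ⟨l, ?_, ?_⟩⟩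
    · rw [h6]; simpa using mem_walksFrom h1
    · exact ⟨((List.nodup_cons.1 h2).2).sublist (dropsFrom_sublist _ _), by omega, mem_dropsFrom h1⟩
  refine (measure_mono hsub).trans ((measure_iUnion_le _).trans ?_)
  calc ∑' t : ℕ, μ (⋃ l ∈ (walksFrom (t + n) (0, 2)).filter (fun l => l.length = t + n), E l)
      ≤ ∑' t : ℕ, 2⁻¹ ^ n * 2⁻¹ ^ t := by
        refine ENNReal.tsum_le_tsum fun t => ?_
        refine (measure_biUnion_finset_le _ _).trans ?_
        refine (Finset.sum_le_card_nsmul _ _ (6⁻¹ ^ (t + n)) fun l hl => ?_).trans ?_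
        · rw [← (Finset.mem_filter.1 hl).2]; exact hE l
        · rw [nsmul_eq_mul]
          calc _ ≤ ((3 ^ (t + n) : ℕ) : ℝ≥0∞) * 6⁻¹ ^ (t + n) := by
                gcongr
                exact (Finset.card_filter_le _ _).trans (card_walksFrom_le _ _)
            _ = 2⁻¹ ^ n * 2⁻¹ ^ t := by
                push_cast
                rw [← mul_pow, ← pow_add, add_comm n t]
                congr 1
                rw [← ENNReal.toReal_eq_toReal_iff' (by finiteness) (by finiteness)]
                simp; norm_num
    _ = 2 * 2⁻¹ ^ n := by
        rw [ENNReal.tsum_mul_left, ENNReal.tsum_geometric, ENNReal.one_sub_inv_two, inv_inv,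
          mul_comm]

/-! ### Renormalisation -/

lemma IsPath.of_shift {ω : Config} {v : ℤ × ℤ} (hv : v ∈ lattice) {g : ℤ → ℤ} {s t : ℤ}
    (h : IsPath (shift v ω) g s t) :
    IsPath ω (fun l => g (l - v.1) + v.2) (s + v.1) (t + v.1) := by
  obtain ⟨hv1, hv2⟩ := hv
  obtain ⟨h0, h1, h2⟩ := h
  refine ⟨by omega, by simp only [add_sub_cancel_right]; grind, fun l hl1 hl2 => ?_⟩
  obtain ⟨h3, h4, h5⟩ := h2 (l - v.1) (by omega) (by omega)
  have e : l + 1 - v.1 = l - v.1 + 1 := by ring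
  have hpar : Even (l + (g (l - v.1) + v.2)) ↔ Even (l - v.1 + g (l - v.1)) := by grind
  simp only [e]
  refine ⟨by simpa using h3, fun h => ?_, fun h => by rw [h5 (fun h' => h (hpar.2 h'))]⟩
  have := h4 (hpar.1 h)
  rw [shift_apply] at this
  convert this using 2
  ext <;> simp

lemma IsPath.of_refl {ω : Config} {g : ℤ → ℤ} {s t : ℤ} (h : IsPath (refl ω) g s t) :
    IsPath ω (fun l => -g l) s t := by
  obtain ⟨h0, h1, h2⟩ := h
  have hpar : ∀ l, Even (l + -g l) ↔ Even (l + g l) := fun l => by grind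
  refine ⟨h0, (hpar s).2 h1, fun l hl1 hl2 => ?_⟩
  obtain ⟨h3, h4, h5⟩ := h2 l hl1 hl2
  refine ⟨?_, fun h => ?_, fun h => ?_⟩
  · simp only; rw [abs_le] at h3 ⊢; omega
  · simpa using h4 ((hpar l).1 h)
  · simp only [h5 (fun h' => h ((hpar l).2 h'))]

lemma corridor_mono {α w w' : ℝ} (h : w ≤ w') (N : ℕ) : corridor α w N ⊆ corridor α w' N :=
  fun _ hz => ⟨hz.1, hz.2.1, hz.2.2.trans h⟩

lemma corridorEvent_mono {α w w' : ℝ} (h : w ≤ w') (N : ℕ) :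
    corridorEvent α w N ⊆ corridorEvent α w' N := by
  rintro ω ⟨s, y, x, h1, h2, h3, h4, h5⟩
  exact ⟨s, y, x, h1, h2, h3, h4, h5.mono (corridor_mono h N)⟩

/-- The parameters of the renormalisation: block length `T`, overlap `M`, width scale `m`, the even
integer `A` approximating `α T`, and the period `J` of the independence classes. -/
structure Scale (α : ℝ) where
  (T M m J : ℕ)
  A : ℤ
  pos : 0 < α
  le_one : α ≤ 1
  two_le_m : 2 ≤ m
  two_le_M : 2 ≤ M
  M_le : M ≤ T
  m_le : 10 * m ≤ T
  lt_J : 3 * T < J * m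
  even_T : Even T
  even_A : Even A
  A_le : (A : ℝ) ≤ α * T
  lt_A : α * T - 2 < A
  m_le_M : 11 * (m : ℝ) ≤ α * M

namespace Scale

variable {α : ℝ} (S : Scale α)

/-- The lattice site at the left end of the block `z`. -/
def base (z : ℤ × ℤ) : ℤ × ℤ := (z.1 * S.T, z.1 * (S.A - 8 * S.m) + z.2 * (2 * S.m))

lemma base_mem (z : ℤ × ℤ) (hz : 0 ≤ z.1) : S.base z ∈ lattice := by
  have h1 : Even (S.T : ℤ) := by exact_mod_cast S.even_T
  have h2 := S.even_A
  refine ⟨?_, by simp only [base]; positivity⟩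
  exact (h1.mul_left _).add (((h2.sub ⟨4 * S.m, by ring⟩).mul_left _).add
    ((even_two_mul (S.m : ℤ)).mul_left _))

/-- The start of the descending corridor of the block `z`. -/
def top (z : ℤ × ℤ) : ℤ × ℤ := S.base z + ((S.T : ℤ), S.A + 8 * (S.m : ℤ))

lemma top_mem (z : ℤ × ℤ) (hz : 0 ≤ z.1) : S.top z ∈ lattice := by
  have h1 : Even (S.T : ℤ) := by exact_mod_cast S.even_T
  have h2 := S.even_A
  obtain ⟨h3, h4⟩ := S.base_mem z hz
  refine ⟨?_, by simp only [top, Prod.fst_add]; positivity⟩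
  simp only [top, Prod.fst_add, Prod.snd_add]
  grind

/-- A block is good if its ascending and its descending corridor are both crossed. -/
def Good (ω : Config) (z : ℤ × ℤ) : Prop :=
  shift (S.base z) ω ∈ corridorEvent α (2 * S.m - 4) (S.T + S.M) ∧
    refl (shift (S.top z) ω) ∈ corridorEvent α (2 * S.m - 4) S.M

/-- `g` is an ascending path of the block `z`. -/
def UpPath (ω : Config) (z : ℤ × ℤ) (s : ℤ) (g : ℤ → ℤ) : Prop :=
  (S.base z).1 ≤ s ∧ s ≤ (S.base z).1 + 1 ∧ g s ≤ (S.base z).2 ∧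
    IsPath ω g s ((S.base z).1 + (S.T + S.M)) ∧
    ∀ l, s ≤ l → l ≤ (S.base z).1 + (S.T + S.M) →
      |(g l : ℝ) - (S.base z).2 - α * (l - (S.base z).1)| ≤ 2 * S.m

/-- `f` is a descending path of the block `z`. -/
def DownPath (ω : Config) (z : ℤ × ℤ) (s : ℤ) (f : ℤ → ℤ) : Prop :=
  (S.top z).1 ≤ s ∧ s ≤ (S.top z).1 + 1 ∧ IsPath ω f s ((S.top z).1 + S.M) ∧
    ∀ l, s ≤ l → l ≤ (S.top z).1 + S.M →
      |(f l : ℝ) - (S.top z).2 + α * (l - (S.top z).1)| ≤ 2 * S.m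

lemma Good.exists_upPath {S : Scale α} {ω : Config} {z : ℤ × ℤ} (h : S.Good ω z) (hz : 0 ≤ z.1) :
    ∃ s g, S.UpPath ω z s g := by
  have hM := S.two_le_M
  obtain ⟨s, g, h0, h1, h2, h3, h4⟩ :=
    exists_isPath_of_mem_corridorEvent S.pos.le S.le_one (by omega) h.1
  have h5 := h3.of_shift (S.base_mem z hz)
  refine ⟨s + (S.base z).1, fun l => g (l - (S.base z).1) + (S.base z).2, by omega, by omega,
    by simpa using h2, ?_, fun l hl1 hl2 => ?_⟩
  · convert h5 using 1; push_cast; ring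
  · have := h4 (l - (S.base z).1) (by omega) (by push_cast; omega)
    simp only
    push_cast at this ⊢
    convert this using 2 <;> ring

lemma Good.exists_downPath {S : Scale α} {ω : Config} {z : ℤ × ℤ} (h : S.Good ω z) (hz : 0 ≤ z.1) :
    ∃ s f, S.DownPath ω z s f := by
  have hM := S.two_le_M
  obtain ⟨s, g, h0, h1, h2, h3, h4⟩ :=
    exists_isPath_of_mem_corridorEvent S.pos.le S.le_one (by omega) h.2
  have h5 := h3.of_refl.of_shift (S.top_mem z hz)
  refine ⟨s + (S.top z).1, fun l => -g (l - (S.top z).1) + (S.top z).2, by omega, by omega, ?_,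
    fun l hl1 hl2 => ?_⟩
  · convert h5 using 1; ring
  · have := h4 (l - (S.top z).1) (by omega) (by omega)
    simp only
    rw [← abs_neg]
    push_cast at this ⊢
    convert this using 2 <;> ring

/-- The descending path of a good block leads from its ascending path to the one of the next
block. -/
lemma exists_crossing {ω : Config} {z z' : ℤ × ℤ} {s s₁ s' : ℤ} {g f g' : ℤ → ℤ}
    (hg : S.UpPath ω z s g) (hf : S.DownPath ω z s₁ f) (hg' : S.UpPath ω z' s' g')
    (h1 : z'.1 = z.1 + 1) (h2 : z'.2 = z.2 + 1 ∨ z'.2 = z.2 - 1) :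
    ∃ l l', (S.base z').1 + 1 ≤ l ∧ l ≤ l' ∧ l' ≤ (S.base z').1 + S.M ∧
      f l = g l ∧ Even (l + g l) ∧ f l' = g' l' ∧ Even (l' + g' l') ∧ IsPath ω f s₁ ((S.top z).1 + S.M) := by
  obtain ⟨hg1, hg2, -, hg3, hg4⟩ := hg
  obtain ⟨hf1, hf2, hf3, hf4⟩ := hf
  obtain ⟨hg1', hg2', -, hg3', hg4'⟩ := hg'
  have hM := S.two_le_M
  have hMT := S.M_le
  have hm : (2 : ℝ) ≤ S.m := by exact_mod_cast S.two_le_m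
  have hα0 := S.pos
  have hα1 := S.le_one
  have hA1 := S.A_le
  have hA2 := S.lt_A
  have hmM := S.m_le_M
  set b := S.base z with hb
  have htop1 : (S.top z).1 = b.1 + S.T := by simp [top, hb]
  have htop2 : ((S.top z).2 : ℝ) = b.2 + S.A + 8 * S.m := by simp [top, hb]; ring
  have hb1 : (S.base z').1 = b.1 + S.T := by simp only [base, hb, h1]; ring
  have hb2 : (S.base z').2 = b.2 + S.A - 8 * S.m + 2 * S.m * (z'.2 - z.2) := by
    simp only [base, hb, h1]; ring
  have hb2u : ((S.base z').2 : ℝ) ≤ b.2 + S.A - 6 * S.m := by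
    have : (S.base z').2 ≤ b.2 + S.A - 6 * S.m := by
      rw [hb2]; rcases h2 with h | h <;> rw [h] <;> ring_nf <;> omega
    exact_mod_cast this
  have hb2l : ((b.2 : ℝ) + S.A - 10 * S.m) ≤ (S.base z').2 := by
    have : b.2 + S.A - 10 * S.m ≤ (S.base z').2 := by
      rw [hb2]; rcases h2 with h | h <;> rw [h] <;> ring_nf <;> omega
    exact_mod_cast this
  have hTr : (((S.base z').1 : ℤ) : ℝ) = b.1 + S.T := by rw [hb1]; push_cast; ring
  have hTr' : (((S.top z).1 : ℤ) : ℝ) = b.1 + S.T := by rw [htop1]; push_cast; ring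
  have hsep : ∀ l, (S.base z').1 + 1 ≤ l → l ≤ (S.base z').1 + S.M → g' l < g l := by
    intro l hl1 hl2
    have e1 := (abs_le.1 (hg4 l (by omega) (by omega))).1
    have e2 := (abs_le.1 (hg4' l (by omega) (by omega))).2
    rw [hTr] at e2
    have : (g' l : ℝ) < g l := by nlinarith
    exact_mod_cast this
  have ha : g ((S.base z').1 + 1) < f ((S.base z').1 + 1) := by
    have e1 := (abs_le.1 (hg4 ((S.base z').1 + 1) (by omega) (by omega))).2
    have e2 := (abs_le.1 (hf4 ((S.base z').1 + 1) (by omega) (by omega))).1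
    rw [hTr', htop2] at e2
    push_cast [hTr] at e1 e2
    have : (g ((S.base z').1 + 1) : ℝ) < f ((S.base z').1 + 1) := by nlinarith
    exact_mod_cast this
  have hend : f ((S.base z').1 + S.M) ≤ g' ((S.base z').1 + S.M) := by
    have e1 := (abs_le.1 (hg4' ((S.base z').1 + S.M) (by omega) (by omega))).1
    have e2 := (abs_le.1 (hf4 ((S.base z').1 + S.M) (by omega) (by omega))).2
    rw [hTr', htop2] at e2
    push_cast [hTr] at e1 e2
    have : (f ((S.base z').1 + S.M) : ℝ) ≤ g' ((S.base z').1 + S.M) := by nlinarith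
    exact_mod_cast this
  obtain ⟨l, hl1, hl2, hl3, hl4⟩ := hf3.exists_common hg3 (a := (S.base z').1 + 1)
    (b := (S.base z').1 + S.M) (by omega) (by omega) (by omega) (by omega) (by omega) (Or.inl ha)
    (hend.trans (hsep _ (by omega) le_rfl).le)
  obtain ⟨l', hl1', hl2', hl3', hl4'⟩ := hf3.exists_common hg3' (a := l)
    (b := (S.base z').1 + S.M) (by omega) (by omega) (by omega) (by omega) (by omega)
    (Or.inl (hl3 ▸ hsep l hl1 hl2)) hend
  exact ⟨l, l', hl1, hl1', hl2', hl3, hl4, hl3', hl4', hf3⟩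

/-- Along a good coarse path, some site of each ascending path is reached from below. -/
lemma exists_reached {ω : Config} {e : ℕ → ℤ} {n : ℕ} (h0 : e 0 ≤ 0)
    (h1 : ∀ k < n, e (k + 1) = e k + 1 ∨ e (k + 1) = e k - 1)
    (h2 : ∀ k : ℕ, k ≤ n → S.Good ω (k, e k)) (k : ℕ) (hk : k ≤ n) :
    ∃ s g, S.UpPath ω (k, e k) s g ∧ ∃ l, s ≤ l ∧ l ≤ k * S.T + S.M ∧ Even (l + g l) ∧
      ∃ s₀ y : ℤ, 0 ≤ s₀ ∧ s₀ ≤ 1 ∧ y ≤ 0 ∧ Connects ω (s₀, y) (l, g l) := by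
  have hM := S.two_le_M
  have hMT := S.M_le
  induction k with
  | zero =>
    obtain ⟨s, g, hg⟩ := (h2 0 hk).exists_upPath (by simp)
    have hb1 : (S.base ((0 : ℕ), e 0)).1 = 0 := by simp [base]
    have hb2 : (S.base ((0 : ℕ), e 0)).2 ≤ 0 := by
      simp only [base, Nat.cast_zero, zero_mul, zero_add]
      exact mul_nonpos_of_nonpos_of_nonneg h0 (by positivity)
    obtain ⟨a1, a2, a3, a4, a5⟩ := id hg
    rw [hb1] at a1 a2
    refine ⟨s, g, hg, s, le_rfl, by push_cast; omega, a4.2.1, s, g s, a1, by omega, by omega, ?_⟩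
    exact ⟨⟨a4.2.1, a1⟩, .refl⟩
  | succ k ih =>
    obtain ⟨s, g, hg, l₀, hl1, hl2, hl3, s₀, y, hs0, hs1, hy, hc⟩ := ih (by omega)
    obtain ⟨s₁, f, hf⟩ := (h2 k (by omega)).exists_downPath (by simp)
    obtain ⟨s', g', hg'⟩ := (h2 (k + 1) hk).exists_upPath (by simp; omega)
    obtain ⟨l, l', c1, c2, c3, c4, c5, c6, c7, c8⟩ := S.exists_crossing hg hf hg' (by simp)
      (by simpa using h1 k (by omega))
    have hb1 : (S.base ((k : ℕ), e k)).1 = k * S.T := by simp [base]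
    have hb1' : (S.base ((k + 1 : ℕ), e (k + 1))).1 = k * S.T + S.T := by simp [base]; ring
    have ht1 : (S.top ((k : ℕ), e k)).1 = k * S.T + S.T := by simp [top, base]
    have hf1 := hf.1
    have hf2 := hf.2.1
    have hg2' := hg'.2.1
    rw [hb1'] at c1 c3 hg2'
    rw [ht1] at hf1 hf2
    refine ⟨s', g', hg', l', by omega, by push_cast; linarith, c7, s₀, y, hs0, hs1, hy, hc.1, ?_⟩
    refine (hc.2.trans (hg.2.2.2.1.path hl1 (b := l) ?_ ?_ hl3 c5)).trans ?_
    · omega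
    · rw [hb1]; omega
    · rw [← c4, ← c6]
      exact c8.path (by omega) c2 (by rw [ht1]; omega) (c4 ▸ c5) (c6 ▸ c7)

lemma le_upperEdge_of_hasGoodPath {ω : Config} {k n : ℕ}
    (h : HasGoodPath (fun z => ¬S.Good ω z) k) (h1 : k * S.T + S.M ≤ n)
    (h2 : n ≤ k * S.T + S.T + S.M) :
    ((k * (S.A - 8 * S.m) : ℝ) : EReal) ≤ upperEdge ω n := by
  obtain ⟨e, he0, hen, hstep, hgood⟩ := h
  have hM := S.two_le_M
  obtain ⟨s, g, hg, l, hl1, hl2, hl3, s₀, y, hs0, hs1, hy, hc⟩ :=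
    S.exists_reached he0 hstep (fun k hk => not_not.1 (hgood k hk)) k le_rfl
  have hb1 : (S.base ((k : ℕ), e k)).1 = k * S.T := by simp [base]
  obtain ⟨g1, g2, -, g3, g4⟩ := hg
  rw [hb1] at g1 g2 g3 g4
  have h1' : (k : ℤ) * S.T + S.M ≤ n := by exact_mod_cast h1
  have h2' : (n : ℤ) ≤ k * S.T + (S.T + S.M) := by rw [← add_assoc]; exact_mod_cast h2
  have key : ∃ x ≥ g n, x ∈ reachedFromBelow ω n := by
    have hmem : ∀ x, Relation.ReflTransGen (Step ω) (l, g l) (n, x) → x ∈ reachedFromBelow ω n := by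
      intro x hx
      refine ⟨y, hy, ?_⟩
      obtain rfl | rfl : s₀ = 0 ∨ s₀ = 1 := by omega
      · exact Or.inl ⟨hc.1, hc.2.trans hx⟩
      · exact Or.inr ⟨hc.1, hc.2.trans hx⟩
    by_cases hev : Even ((n : ℤ) + g n)
    · exact ⟨g n, le_rfl, hmem _ (g3.path hl1 (by omega) h2' hl3 hev)⟩
    · have hln : l ≠ n := by rintro rfl; exact hev hl3
      obtain ⟨d1, d2, d3⟩ := g3.2.2 (n - 1) (by omega) (by omega)
      rw [sub_add_cancel] at d1 d3
      have hev' : Even ((n : ℤ) - 1 + g (n - 1)) := by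
        by_contra hc'
        rw [d3 hc'] at hev
        grind
      have heq : g n = g (n - 1) := by
        rw [abs_le] at d1
        rw [Int.even_iff] at hev hev'
        omega
      refine ⟨g n + 1, by omega, hmem _ ?_⟩
      refine (g3.path hl1 (b := n - 1) (by omega) (by omega) hl3 hev').tail ?_
      have hlat : ((n : ℤ) - 1, g (n - 1)) ∈ lattice := ⟨hev', by have := g3.1; simp; omega⟩
      exact ⟨hlat, d2 hev', Or.inl (by simp [heq])⟩
  obtain ⟨x, hx1, hx2⟩ := key
  refine le_trans ?_ (le_upperEdge hx2)
  rw [EReal.coe_le_coe_iff]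
  have hx1' : (g n : ℝ) ≤ x := by exact_mod_cast hx1
  have e1 := (abs_le.1 (g4 n (by omega) h2')).1
  have e2 : ((k : ℝ) * (S.A - 8 * S.m) - 2 * S.m) ≤ (S.base ((k : ℕ), e k)).2 := by
    simp only [base]
    push_cast
    have : (-1 : ℝ) ≤ e k := by exact_mod_cast hen
    have hm : (0 : ℝ) ≤ S.m := by positivity
    nlinarith
  have e3 : (k : ℝ) * S.T + S.M ≤ n := by exact_mod_cast h1
  have hα0 := S.pos
  have hmM := S.m_le_M
  have hm : (0 : ℝ) ≤ S.m := by positivity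
  push_cast at e1
  nlinarith

end Scale

namespace Scale

variable {α : ℝ} (S : Scale α)

/-- The sites on which the goodness of the block `z` depends. -/
def box (z : ℤ × ℤ) : Set (ℤ × ℤ) :=
  {x | z.1 * S.T ≤ x.1 ∧ x.1 < (z.1 + 2) * S.T ∧ |x.2 - (S.base z).2| ≤ 3 * S.T}

lemma measurableSet_good (z : ℤ × ℤ) : MeasurableSet[sig Bool (S.box z)] {ω | S.Good ω z} := by
  have hα0 := S.pos
  have hα1 := S.le_one
  have hMT : (S.M : ℤ) ≤ S.T := by exact_mod_cast S.M_le
  have hMTr : (S.M : ℝ) ≤ S.T := by exact_mod_cast S.M_le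
  have hm : (10 * S.m : ℝ) ≤ S.T := by exact_mod_cast S.m_le
  have hA1 := S.A_le
  have hA2 := S.lt_A
  have hm0 : (0 : ℝ) ≤ S.m := by positivity
  have hm2 : (2 : ℝ) ≤ S.m := by exact_mod_cast S.two_le_m
  have hT0 : (0 : ℝ) ≤ S.T := by positivity
  refine @MeasurableSet.inter _ (sig Bool (S.box z)) _ _ ?_ ?_
  · refine measurable_reindex_sig (fun x => x + S.base z) ?_
      (measurableSet_corridorEvent α (2 * S.m - 4) (S.T + S.M))
    rintro ⟨l, y⟩ ⟨h1, h2, h3⟩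
    simp only at h1 h2 h3
    have h1r : (0 : ℝ) ≤ l := by exact_mod_cast h1
    have h2r : (l : ℝ) ≤ S.T + S.M := by exact_mod_cast h2.le
    push_cast at h2
    rw [abs_le] at h3
    refine ⟨by simp [base]; omega, by simp [base]; linarith, ?_⟩
    simp only [Prod.snd_add, add_sub_cancel_right]
    have : |(y : ℝ)| ≤ 3 * S.T := by
      rw [abs_le]; constructor <;> nlinarith
    exact_mod_cast this
  · refine measurable_reindex_sig (fun x => (x.1, -x.2) + S.top z) ?_
      (measurableSet_corridorEvent α (2 * S.m - 4) S.M)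
    rintro ⟨l, y⟩ ⟨h1, h2, h3⟩
    simp only at h1 h2 h3
    have h1r : (0 : ℝ) ≤ l := by exact_mod_cast h1
    have h2r : (l : ℝ) ≤ S.M := by exact_mod_cast h2.le
    rw [abs_le] at h3
    refine ⟨by simp [top, base]; omega, by simp [top, base]; linarith, ?_⟩
    simp only [top, Prod.snd_add]
    have : |(-y + S.A + 8 * S.m : ℝ)| ≤ 3 * S.T := by
      rw [abs_le]; constructor <;> nlinarith
    rw [show -y + ((S.base z).2 + (S.A + 8 * (S.m : ℤ))) - (S.base z).2 = -y + S.A + 8 * S.m by ring]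
    exact_mod_cast this

/-- The independence class of a block. -/
def cls (hJ : 0 < S.J) (z : ℤ × ℤ) : Fin (2 * S.J) :=
  finProdFinEquiv (⟨(z.1 % 2).toNat, by omega⟩,
    ⟨(z.2 % S.J).toNat, by
      have := Int.emod_lt_of_pos z.2 (show (0 : ℤ) < S.J by exact_mod_cast hJ)
      omega⟩)

lemma disjoint_box {hJ : 0 < S.J} {z z' : ℤ × ℤ} (h : S.cls hJ z = S.cls hJ z') (hne : z ≠ z') :
    Disjoint (S.box z) (S.box z') := by
  have hJ' : (0 : ℤ) < S.J := by exact_mod_cast hJ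
  rw [cls, cls, EmbeddingLike.apply_eq_iff_eq, Prod.ext_iff, Fin.ext_iff, Fin.ext_iff] at h
  simp only at h
  obtain ⟨h1, h2⟩ := h
  have h1' : z.1 % 2 = z'.1 % 2 := by omega
  have h2' : z.2 % S.J = z'.2 % S.J := by
    have := Int.emod_nonneg z.2 hJ'.ne'
    have := Int.emod_nonneg z'.2 hJ'.ne'
    omega
  have hT : (0 : ℤ) ≤ S.T := by positivity
  have hm : (2 : ℤ) ≤ S.m := by exact_mod_cast S.two_le_m
  have hJT : 3 * (S.T : ℤ) < S.J * S.m := by exact_mod_cast S.lt_J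
  rw [Set.disjoint_left]
  rintro x ⟨a1, a2, a3⟩ ⟨b1, b2, b3⟩
  rcases lt_trichotomy z.1 z'.1 with hlt | heq | hlt
  · have : z.1 + 2 ≤ z'.1 := by omega
    nlinarith
  · have hne2 : z.2 ≠ z'.2 := fun h => hne (Prod.ext heq h)
    have hd : (S.J : ℤ) ∣ z.2 - z'.2 := Int.ModEq.dvd (show z'.2 ≡ z.2 [ZMOD S.J] from h2'.symm)
    have hJd : (S.J : ℤ) ≤ |z.2 - z'.2| :=
      Int.le_of_dvd (abs_pos.2 (sub_ne_zero.2 hne2)) ((dvd_abs _ _).2 hd)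
    have hb : |(S.base z).2 - (S.base z').2| = |z.2 - z'.2| * (2 * S.m) := by
      rw [← abs_of_nonneg (show (0 : ℤ) ≤ 2 * S.m by positivity), ← abs_mul]
      congr 1
      simp only [base, heq]
      ring
    have : |(S.base z).2 - (S.base z').2| ≤ 6 * S.T := by
      rw [abs_le] at a3 b3 ⊢; omega
    rw [hb] at this
    nlinarith
  · have : z'.1 + 2 ≤ z.1 := by omega
    nlinarith

lemma law_not_good_le (p : I) {δ : ℝ≥0∞}
    (h1 : law p (corridorEvent α (2 * S.m - 4) (S.T + S.M))ᶜ ≤ δ)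
    (h2 : law p (corridorEvent α (2 * S.m - 4) S.M)ᶜ ≤ δ) (z : ℤ × ℤ) :
    law p {ω | ¬S.Good ω z} ≤ 2 * δ := by
  have hm : ∀ N, MeasurableSet (corridorEvent α (2 * S.m - 4) N) := fun N =>
    sig_le _ _ (measurableSet_corridorEvent α _ N)
  have hs : MeasurePreserving (shift (S.base z)) (law p) (law p) := measurePreserving_shift _ _
  have hs' : MeasurePreserving (shift (S.top z)) (law p) (law p) := measurePreserving_shift _ _
  have hr : MeasurePreserving refl (law p) (law p) := measurePreserving_refl _
  have hsub : {ω | ¬S.Good ω z} ⊆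
      (shift (S.base z) ⁻¹' (corridorEvent α (2 * S.m - 4) (S.T + S.M))ᶜ) ∪
        ((refl ∘ shift (S.top z)) ⁻¹' (corridorEvent α (2 * S.m - 4) S.M)ᶜ) := by
    intro ω hω
    simp only [Good, Set.mem_ofPred_eq, not_and_or] at hω
    exact hω
  refine (measure_mono hsub).trans ((measure_union_le _ _).trans ?_)
  rw [hs.measure_preimage (hm _).compl.nullMeasurableSet,
    (hr.comp hs').measure_preimage (hm _).compl.nullMeasurableSet]
  exact (add_le_add h1 h2).trans (two_mul δ).ge

lemma law_not_hasGoodPath_le (p : I)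
    (h : ∀ z, law p {ω | ¬S.Good ω z} ≤ 6⁻¹ ^ (3 * (2 * S.J))) {k : ℕ} (hk : 1 ≤ k) :
    law p {ω | ¬HasGoodPath (fun z => ¬S.Good ω z) k} ≤ 2 * 2⁻¹ ^ k := by
  have hJ : 0 < S.J := by
    have := S.lt_J
    by_contra h0
    simp only [not_lt, Nat.le_zero] at h0
    simp [h0] at this
  refine measure_not_hasGoodPath_le (law p) (by omega) (S.cls hJ) (fun ω z => ¬S.Good ω z) ?_ hk
  intro F c hF
  have he : {ω : Config | ∀ z ∈ F, ¬S.Good ω z} = ⋂ z ∈ F, {ω | ¬S.Good ω z} := by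
    ext ω; simp
  have hprod : law p (⋂ z ∈ F, {ω | ¬S.Good ω z}) = ∏ z ∈ F, law p {ω | ¬S.Good ω z} :=
    measure_biInter_eq_prod (bernoulliMeasure true false p) F S.box
      (fun z hz z' hz' hne => S.disjoint_box ((hF z hz).2.trans (hF z' hz').2.symm) hne) _
      fun z _ => @MeasurableSet.compl _ _ (sig Bool (S.box z)) (S.measurableSet_good z)
  rw [he, hprod]
  exact Finset.prod_le_pow_card _ _ _ fun z _ => h z

end Scale

/-- Scales with small probability of bad blocks and of prescribed precision exist. -/
lemma exists_scale {p : I} {α : ℝ} (hα : slope p = α) (hα0 : 0 < α) (hα1 : α ≤ 1) {κ : ℝ}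
    (hκ : 0 < κ) :
    ∃ S : Scale α, 9 * (S.m : ℝ) ≤ κ * S.T ∧
      ∀ z, law p {ω | ¬S.Good ω z} ≤ 6⁻¹ ^ (3 * (2 * S.J)) := by
  obtain ⟨b, hb⟩ := exists_nat_ge (11 / α)
  set B : ℕ := 2 * (b + 1) with hB
  have hBα : 11 ≤ α * B := by
    rw [div_le_iff₀ hα0] at hb
    have : (b : ℝ) ≤ B := by rw [hB]; push_cast; linarith [Nat.cast_nonneg (α := ℝ) b]
    nlinarith
  have hB11 : 11 ≤ B := by
    have : (11 : ℝ) ≤ B := hBα.trans (by nlinarith [Nat.cast_nonneg (α := ℝ) B])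
    exact_mod_cast this
  obtain ⟨K₀, hK₀⟩ := exists_nat_ge (9 / κ)
  set K : ℕ := K₀ + 1 with hK
  have hKκ : 9 ≤ κ * K := by
    rw [div_le_iff₀ hκ] at hK₀
    rw [hK]; push_cast; nlinarith
  set J : ℕ := 3 * (K * B) + 1 with hJ
  set β : ℝ := 1 / ((K + 1) * B) with hβ
  have hB0 : (0 : ℝ) < B := by exact_mod_cast (show 0 < B by omega)
  have hβ0 : 0 < β := by positivity
  set δ : ℝ := 6⁻¹ ^ (3 * (2 * J)) / 2 with hδ
  have hδ0 : 0 < δ := by positivity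
  have hev := eventually_corridorEvent hα hα0.le hβ0 hδ0
  have ht : ∀ c : ℕ, 0 < c → Tendsto (fun m : ℕ => c * m) atTop atTop := fun c hc =>
    tendsto_id.const_mul_atTop' hc
  obtain ⟨m, h1, h2, hm⟩ := (((ht ((K + 1) * B) (by positivity)).eventually hev).and
    (((ht B (by omega)).eventually hev).and (eventually_ge_atTop 4))).exists
  have hmr : (4 : ℝ) ≤ m := by exact_mod_cast hm
  have hA1 := Int.floor_le (α * (K * B * m : ℕ) / 2)
  have hA2 := Int.lt_floor_add_one (α * (K * B * m : ℕ) / 2)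
  have hKB : 1 ≤ K := by omega
  let S : Scale α :=
    { T := K * B * m
      M := B * m
      m := m
      J := J
      A := 2 * ⌊α * (K * B * m : ℕ) / 2⌋
      pos := hα0
      le_one := hα1
      two_le_m := by omega
      two_le_M := by nlinarith
      M_le := (Nat.le_mul_of_pos_left (B * m) hKB).trans (mul_assoc K B m).ge
      m_le := by
        refine Nat.mul_le_mul_right m ?_
        nlinarith
      lt_J := by rw [hJ]; nlinarith
      even_T := by rw [hB]; exact ⟨K * (b + 1) * m, by ring⟩
      even_A := even_two_mul _
      A_le := by push_cast at hA1 ⊢; linarith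
      lt_A := by push_cast at hA2 ⊢; linarith
      m_le_M := by push_cast; nlinarith }
  refine ⟨S, ?_, fun z => ?_⟩
  · change 9 * (m : ℝ) ≤ κ * (K * B * m : ℕ)
    push_cast
    have : (1 : ℝ) ≤ B := by exact_mod_cast (show 1 ≤ B by omega)
    have h3 : 9 ≤ κ * K * B := by nlinarith
    nlinarith
  · have h3 : law p (corridorEvent α (2 * S.m - 4) (S.T + S.M))ᶜ ≤ ENNReal.ofReal δ := by
      have e : S.T + S.M = (K + 1) * B * m := by simp only [S]; ring
      rw [e]
      refine (measure_mono (Set.compl_subset_compl.2 (corridorEvent_mono ?_ _))).trans h1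
      simp only [S, hβ]
      push_cast
      rw [div_mul_eq_mul_div, div_le_iff₀ (by positivity)]
      nlinarith [show (0 : ℝ) < (K + 1) * B by positivity]
    have h4 : law p (corridorEvent α (2 * S.m - 4) S.M)ᶜ ≤ ENNReal.ofReal δ := by
      refine (measure_mono (Set.compl_subset_compl.2 (corridorEvent_mono ?_ _))).trans h2
      simp only [S, hβ]
      push_cast
      rw [div_mul_eq_mul_div, div_le_iff₀ (by positivity)]
      nlinarith [show (0 : ℝ) < B * m by positivity, show (0 : ℝ) ≤ K * B * m by positivity]
    refine (S.law_not_good_le p h3 h4 z).trans ?_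
    rw [← ENNReal.ofReal_ofNat, ← ENNReal.ofReal_mul zero_le_two, hδ, mul_div_cancel₀ _ two_ne_zero,
      ENNReal.ofReal_pow (by positivity), ENNReal.ofReal_inv_of_pos (by norm_num),
      ENNReal.ofReal_ofNat]

theorem exists_lowProb_le {p : I} (hp : criticalValue < p) {a : ℝ} (ha : (a : EReal) < slope p) :
    ∃ C γ : ℝ, 0 < C ∧ 0 < γ ∧
      ∀ n : ℕ, lowProb p a n ≤ ENNReal.ofReal (C * Real.exp (-γ * n)) := by
  obtain ⟨α, hα0, hα1, hα⟩ := exists_slope_eq hp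
  rw [hα, EReal.coe_lt_coe_iff] at ha
  set a' := max a 0 with ha'
  have ha'α : a' < α := max_lt ha hα0
  have ha'0 : 0 ≤ a' := le_max_right _ _
  set κ := (α - a') / 2 with hκ
  have hκ0 : 0 < κ := half_pos (sub_pos.2 ha'α)
  obtain ⟨S, hS, hbad⟩ := exists_scale hα hα0 hα1 hκ0
  have hT0 : 0 < S.T := by have := S.m_le; have := S.two_le_m; omega
  have hT : (0 : ℝ) < S.T := by exact_mod_cast hT0
  have hMT := S.M_le
  have hMTr : (S.M : ℝ) ≤ S.T := by exact_mod_cast hMT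
  obtain ⟨n₀, hn₀⟩ := exists_nat_gt ((α * 2 * S.T) / κ)
  set n₁ := max n₀ (2 * S.T) with hn₁
  set γ := Real.log 2 / S.T with hγ
  have hγ0 : 0 < γ := div_pos (Real.log_pos one_lt_two) hT
  refine ⟨8 + Real.exp (γ * n₁), γ, by positivity, hγ0, fun n => ?_⟩
  rcases lt_or_ge n n₁ with hn | hn
  · refine prob_le_one.trans ?_
    rw [← ENNReal.ofReal_one]
    refine ENNReal.ofReal_le_ofReal ?_
    have h1 : (n : ℝ) ≤ n₁ := by exact_mod_cast hn.le
    calc (1 : ℝ) ≤ Real.exp (γ * n₁) * Real.exp (-γ * n) := by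
          rw [← Real.exp_add, Real.one_le_exp_iff]; nlinarith
      _ ≤ _ := by gcongr; linarith
  · have hn2 : 2 * S.T ≤ n := (le_max_right _ _).trans hn
    set k := (n - S.M) / S.T with hk
    have hk1 : k * S.T + S.M ≤ n := by
      have := Nat.div_mul_le_self (n - S.M) S.T; rw [← hk] at this; omega
    have hk2 : n < k * S.T + S.T + S.M := by
      have := Nat.lt_div_mul_add hT0 (a := n - S.M); rw [← hk] at this; omega
    have hkpos : 1 ≤ k := (Nat.one_le_div_iff hT0).2 (by omega)
    have hk2r : (n : ℝ) ≤ (k + 2) * S.T := by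
      have : n ≤ (k + 2) * S.T := by nlinarith
      exact_mod_cast this
    have hsub : {ω | upperEdge ω n ≤ ((a * n : ℝ) : EReal)} ⊆
        {ω | ¬HasGoodPath (fun z => ¬S.Good ω z) k} := by
      intro ω hω hgp
      have h1 := (S.le_upperEdge_of_hasGoodPath hgp hk1 hk2.le).trans hω
      rw [EReal.coe_le_coe_iff] at h1
      have h2 : a * n ≤ a' * n := by gcongr; exact le_max_left _ _
      have hA := S.lt_A
      have hm2 : (2 : ℝ) ≤ S.m := by exact_mod_cast S.two_le_m
      have h3 : (a' + κ) * S.T ≤ S.A - 8 * S.m := by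
        have : a' + κ = α - κ := by rw [hκ]; ring
        rw [this]; nlinarith
      have h4 : (n : ℝ) - 2 * S.T ≤ k * S.T := by linarith
      have h5 : (a' + κ) * (k * S.T) ≤ k * (S.A - 8 * S.m) := by
        calc _ = k * ((a' + κ) * S.T) := by ring
          _ ≤ _ := by gcongr
      have h6 : (a' + κ) * (n - 2 * S.T) ≤ (a' + κ) * (k * S.T) := by gcongr
      have h7 : (α * 2 * S.T) < κ * n := by
        rw [div_lt_iff₀ hκ0] at hn₀
        have : (n₀ : ℝ) ≤ n := by exact_mod_cast (le_max_left _ _).trans hn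
        nlinarith
      have h8 : (a' + κ) * (2 * S.T) ≤ α * 2 * S.T := by
        have : a' + κ ≤ α := by rw [hκ]; linarith
        nlinarith
      nlinarith
    refine (measure_mono hsub).trans ((S.law_not_hasGoodPath_le p hbad hkpos).trans ?_)
    have e1 : (2 * 2⁻¹ ^ k : ℝ≥0∞) = ENNReal.ofReal (2 * 2⁻¹ ^ k) := by
      rw [ENNReal.ofReal_mul zero_le_two, ENNReal.ofReal_pow (by positivity),
        ENNReal.ofReal_inv_of_pos (by norm_num), ENNReal.ofReal_ofNat]
    rw [e1]
    refine ENNReal.ofReal_le_ofReal ?_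
    have e2 : (2⁻¹ : ℝ) ^ k = 4 * Real.exp (-(Real.log 2 * (k + 2))) := by
      rw [show -(Real.log 2 * ((k : ℝ) + 2)) = ((k + 2 : ℕ) : ℝ) * -Real.log 2 by push_cast; ring,
        Real.exp_nat_mul, Real.exp_neg, Real.exp_log two_pos, pow_add]
      norm_num; ring
    have e3 : Real.exp (-(Real.log 2 * (k + 2))) ≤ Real.exp (-γ * n) := by
      refine Real.exp_le_exp.2 ?_
      have : γ * n ≤ Real.log 2 * (k + 2) := by
        rw [hγ, div_mul_eq_mul_div, div_le_iff₀ hT, mul_assoc]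
        exact mul_le_mul_of_nonneg_left hk2r (Real.log_pos one_lt_two).le
      linarith
    rw [e2]
    nlinarith [Real.exp_pos (γ * n₁), Real.exp_pos (-γ * n), mul_pos (Real.exp_pos (γ * n₁)) (Real.exp_pos (-γ * n))]

/-! ### Supermultiplicative sequences -/

section Fekete

variable {f : ℕ → ℝ≥0∞}

lemma pow_mul_le_of_supermul (hf : ∀ n m, f n * f m ≤ f (n + m)) (m r q : ℕ) :
    f m ^ q * f r ≤ f (q * m + r) := by
  induction q with
  | zero => simp
  | succ q ih =>
    calc f m ^ (q + 1) * f r = f m * (f m ^ q * f r) := by ring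
      _ ≤ f m * f (q * m + r) := by gcongr
      _ ≤ f (m + (q * m + r)) := hf _ _
      _ = f ((q + 1) * m + r) := by congr 1; ring

/-- Fekete's lemma for logarithms of supermultiplicative sequences. -/
lemma tendsto_log_div_of_supermul (hf : ∀ n m, f n * f m ≤ f (n + m)) (h1 : ∀ n, f n ≤ 1)
    (hpos : ∀ n, 2 ≤ n → f n ≠ 0) :
    Tendsto (fun n : ℕ => ENNReal.log (f n) / (n : EReal)) atTop
      (𝓝 (⨆ (n : ℕ) (_ : 1 ≤ n), ENNReal.log (f n) / (n : EReal))) := by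
  have hfin : ∀ n, f n ≠ ⊤ := fun n => ((h1 n).trans_lt ENNReal.one_lt_top).ne
  refine tendsto_order.2 ⟨fun b hb => ?_, fun b hb => ?_⟩
  · obtain ⟨m, hb⟩ := lt_iSup_iff.1 hb
    obtain ⟨hm, hb⟩ := lt_iSup_iff.1 hb
    have hm0 : (0 : ℝ) < m := by exact_mod_cast hm
    have hfm : f m ≠ 0 := by
      intro h0
      rw [h0, ENNReal.log_zero, EReal.bot_div_of_pos_ne_top (by exact_mod_cast hm0)
        (EReal.natCast_ne_top m)] at hb
      exact not_lt_bot hb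
    set ℓ := Real.log (f m).toReal with hℓ
    have hℓ0 : ℓ ≤ 0 := Real.log_nonpos ENNReal.toReal_nonneg
      (ENNReal.toReal_mono ENNReal.one_ne_top (h1 m))
    have hb' : b < ((ℓ / m : ℝ) : EReal) := by
      rwa [ENNReal.log_pos_real hfm (hfin m)] at hb
    set c := -∑ r ∈ Finset.range (m + 2), |Real.log (f r).toReal| with hc
    have hlim : Tendsto (fun n : ℕ => ((ℓ / m + c / n : ℝ) : EReal)) atTop
        (𝓝 ((ℓ / m : ℝ) : EReal)) := by
      refine (continuous_coe_real_ereal.tendsto _).comp ?_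
      simpa using (tendsto_const_nhds (x := ℓ / m)).add (tendsto_const_div_atTop_nhds_zero_nat c)
    filter_upwards [hlim.eventually (lt_mem_nhds hb'), eventually_ge_atTop 2] with n hn hn2
    refine hn.trans_le ?_
    have hn0 : (0 : ℝ) < n := by exact_mod_cast (show 0 < n by omega)
    rw [ENNReal.log_pos_real (hpos n hn2) (hfin n)]
    change _ ≤ ((Real.log (f n).toReal / (n : ℝ) : ℝ) : EReal)
    rw [EReal.coe_le_coe_iff, le_div_iff₀ hn0]
    set q := (n - 2) / m with hq
    set r := (n - 2) % m + 2 with hr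
    have hrm : r < m + 2 := by have := Nat.mod_lt (n - 2) hm; omega
    have hn_eq : q * m + r = n := by
      have := Nat.div_add_mod' (n - 2) m
      rw [← hq] at this; omega
    have hfr : f r ≠ 0 := hpos r (by omega)
    have hle := ENNReal.toReal_mono (hfin n) (hn_eq ▸ pow_mul_le_of_supermul hf m r q)
    rw [ENNReal.toReal_mul, ENNReal.toReal_pow] at hle
    have hpm := ENNReal.toReal_pos hfm (hfin m)
    have hpr := ENNReal.toReal_pos hfr (hfin r)
    have hlog := Real.log_le_log (by positivity) hle
    rw [Real.log_mul (by positivity) (by positivity), Real.log_pow, ← hℓ] at hlog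
    have hcr : c ≤ Real.log (f r).toReal := by
      have h3 := Finset.single_le_sum (f := fun r => |Real.log (f r).toReal|)
        (fun i _ => abs_nonneg _) (Finset.mem_range.2 hrm)
      have h4 := neg_abs_le (Real.log (f r).toReal)
      linarith
    have hqm : (q : ℝ) * m ≤ n := by
      have : q * m ≤ n := by omega
      exact_mod_cast this
    have h5 : ℓ / m * n ≤ q * ℓ := by
      rw [div_mul_eq_mul_div, div_le_iff₀ hm0]; nlinarith
    have h6 : c / n * n = c := div_mul_cancel₀ _ hn0.ne'
    rw [add_mul, h6]
    linarith
  · filter_upwards [eventually_ge_atTop 1] with n hn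
    exact lt_of_le_of_lt (le_iSup₂ (f := fun (n : ℕ) (_ : 1 ≤ n) => ENNReal.log (f n) / (n : EReal))
      n hn) hb

/-- A supermultiplicative sequence decaying exponentially does so without a prefactor. -/
lemma le_exp_of_supermul (hf : ∀ n m, f n * f m ≤ f (n + m)) (h1 : ∀ n, f n ≤ 1) {C γ : ℝ}
    (h : ∀ n : ℕ, f n ≤ ENNReal.ofReal (C * Real.exp (-γ * n))) (n : ℕ) :
    f n ≤ ENNReal.ofReal (Real.exp (-γ * n)) := by
  have hfin : f n ≠ ⊤ := ((h1 n).trans_lt ENNReal.one_lt_top).ne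
  rw [ENNReal.le_ofReal_iff_toReal_le hfin (Real.exp_pos _).le]
  by_contra! hlt
  set r := Real.exp (-γ * n) with hr
  have hr0 : 0 < r := Real.exp_pos _
  have hC : ∀ q : ℕ, ((f n).toReal / r) ^ q ≤ max C 1 := by
    intro q
    rcases Nat.eq_zero_or_pos q with rfl | hq
    · simp
    have h2 : f n ^ q ≤ f (q * n) := by
      obtain ⟨q, rfl⟩ : ∃ k, q = k + 1 := ⟨q - 1, by omega⟩
      have := pow_mul_le_of_supermul hf n n q
      rwa [← pow_succ, ← Nat.succ_mul] at this
    have h3 := h2.trans (h (q * n))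
    have h4 : C * Real.exp (-γ * (q * n : ℕ)) ≤ max C 1 * r ^ q := by
      rw [hr, ← Real.exp_nat_mul, show -γ * ((q * n : ℕ) : ℝ) = q * (-γ * n) by push_cast; ring]
      gcongr
      exact le_max_left _ _
    have h5 := ENNReal.toReal_le_of_le_ofReal (by positivity)
      (h3.trans (ENNReal.ofReal_le_ofReal h4))
    rw [ENNReal.toReal_pow] at h5
    rw [div_pow, div_le_iff₀ (by positivity)]
    exact h5
  obtain ⟨q, hq⟩ := pow_unbounded_of_one_lt (max C 1) ((one_lt_div hr0).2 hlt)
  exact absurd (hC q) (not_le.2 hq)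

end Fekete

/-! ### Positivity of the probabilities of a low edge -/

lemma law_closed (p : I) (z : ℤ × ℤ) : law p {ω | ω z = false} = ENNReal.ofReal (1 - p) := by
  have h := (measurePreserving_eval_infinitePi
    (fun _ : ℤ × ℤ => bernoulliMeasure true false p) z).measure_preimage
    (MeasurableSet.singleton false).nullMeasurableSet
  have e : (Function.eval z : Config → Bool) ⁻¹' {false} = {ω | ω z = false} := by
    ext ω; simp
  rw [e] at h
  rw [law, h, ← ofReal_measureReal, bernoulliMeasure_real_apply_of_notMem_of_mem] <;> simp

lemma lowProb_ne_zero {p : I} (hp : (p : ℝ) < 1) (a : ℝ) {n : ℕ} (hn : 2 ≤ n) :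
    lowProb p a n ≠ 0 := by
  obtain ⟨Y, hY⟩ := exists_nat_ge ((1 - a) * n)
  set F : Finset (ℤ × ℤ) := Finset.Icc 0 1 ×ˢ Finset.Ioc (-(Y : ℤ)) 0 with hF
  have hsub : (⋂ z ∈ F, {ω : Config | ω z = false}) ⊆
      {ω | upperEdge ω n ≤ ((a * n : ℝ) : EReal)} := by
    intro ω hω
    simp only [Set.mem_iInter, Set.mem_ofPred_eq] at hω
    rw [Set.mem_ofPred_eq, upperEdge_le_iff]
    have key : ∀ s y x : ℤ, 0 ≤ s → s ≤ 1 → y ≤ 0 → Connects ω (s, y) (n, x) →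
        ((x : ℝ) : EReal) ≤ ((a * n : ℝ) : EReal) := by
      intro s y x hs0 hs1 hy hc
      have hyY : y ≤ -Y := by
        by_contra hlt
        have hcl := hω (s, y) (by simp [hF]; omega)
        rcases Relation.ReflTransGen.cases_head hc.2 with h | ⟨v, hv, -⟩
        · rw [Prod.ext_iff] at h; simp only at h; omega
        · have := hv.2.1; rw [hcl] at this; simp at this
      have hx := path_height_le hc.2
      simp only at hx
      have hx' : x ≤ -Y + n := by omega
      rw [EReal.coe_le_coe_iff]
      have : (x : ℝ) ≤ -Y + n := by exact_mod_cast hx'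
      linarith
    rintro x ⟨y, hy, h | h⟩
    · exact key 0 y x le_rfl zero_le_one hy h
    · exact key 1 y x zero_le_one le_rfl hy h
  have hprod : law p (⋂ z ∈ F, {ω : Config | ω z = false}) =
      ∏ z ∈ F, law p {ω : Config | ω z = false} :=
    measure_biInter_eq_prod (bernoulliMeasure true false p) F (fun z => {z})
      (fun z _ z' _ hne => by simpa using hne) _
      fun z _ => measurable_eval_sig (X := Bool) (Set.mem_singleton z)
        (MeasurableSet.singleton false)
  have hpos : 0 < law p (⋂ z ∈ F, {ω : Config | ω z = false}) := by
    rw [hprod]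
    simp only [law_closed]
    rw [Finset.prod_const]
    exact ENNReal.pow_pos (ENNReal.ofReal_pos.2 (sub_pos.2 hp)) _
  exact (hpos.trans_le (measure_mono hsub)).ne'

lemma lowProb_eq_zero {p : I} (hp : (p : ℝ) = 1) {a : ℝ} (ha : a < 1) {n : ℕ} (hn : 1 ≤ n) :
    lowProb p a n = 0 := by
  have hsub : {ω | upperEdge ω n ≤ ((a * n : ℝ) : EReal)} ⊆
      ⋃ l : ℕ, {ω : Config | ω ((l : ℤ), (l : ℤ)) = false} := by
    intro ω hω
    by_contra hcon
    simp only [Set.mem_iUnion, Set.mem_ofPred_eq, not_exists, Bool.not_eq_false] at hcon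
    have hpath : ∀ l : ℕ, Relation.ReflTransGen (Step ω) (0, 0) ((l : ℤ), (l : ℤ)) := by
      intro l
      induction l with
      | zero => exact .refl
      | succ l ih =>
        exact ih.tail ⟨⟨Even.add_self _, by simp⟩, hcon l, Or.inl (by simp)⟩
    have hmem : (n : ℤ) ∈ reachedFromBelow ω n :=
      ⟨0, le_rfl, Or.inl ⟨⟨by simp, by simp⟩, hpath n⟩⟩
    have := (le_upperEdge hmem).trans hω
    rw [EReal.coe_le_coe_iff] at this
    have hn0 : (0 : ℝ) < n := by exact_mod_cast hn
    push_cast at this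
    nlinarith
  refine measure_mono_null hsub (measure_iUnion_null fun l => ?_)
  rw [law_closed, hp]; simp

lemma lowRate_iSup_eq {p : I} {a : ℝ} {C γ₀ : ℝ} (hγ₀ : 0 < γ₀)
    (h : ∀ n : ℕ, lowProb p a n ≤ ENNReal.ofReal (C * Real.exp (-γ₀ * n))) (ha : a < 1) :
    ∃ γ : EReal, 0 < γ ∧ ((p : ℝ) < 1 → γ < ⊤) ∧
        Tendsto (lowRate p a) atTop (𝓝 (-γ)) ∧
        (⨆ (n : ℕ) (_ : 1 ≤ n), lowRate p a n) = -γ ∧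
        ∀ n : ℕ, lowProb p a n ≤ EReal.exp (-(γ * n)) := by
  have hle1 : ∀ n, lowProb p a n ≤ 1 := fun n => prob_le_one
  set s := ⨆ (n : ℕ) (_ : 1 ≤ n), lowRate p a n with hs
  have hnat : ∀ n : ℕ, 1 ≤ n → (0 : EReal) < n := fun n hn => by
    have : (0 : ℝ) < n := by exact_mod_cast hn
    exact_mod_cast this
  refine ⟨-s, ?_, fun hp => ?_, ?_, (neg_neg s).symm, fun n => ?_⟩
  · have hsle : s ≤ ((-γ₀ : ℝ) : EReal) := by
      refine iSup₂_le fun n hn => ?_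
      rw [lowRate, EReal.div_le_iff_le_mul (hnat n hn) (EReal.natCast_ne_top n)]
      have := ENNReal.log_monotone (le_exp_of_supermul (lowProb_mul_le p a) hle1 h n)
      rw [ENNReal.log_ofReal_of_pos (Real.exp_pos _), Real.log_exp, mul_comm, EReal.coe_mul] at this
      exact this
    have : s < 0 := hsle.trans_lt (by exact_mod_cast neg_neg_of_pos hγ₀)
    rw [EReal.lt_neg_comm, neg_zero]
    exact this
  · have h2 : lowRate p a 2 ≤ s := le_iSup₂ (f := fun (n : ℕ) (_ : 1 ≤ n) => lowRate p a n) 2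
      one_le_two
    have hb : ⊥ < lowRate p a 2 := by
      rw [lowRate, EReal.lt_div_iff (hnat 2 one_le_two) (EReal.natCast_ne_top 2),
        EReal.bot_mul_of_pos (hnat 2 one_le_two), ENNReal.bot_lt_log_iff]
      exact pos_iff_ne_zero.2 (lowProb_ne_zero hp a le_rfl)
    have := hb.trans_le h2
    rw [lt_top_iff_ne_top, Ne, EReal.neg_eq_top_iff]
    exact this.ne'
  · rw [neg_neg]
    rcases (p.2.2 : (p : ℝ) ≤ 1).lt_or_eq with hp | hp
    · exact tendsto_log_div_of_supermul (lowProb_mul_le p a) hle1 fun n hn => lowProb_ne_zero hp a hn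
    · have hbot : ∀ n : ℕ, 1 ≤ n → lowRate p a n = ⊥ := fun n hn => by
        rw [lowRate, lowProb_eq_zero hp ha hn, ENNReal.log_zero,
          EReal.bot_div_of_pos_ne_top (hnat n hn) (EReal.natCast_ne_top n)]
      have hsb : s = ⊥ := by
        rw [hs, iSup₂_eq_bot]; exact hbot
      rw [hsb]
      refine tendsto_const_nhds.congr' ?_
      filter_upwards [eventually_ge_atTop 1] with n hn
      exact (hbot n hn).symm
  · rw [neg_mul, neg_neg]
    rcases Nat.eq_zero_or_pos n with rfl | hn
    · simpa using hle1 0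
    · have h2 : lowRate p a n ≤ s := le_iSup₂ (f := fun (n : ℕ) (_ : 1 ≤ n) => lowRate p a n) n hn
      rw [lowRate, EReal.div_le_iff_le_mul (hnat n hn) (EReal.natCast_ne_top n)] at h2
      have := EReal.exp_monotone h2
      rwa [ENNReal.exp_log, mul_comm] at this

/-! ### The extinction time -/

/-- If the cluster of the origin dies out at level `k`, the edge reached from below stays below the
last surviving sites. -/
lemma lt_of_reached_eq_empty {ω : Config} {k : ℕ} (hempty : reached ω (k + 1) = ∅) {z x : ℤ}
    (hz : z ∈ reached ω k) (hx : x ∈ reachedFromBelow ω (k + 1)) (hx0 : 0 < x) : x < z := by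
  obtain ⟨h, hh, hh0, hhk, -⟩ := (path_iff_pathIn.2 hz.2).exists_isPath hz.1
  simp only at hh hh0 hhk
  have key : ∀ s y : ℤ, 0 ≤ s → s ≤ 1 → y ≤ 0 → Connects ω (s, y) ((k + 1 : ℕ), x) → x < z := by
    intro s y hs0 hs1 hy hc
    obtain ⟨f, hf, hfs, hfk, -⟩ := (path_iff_pathIn.2 hc.2).exists_isPath hc.1
    simp only at hf hfs hfk
    push_cast at hf hfk
    have hsk : s ≤ k := by
      by_contra hlt
      have hk1 : s = k + 1 := by
        have := path_level_le hc.2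
        push_cast at this
        omega
      rw [← hk1, hfs] at hfk
      omega
    have hstart : f s < h s ∨ (h s = f s ∧ Even (s + h s)) := by
      rw [hfs]
      have hpar := hc.1.1
      simp only at hpar
      obtain rfl | rfl : s = 0 ∨ s = 1 := by omega
      · rw [hh0]
        rcases hy.lt_or_eq with h1 | h1
        · exact Or.inl h1
        · exact Or.inr ⟨h1.symm, by simp⟩
      · have h1 := (hh.2.2 0 le_rfl (by omega)).1
        rw [hh0, zero_add, sub_zero, abs_le] at h1
        rw [Int.even_iff] at hpar
        by_cases h2 : h 1 = y
        · exact Or.inr ⟨h2, by rw [h2, Int.even_iff]; exact hpar⟩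
        · exact Or.inl (by omega)
    have hlt : f k < h k := by
      by_contra hge
      obtain ⟨l, hl1, hl2, hl3, hl4⟩ := hh.exists_common hf (a := s) (b := k) hs0 le_rfl le_rfl
        (by omega) hsk hstart (not_lt.1 hge)
      have h1 := hh.path le_rfl (hs0.trans hl1) hl2 (by simp [hh0]) (by rw [hl3]; exact hl4)
      have h2 := hf.path (a := l) (b := k + 1) hl1 (by omega) le_rfl hl4
        (by rw [hfk]; exact_mod_cast (path_mem_lattice hc.2 hc.1).1)
      rw [hh0, hl3] at h1
      rw [hfk] at h2
      have : x ∈ reached ω (k + 1) := ⟨hz.1, by push_cast; exact h1.trans h2⟩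
      rw [hempty] at this
      exact this
    obtain ⟨h1, -, h3⟩ := hf.2.2 k hsk (by omega)
    have h4 := (path_mem_lattice hz.2 hz.1).1
    simp only at h4
    rw [hhk] at hlt
    rw [hfk] at h1 h3
    rw [abs_le] at h1
    rw [Int.even_iff] at h3 h4
    omega
  obtain ⟨y, hy, hc | hc⟩ := hx
  · exact key 0 y le_rfl zero_le_one hy hc
  · exact key 1 y zero_le_one le_rfl hy hc

lemma upperEdge_nonpos_of_reached_eq_empty {ω : Config} {k : ℕ}
    (hempty : reached ω (k + 1) = ∅) (hne : (reached ω k).Nonempty) :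
    upperEdge ω (k + 1) ≤ 0 ∨ upperEdge (refl ω) (k + 1) ≤ 0 := by
  by_contra! hcon
  obtain ⟨z, hz⟩ := hne
  have hex : ∀ ω : Config, 0 < upperEdge ω (k + 1) → ∃ x ∈ reachedFromBelow ω (k + 1), 0 < x := by
    intro ω h
    by_contra! hle
    refine absurd (upperEdge_le_iff.2 fun x hx => ?_) (not_le.2 h)
    exact_mod_cast hle x hx
  obtain ⟨x, hx, hx0⟩ := hex _ hcon.1
  obtain ⟨x', hx', hx0'⟩ := hex _ hcon.2
  have h1 := lt_of_reached_eq_empty hempty hz hx hx0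
  have hempty' : reached (refl ω) (k + 1) = ∅ := by
    refine Set.eq_empty_of_forall_notMem fun w hw => ?_
    have := neg_mem_reached_refl hw
    rw [refl_refl, hempty] at this
    exact this
  have h2 := lt_of_reached_eq_empty hempty' (neg_mem_reached_refl hz) hx' hx0'
  omega

lemma exists_deathTime_eq {ω : Config} (h : deathTime ω < ⊤) :
    ∃ k : ℕ, deathTime ω = (k + 1 : ℕ) ∧ reached ω (k + 1) = ∅ ∧ (reached ω k).Nonempty := by
  have hex : ∃ n, reached ω n = ∅ := by
    by_contra! hcon
    have : deathTime ω = ⊤ := by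
      simp only [deathTime, iInf_eq_top]
      exact fun n hn => absurd hn (hcon n).ne_empty
    exact h.ne this
  classical
  have hmin : deathTime ω = (Nat.find hex : ℕ) := by
    refine le_antisymm (iInf₂_le (f := fun (n : ℕ) (_ : reached ω n = ∅) => (n : ℕ∞)) _
      (Nat.find_spec hex)) (le_iInf₂ fun n hn => ?_)
    exact_mod_cast Nat.find_min' hex hn
  have hne0 : Nat.find hex ≠ 0 := by
    intro h0
    have h1 := Nat.find_spec hex
    rw [h0] at h1
    have h2 : (0 : ℤ) ∈ reached ω 0 := ⟨⟨by simp, by simp⟩, .refl⟩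
    rw [h1] at h2
    exact h2
  obtain ⟨k, hk⟩ := Nat.exists_eq_succ_of_ne_zero hne0
  refine ⟨k, by rw [hmin, hk], ?_, ?_⟩
  · have := Nat.find_spec hex
    rwa [hk] at this
  · exact Set.nonempty_iff_ne_empty.2 (Nat.find_min hex (by omega))

lemma law_deathTime_le (p : I) {C γ : ℝ} (hC : 0 < C) (hγ : 0 < γ)
    (h : ∀ n : ℕ, lowProb p 0 n ≤ ENNReal.ofReal (C * Real.exp (-γ * n))) (n : ℕ) :
    law p {ω | (n : ℕ∞) ≤ deathTime ω ∧ deathTime ω < ⊤} ≤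
      ENNReal.ofReal (2 * C / (1 - Real.exp (-γ)) * Real.exp (-γ * n)) := by
  set E : ℕ → Set Config := fun k => {ω | upperEdge ω k ≤ 0} with hE
  have hEl : ∀ k, law p (E k) = lowProb p 0 k := fun k => by simp [hE, lowProb]
  have hr : MeasurePreserving refl (law p) (law p) := measurePreserving_refl _
  have hsub : {ω | (n : ℕ∞) ≤ deathTime ω ∧ deathTime ω < ⊤} ⊆
      ⋃ t : ℕ, (E (t + n) ∪ refl ⁻¹' E (t + n)) := by
    rintro ω ⟨h1, h2⟩
    obtain ⟨k, h3, h4, h5⟩ := exists_deathTime_eq h2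
    rw [h3] at h1
    have h1' : n ≤ k + 1 := by exact_mod_cast h1
    refine Set.mem_iUnion.2 ⟨k + 1 - n, ?_⟩
    rw [Nat.sub_add_cancel h1']
    exact upperEdge_nonpos_of_reached_eq_empty h4 h5
  have hexp : Real.exp (-γ) < 1 := Real.exp_lt_one_iff.2 (neg_neg_of_pos hγ)
  refine (measure_mono hsub).trans ((measure_iUnion_le _).trans ?_)
  calc ∑' t : ℕ, law p (E (t + n) ∪ refl ⁻¹' E (t + n))
      ≤ ∑' t : ℕ, ENNReal.ofReal (2 * C * Real.exp (-γ * n) * Real.exp (-γ) ^ t) := by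
        refine ENNReal.tsum_le_tsum fun t => (measure_union_le _ _).trans ?_
        rw [hr.measure_preimage (measurableSet_upperEdge_le _ _).nullMeasurableSet, hEl]
        refine (add_le_add (h _) (h _)).trans ?_
        rw [← ENNReal.ofReal_add (by positivity) (by positivity)]
        refine ENNReal.ofReal_le_ofReal (le_of_eq ?_)
        rw [← Real.exp_nat_mul, show -γ * ((t + n : ℕ) : ℝ) = -γ * n + t * -γ by push_cast; ring,
          Real.exp_add]
        ring
    _ = ENNReal.ofReal (∑' t : ℕ, 2 * C * Real.exp (-γ * n) * Real.exp (-γ) ^ t) :=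
        (ENNReal.ofReal_tsum_of_nonneg (fun t => by positivity)
          ((summable_geometric_of_lt_one (Real.exp_pos _).le hexp).mul_left _)).symm
    _ = _ := by
        rw [tsum_mul_left, tsum_geometric_of_lt_one (Real.exp_pos _).le hexp]
        congr 1
        field_simp

end OTSP

end

theorem mainTheorem7 (p : unitInterval) (hp : OTSP.criticalValue < (p : ℝ)) :
    (∀ a : ℝ, (a : EReal) < OTSP.slope p →
      (∃ C γ : ℝ, 0 < C ∧ 0 < γ ∧
        ∀ n : ℕ, OTSP.lowProb p a n ≤ ENNReal.ofReal (C * Real.exp (-γ * n))) ∧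
      (∃ γ : EReal, 0 < γ ∧ ((p : ℝ) < 1 → γ < ⊤) ∧
        Tendsto (OTSP.lowRate p a) atTop (𝓝 (-γ)) ∧
        (⨆ (n : ℕ) (_ : 1 ≤ n), OTSP.lowRate p a n) = -γ ∧
        ∀ n : ℕ, OTSP.lowProb p a n ≤ EReal.exp (-(γ * n)))) ∧
    (∃ C γ : ℝ, 0 < C ∧ 0 < γ ∧
      ∀ n : ℕ, OTSP.law p {ω | (n : ℕ∞) ≤ OTSP.deathTime ω ∧ OTSP.deathTime ω < ⊤} ≤
        ENNReal.ofReal (C * Real.exp (-γ * n))) := by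
  obtain ⟨α, hα0, hα1, hα⟩ := OTSP.exists_slope_eq hp
  refine ⟨fun a ha => ?_, ?_⟩
  · obtain ⟨C, γ, hC, hγ, h⟩ := OTSP.exists_lowProb_le hp ha
    refine ⟨⟨C, γ, hC, hγ, h⟩, OTSP.lowRate_iSup_eq hγ h ?_⟩
    rw [hα, EReal.coe_lt_coe_iff] at ha
    exact ha.trans_le hα1
  · obtain ⟨C, γ, hC, hγ, h⟩ := OTSP.exists_lowProb_le hp (a := 0) (by rw [hα]; exact_mod_cast hα0)
    refine ⟨2 * C / (1 - Real.exp (-γ)), γ, div_pos (by positivity) (sub_pos.2 ?_), hγ,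
      OTSP.law_deathTime_le p hC hγ h⟩
    exact Real.exp_lt_one_iff.2 (neg_neg_of_pos hγ)
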